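/- Let $T>0$ and let $n,m,k$ be dimensions. Write $\mathbb S^p$ for the symmetric real $p\times p$ matrices, $\mathbb S^p_+$ for the positive semidefinite ones, $\le$ for the Loewner order, $|\cdot|$ for the spectral norm, and $\Delta^*[0,T]=\{(t,s):0\le t\le s\le T\}$. Let $H\in\mathbb R^{m\times n}$ and assume: (H1) $A,C\in L^\infty(0,T;\mathbb R^{n\times n})$, $B,D\in L^\infty(0,T;\mathbb R^{n\times k})$, $\widehat A\in L^\infty(0,T;\mathbb R^{m\times n})$, $\widehat B\in L^\infty(0,T;\mathbb R^{m\times k})$, $\widehat C,\widehat D\in L^\infty(0,T;\mathbb R^{m\times m})$, $Q\in C([0,T]^2;\mathbb S^n)$, $R\in C([0,T]^2;\mathbb S^k)$, $M,N\in C([0,T]^2;\mathbb S^m)$, $G_1\in C([0,T];\mathbb S^n)$, $G_2\in C([0,T];\mathbb S^m)$. (H2) There is a constant $\delta>0$ such that $R(t,s)\ge\delta I$, $G_2(t)\ge\delta I$, $Q(t,s)\ge0$, $M(t,s)\ge0$, $N(t,s)\ge0$ and $G_1(t)\ge0$ whenever $0\le t\le s\le T$. (H3) There are positive definite matrices $\widehat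 Q,\widehat R,\widehat M,\widehat N,\widehat G_1,\widehat G_2$ such that, whenever $0\le t\le\tau\le s\le T$, $Q(t,s)\le Q(\tau,s)\le\widehat Q$, $R(t,s)\le R(\tau,s)\le\widehat R$, $M(t,s)\le M(\tau,s)\le\widehat M$, $N(t,s)\le N(\tau,s)\le\widehat N$, $G_1(t)\le G_1(\tau)\le\widehat G_1$ and $G_2(t)\le G_2(\tau)\le\widehat G_2$. Consider the equilibrium Riccati equation (ERE) $$\begin{cases}\dfrac{dP_1(t,s)}{ds}+P_1(t,s)A_\Theta(s)+A_\Theta(s)^\top P_1(t,s)+C_\Theta(s)^\top P_1(t,s)C_\Theta(s)+Q(t,s)+\Theta(s)^\top R(t,s)\Theta(s)\\ \qquad+P_2(s)^\top M(t,s)P_2(s)+C_\Theta(s)^\top P_2(s)^\top N(t,s)P_2(s)C_\Theta(s)=0,&0\le t\le s\le T,\\[4pt] \dfrac{dP_2(s)}{ds}+P_2(s)A_\Theta(s)+\widehat A_\Theta(s)+\widehat C(s)P_2(s)+\widehat D(s)P_2(s)C_\Theta(s)=0,&0\le s\le T,\\[4pt] P_1(t,T)=G_1(t),\quad P_2(T)=H,&0\le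 t\le T,\end{cases}$$ where $A_\Theta=A+B\Theta$, $C_\Theta=C+D\Theta$, $\widehat A_\Theta=\widehat A+\widehat B\Theta$ and $$\begin{aligned}\Theta(s)=&-\big[R(s,s)+D(s)^\top\big(P_1(s,s)+P_2(s)^\top N(s,s)P_2(s)\big)D(s)\big]^{-1}\big[B(s)^\top P_1(s,s)\\&+D(s)^\top\big(P_1(s,s)+P_2(s)^\top N(s,s)P_2(s)\big)C(s)+\big(\widehat B(s)^\top+B(s)^\top P_2(s)^\top+D(s)^\top P_2(s)^\top\widehat D(s)^\top\big)G_2(s)P_2(s)\big].\end{aligned}$$ Since the coefficients are only bounded and measurable in time, the differential equations are understood in integrated form (equivalently: absolutely continuous in $s$ and satisfied for almost every $s$). Then the ERE has a unique solution $(P_1,P_2)\in C(\Delta^*[0,T];\mathbb S^n_+)\times C([0,T];\mathbb R^{m\times n})$. Moreover, $$\sup_{t\in[0,T]}\big|P_1(t,t)+P_2(t)^\top G_2(t)P_2(t)\big|\le\mathcal C^*_{\mathbb V},$$ where, with $\widehat{\mathcal G}=\max\{|\widehat G_1|,|\widehat G_2|\}$, $$\mathcal C^*_{\mathbb V}=\Big[\widehat{\mathcal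 G}+\widehat{\mathcal G}|H|^2+\int_0^T\big(|\widehat Q|+\widehat{\mathcal G}^2|\widehat A(s)|^2\big)ds\Big]\exp\Big(\int_0^T\Big[2|A(s)|+|C(s)|^2+\frac n\delta\big(1+|\widehat M|+|\widehat N||C(s)|^2+2\widehat{\mathcal G}|\widehat C(s)|+2\widehat{\mathcal G}|C(s)||\widehat D(s)|\big)\Big]ds\Big).$$ -/

import Mathlib

open MeasureTheory Set
open scoped Matrix Matrix.Norms.L2Operator

/-! Throughout, the norm on real matrices (square or rectangular) is the spectral norm: the scope
`Matrix.Norms.L2Operator` makes the operator norm between Euclidean spaces the norm instance. -/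

/-- The triangle of pairs `(t, s)` with `0 ≤ t ≤ s ≤ T`. -/
def triangle (T : ℝ) : Set (ℝ × ℝ) :=
  {p | 0 ≤ p.1 ∧ p.1 ≤ p.2 ∧ p.2 ≤ T}

/-- Raw data of the problem: state dimension `n`, dimension `m` of the backward component, control
dimension `k`. A trailing `h` stands for a hat in `Ah, Bh, Ch, Dh`. The functions are total, but
only their values for times in `[0, T]` are ever used. -/
structure LQData (n m k : ℕ) where
  /-- drift of the forward state -/
  A : ℝ → Matrix (Fin n) (Fin n) ℝ
  /-- control in the drift -/
  B : ℝ → Matrix (Fin n) (Fin k) ℝ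
  /-- diffusion of the forward state -/
  C : ℝ → Matrix (Fin n) (Fin n) ℝ
  /-- control in the diffusion -/
  D : ℝ → Matrix (Fin n) (Fin k) ℝ
  /-- forward state in the backward driver -/
  Ah : ℝ → Matrix (Fin m) (Fin n) ℝ
  /-- control in the backward driver -/
  Bh : ℝ → Matrix (Fin m) (Fin k) ℝ
  /-- coefficient of `Y` in the backward driver -/
  Ch : ℝ → Matrix (Fin m) (Fin m) ℝ
  /-- coefficient of `Z` in the backward driver -/
  Dh : ℝ → Matrix (Fin m) (Fin m) ℝ
  /-- terminal matrix of the backward equation -/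
  H : Matrix (Fin m) (Fin n) ℝ
  /-- running weight of the forward state -/
  Q : ℝ → ℝ → Matrix (Fin n) (Fin n) ℝ
  /-- running weight of the control -/
  R : ℝ → ℝ → Matrix (Fin k) (Fin k) ℝ
  /-- running weight of `Y` -/
  M : ℝ → ℝ → Matrix (Fin m) (Fin m) ℝ
  /-- running weight of `Z` -/
  N : ℝ → ℝ → Matrix (Fin m) (Fin m) ℝ
  /-- terminal weight of the forward state -/
  G1 : ℝ → Matrix (Fin n) (Fin n) ℝ
  /-- initial weight of `Y` -/
  G2 : ℝ → Matrix (Fin m) (Fin m) ℝ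

/-- The upper bounds (the hatted weights) that dominate the weights. -/
structure WeightBounds (n m k : ℕ) where
  /-- bound for `Q` -/
  Q : Matrix (Fin n) (Fin n) ℝ
  /-- bound for `R` -/
  R : Matrix (Fin k) (Fin k) ℝ
  /-- bound for `M` -/
  M : Matrix (Fin m) (Fin m) ℝ
  /-- bound for `N` -/
  N : Matrix (Fin m) (Fin m) ℝ
  /-- bound for `G1` -/
  G1 : Matrix (Fin n) (Fin n) ℝ
  /-- bound for `G2` -/
  G2 : Matrix (Fin m) (Fin m) ℝ

/-- `f` belongs to `L^∞(0, T)`: measurable (up to null sets) and essentially bounded. -/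
def BoundedMeasurable {p q : ℕ} (T : ℝ) (f : ℝ → Matrix (Fin p) (Fin q) ℝ) : Prop :=
  MemLp f ⊤ (volume.restrict (Icc 0 T))

/-- `F` belongs to `C([0, T]²; 𝕊^p)`. -/
def SymmContinuous₂ {p : ℕ} (T : ℝ) (F : ℝ → ℝ → Matrix (Fin p) (Fin p) ℝ) : Prop :=
  ContinuousOn (Function.uncurry F) (Icc 0 T ×ˢ Icc 0 T) ∧
    ∀ t ∈ Icc 0 T, ∀ s ∈ Icc 0 T, (F t s).IsSymm

/-- `G` belongs to `C([0, T]; 𝕊^p)`. -/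
def SymmContinuous {p : ℕ} (T : ℝ) (G : ℝ → Matrix (Fin p) (Fin p) ℝ) : Prop :=
  ContinuousOn G (Icc 0 T) ∧ ∀ t ∈ Icc 0 T, (G t).IsSymm

namespace LQData

variable {n m k : ℕ}

/-- Regularity: bounded measurable system coefficients, continuous symmetric weights. -/
structure Regular (d : LQData n m k) (T : ℝ) : Prop where
  A : BoundedMeasurable T d.A
  B : BoundedMeasurable T d.B
  C : BoundedMeasurable T d.C
  D : BoundedMeasurable T d.D
  Ah : BoundedMeasurable T d.Ah
  Bh : BoundedMeasurable T d.Bh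
  Ch : BoundedMeasurable T d.Ch
  Dh : BoundedMeasurable T d.Dh
  Q : SymmContinuous₂ T d.Q
  R : SymmContinuous₂ T d.R
  M : SymmContinuous₂ T d.M
  N : SymmContinuous₂ T d.N
  G1 : SymmContinuous T d.G1
  G2 : SymmContinuous T d.G2

/-- Positivity of the weights, with constant `δ > 0`. -/
structure Positive (d : LQData n m k) (T δ : ℝ) : Prop where
  δ_pos : 0 < δ
  R : ∀ t s, 0 ≤ t → t ≤ s → s ≤ T → (d.R t s - δ • 1).PosSemidef
  G2 : ∀ t, 0 ≤ t → t ≤ T → (d.G2 t - δ • 1).PosSemidef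
  Q : ∀ t s, 0 ≤ t → t ≤ s → s ≤ T → (d.Q t s).PosSemidef
  M : ∀ t s, 0 ≤ t → t ≤ s → s ≤ T → (d.M t s).PosSemidef
  N : ∀ t s, 0 ≤ t → t ≤ s → s ≤ T → (d.N t s).PosSemidef
  G1 : ∀ t, 0 ≤ t → t ≤ T → (d.G1 t).PosSemidef

/-- Monotonicity of the weights in their first variable, with positive definite upper bounds. -/
structure Monotone (d : LQData n m k) (T : ℝ) (b : WeightBounds n m k) : Prop where
  Q_posDef : b.Q.PosDef
  R_posDef : b.R.PosDef
  M_posDef : b.M.PosDef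
  N_posDef : b.N.PosDef
  G1_posDef : b.G1.PosDef
  G2_posDef : b.G2.PosDef
  Q : ∀ t τ s, 0 ≤ t → t ≤ τ → τ ≤ s → s ≤ T →
    (d.Q τ s - d.Q t s).PosSemidef ∧ (b.Q - d.Q τ s).PosSemidef
  R : ∀ t τ s, 0 ≤ t → t ≤ τ → τ ≤ s → s ≤ T →
    (d.R τ s - d.R t s).PosSemidef ∧ (b.R - d.R τ s).PosSemidef
  M : ∀ t τ s, 0 ≤ t → t ≤ τ → τ ≤ s → s ≤ T →
    (d.M τ s - d.M t s).PosSemidef ∧ (b.M - d.M τ s).PosSemidef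
  N : ∀ t τ s, 0 ≤ t → t ≤ τ → τ ≤ s → s ≤ T →
    (d.N τ s - d.N t s).PosSemidef ∧ (b.N - d.N τ s).PosSemidef
  G1 : ∀ t τ, 0 ≤ t → t ≤ τ → τ ≤ T →
    (d.G1 τ - d.G1 t).PosSemidef ∧ (b.G1 - d.G1 τ).PosSemidef
  G2 : ∀ t τ, 0 ≤ t → t ≤ τ → τ ≤ T →
    (d.G2 τ - d.G2 t).PosSemidef ∧ (b.G2 - d.G2 τ).PosSemidef

/-- The matrix that is inverted in the definition of `Θ`. -/
def gram (d : LQData n m k) (P₁ : ℝ → ℝ → Matrix (Fin n) (Fin n) ℝ)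
    (P₂ : ℝ → Matrix (Fin m) (Fin n) ℝ) (s : ℝ) : Matrix (Fin k) (Fin k) ℝ :=
  d.R s s + (d.D s)ᵀ * (P₁ s s + (P₂ s)ᵀ * d.N s s * P₂ s) * d.D s

/-- The feedback `Θ` determined by `P₁` and `P₂`. -/
noncomputable def feedback (d : LQData n m k) (P₁ : ℝ → ℝ → Matrix (Fin n) (Fin n) ℝ)
    (P₂ : ℝ → Matrix (Fin m) (Fin n) ℝ) (s : ℝ) : Matrix (Fin k) (Fin n) ℝ :=
  -((d.gram P₁ P₂ s)⁻¹ *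
    ((d.B s)ᵀ * P₁ s s + (d.D s)ᵀ * (P₁ s s + (P₂ s)ᵀ * d.N s s * P₂ s) * d.C s
      + ((d.Bh s)ᵀ + (d.B s)ᵀ * (P₂ s)ᵀ + (d.D s)ᵀ * (P₂ s)ᵀ * (d.Dh s)ᵀ) * d.G2 s * P₂ s))

/-- `A + BΘ`. -/
def closedA (d : LQData n m k) (Θ : ℝ → Matrix (Fin k) (Fin n) ℝ) (s : ℝ) :
    Matrix (Fin n) (Fin n) ℝ :=
  d.A s + d.B s * Θ s

/-- `C + DΘ`. -/
def closedC (d : LQData n m k) (Θ : ℝ → Matrix (Fin k) (Fin n) ℝ) (s : ℝ) :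
    Matrix (Fin n) (Fin n) ℝ :=
  d.C s + d.D s * Θ s

/-- `Â + B̂Θ`. -/
def closedAh (d : LQData n m k) (Θ : ℝ → Matrix (Fin k) (Fin n) ℝ) (s : ℝ) :
    Matrix (Fin m) (Fin n) ℝ :=
  d.Ah s + d.Bh s * Θ s

/-- The function `F₁` for which the first equation reads `dP₁(t, s)/ds + F₁(t, s) = 0`. -/
def rhs₁ (d : LQData n m k) (P₁ : ℝ → ℝ → Matrix (Fin n) (Fin n) ℝ)
    (P₂ : ℝ → Matrix (Fin m) (Fin n) ℝ) (Θ : ℝ → Matrix (Fin k) (Fin n) ℝ) (t s : ℝ) :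
    Matrix (Fin n) (Fin n) ℝ :=
  P₁ t s * d.closedA Θ s + (d.closedA Θ s)ᵀ * P₁ t s
    + (d.closedC Θ s)ᵀ * P₁ t s * d.closedC Θ s
    + d.Q t s + (Θ s)ᵀ * d.R t s * Θ s + (P₂ s)ᵀ * d.M t s * P₂ s
    + (d.closedC Θ s)ᵀ * (P₂ s)ᵀ * d.N t s * P₂ s * d.closedC Θ s

/-- The function `F₂` for which the second equation reads `dP₂(s)/ds + F₂(s) = 0`. -/
def rhs₂ (d : LQData n m k) (P₂ : ℝ → Matrix (Fin m) (Fin n) ℝ)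
    (Θ : ℝ → Matrix (Fin k) (Fin n) ℝ) (s : ℝ) : Matrix (Fin m) (Fin n) ℝ :=
  P₂ s * d.closedA Θ s + d.closedAh Θ s + d.Ch s * P₂ s + d.Dh s * P₂ s * d.closedC Θ s

/-- `(P₁, P₂)` is a solution of the equilibrium Riccati equation on `[0, T]` in the class
`C(Δ*[0, T]; 𝕊₊ⁿ) × C([0, T]; ℝ^{m × n})`. As the coefficients are merely measurable in time, the
differential equations with their terminal conditions are understood in Carathéodory's sense, that
is, in integrated form with an integrable right-hand side. The matrix inverse in the definition of
`Θ` is required to be a true inverse. -/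
structure IsSolution (d : LQData n m k) (T : ℝ) (P₁ : ℝ → ℝ → Matrix (Fin n) (Fin n) ℝ)
    (P₂ : ℝ → Matrix (Fin m) (Fin n) ℝ) : Prop where
  continuousOn₁ : ContinuousOn (Function.uncurry P₁) (triangle T)
  continuousOn₂ : ContinuousOn P₂ (Icc 0 T)
  posSemidef : ∀ t s, 0 ≤ t → t ≤ s → s ≤ T → (P₁ t s).PosSemidef
  isUnit_gram : ∀ s ∈ Icc 0 T, IsUnit (d.gram P₁ P₂ s)
  integrable₁ : ∀ t ∈ Icc 0 T,
    IntervalIntegrable (d.rhs₁ P₁ P₂ (d.feedback P₁ P₂) t) volume t T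
  integrable₂ : IntervalIntegrable (d.rhs₂ P₂ (d.feedback P₁ P₂)) volume 0 T
  eq₁ : ∀ t s, 0 ≤ t → t ≤ s → s ≤ T →
    P₁ t s = d.G1 t + ∫ r in s..T, d.rhs₁ P₁ P₂ (d.feedback P₁ P₂) t r
  eq₂ : ∀ s ∈ Icc 0 T,
    P₂ s = d.H + ∫ r in s..T, d.rhs₂ P₂ (d.feedback P₁ P₂) r

/-- The larger of the spectral norms of the bounds for `G1` and `G2`. -/
noncomputable def gHat (b : WeightBounds n m k) : ℝ :=
  max ‖b.G1‖ ‖b.G2‖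

/-- The explicit constant that bounds `P₁(t, t) + P₂(t)ᵀ G₂(t) P₂(t)`. -/
noncomputable def valueBound (d : LQData n m k) (T δ : ℝ) (b : WeightBounds n m k) : ℝ :=
  (gHat b + gHat b * ‖d.H‖ ^ 2 + ∫ s in (0 : ℝ)..T, (‖b.Q‖ + gHat b ^ 2 * ‖d.Ah s‖ ^ 2)) *
    Real.exp (∫ s in (0 : ℝ)..T,
      (2 * ‖d.A s‖ + ‖d.C s‖ ^ 2
        + (n : ℝ) / δ * (1 + ‖b.M‖ + ‖b.N‖ * ‖d.C s‖ ^ 2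
          + 2 * gHat b * ‖d.Ch s‖ + 2 * gHat b * ‖d.C s‖ * ‖d.Dh s‖)))

end LQData

/-! Read backward from `T`, the equation is a Volterra equation for `Z(t, s) = (P₁(t, s), P₂(s))`:
the integrand at `(t, r)` depends on `Z(t, r)` and, through `Θ`, on the diagonal value `Z(r, r)`. If
the integrand were bounded and globally Lipschitz, some Picard iterate would be a contraction of
`C(Δ*[0, T])` (`exists_unique_volterra`). It is only locally Lipschitz, and the inverse in `Θ` is
under control only where `P₁ ≥ 0`. The arguments are therefore composed with Lipschitz retractions:
off the diagonal onto a ball of radius `K`, on the diagonal onto the part of that ball where `R ≥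
δ`, `N ≥ 0` and `P₁ ≥ 0`. The task is to show that for large `K` the truncations are inactive.

Suppose `‖Z‖ ≤ K` for second times in `[a, T]`. Whatever the truncated feedback is, `P₁(t, ·)`
solves a linear Lyapunov equation with positive semidefinite source and terminal value, so `P₁ ≥ 0`
(`posSemidef_of_lyapunov`). By monotonicity of the weights the same argument applies to `P₁(u, ·) -
P₁(t, ·)` for `t ≤ u`, so `P₁(t, s) ≤ P₁(s, s)`. Hence both truncations are inactive on `[a, T]`.

The a priori bound concerns `V(t) = P₁(t, t) + P₂(t)ᵀ G₂(t) P₂(t)`. The weights are merely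
continuous in `t`, so `V` need not be differentiable; but `P₁(t, u) ≤ P₁(u, u)` and `G₂(t) ≤ G₂(u)`
give a one-sided estimate of `V(t)` by `V(u)` plus the integrated drift, up to a small error
(`value_step`). The feedback completes the square: its contribution to the drift is `-Θᵀ (R + Dᵀ (P₁
+ P₂ᵀ N P₂) D) Θ ≤ 0`, so the drift is at most that of the uncontrolled system, which is affine in
`‖V‖` (`Config.quad_drift_le`). Grönwall's inequality in one-step form (`backward_gronwall`) then
bounds `V` independently of `K`.

Since `‖P₁(t, s)‖ ≤ ‖P₁(s, s)‖ ≤ ‖V(s)‖` and `δ ‖P₂‖² ≤ ‖V‖`, the solution stays in a ball whose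
radius does not depend on `K`. With `K` larger by one, uniform continuity extends confinement from
`[a, T]` to the left by a fixed length, and finitely many extensions reach `0` (`Confined.to_zero`).
Uniqueness follows because any two solutions solve a common truncated system. -/

namespace Matrix

/-! ### Spectral norm, quadratic forms and the Loewner order. -/

variable {p q r : ℕ}

lemma l2_opNorm_transpose (A : Matrix (Fin p) (Fin q) ℝ) : ‖Aᵀ‖ = ‖A‖ := by
  rw [← conjTranspose_eq_transpose_of_trivial, l2_opNorm_conjTranspose]

lemma sq_norm_toLp (x : Fin p → ℝ) : ‖WithLp.toLp 2 x‖ ^ 2 = x ⬝ᵥ x := by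
  rw [EuclideanSpace.real_norm_sq_eq]
  simp [dotProduct, sq]

lemma abs_dotProduct_mulVec_le (A : Matrix (Fin p) (Fin q) ℝ) (x : Fin p → ℝ) (y : Fin q → ℝ) :
    |x ⬝ᵥ (A *ᵥ y)| ≤ ‖A‖ * ‖WithLp.toLp 2 x‖ * ‖WithLp.toLp 2 y‖ := by
  have h1 : x ⬝ᵥ (A *ᵥ y) = inner ℝ (WithLp.toLp 2 (A *ᵥ y)) (WithLp.toLp 2 x) := by
    rw [EuclideanSpace.inner_toLp_toLp]; simp
  have h2 := l2_opNorm_mulVec A (WithLp.toLp 2 y)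
  rw [h1]
  calc _ ≤ _ := abs_real_inner_le_norm _ _
    _ ≤ (‖A‖ * ‖WithLp.toLp 2 y‖) * ‖WithLp.toLp 2 x‖ := by
      gcongr; simpa using h2
    _ = _ := by ring

/-- The quadratic form of a real square matrix. -/
def quad (P : Matrix (Fin p) (Fin p) ℝ) (x : Fin p → ℝ) : ℝ := x ⬝ᵥ (P *ᵥ x)

lemma abs_quad_le (P : Matrix (Fin p) (Fin p) ℝ) (x : Fin p → ℝ) :
    |P.quad x| ≤ ‖P‖ * (x ⬝ᵥ x) := by
  rw [← sq_norm_toLp, sq, ← mul_assoc]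
  exact abs_dotProduct_mulVec_le P x x

lemma quad_le (P : Matrix (Fin p) (Fin p) ℝ) (x : Fin p → ℝ) :
    P.quad x ≤ ‖P‖ * (x ⬝ᵥ x) := (le_abs_self _).trans (abs_quad_le P x)

lemma quad_add (P Q : Matrix (Fin p) (Fin p) ℝ) (x : Fin p → ℝ) :
    (P + Q).quad x = P.quad x + Q.quad x := by simp [quad, add_mulVec]

lemma quad_sub (P Q : Matrix (Fin p) (Fin p) ℝ) (x : Fin p → ℝ) :
    (P - Q).quad x = P.quad x - Q.quad x := by simp [quad, sub_mulVec]

lemma quad_smul_one (c : ℝ) (x : Fin p → ℝ) :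
    (c • (1 : Matrix (Fin p) (Fin p) ℝ)).quad x = c * (x ⬝ᵥ x) := by
  simp [quad, smul_mulVec]

lemma quad_transpose_mul_mul (P : Matrix (Fin p) (Fin p) ℝ) (A : Matrix (Fin p) (Fin q) ℝ)
    (x : Fin q → ℝ) : (Aᵀ * P * A).quad x = P.quad (A *ᵥ x) := by
  simp only [quad, ← mulVec_mulVec, dotProduct_mulVec, vecMul_transpose]

lemma dotProduct_mulVec_self_le (A : Matrix (Fin p) (Fin q) ℝ) (x : Fin q → ℝ) :
    (A *ᵥ x) ⬝ᵥ (A *ᵥ x) ≤ ‖A‖ ^ 2 * (x ⬝ᵥ x) := by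
  rw [← sq_norm_toLp, ← sq_norm_toLp, ← mul_pow]
  have h2 := l2_opNorm_mulVec A (WithLp.toLp 2 x)
  gcongr
  simpa using h2

lemma dotProduct_self_nonneg' (x : Fin p → ℝ) : 0 ≤ x ⬝ᵥ x := by
  rw [← sq_norm_toLp]; positivity

lemma l2_opNorm_le_of_forall (A : Matrix (Fin p) (Fin q) ℝ) {c : ℝ} (hc : 0 ≤ c)
    (h : ∀ x, (A *ᵥ x) ⬝ᵥ (A *ᵥ x) ≤ c ^ 2 * (x ⬝ᵥ x)) : ‖A‖ ≤ c := by
  rw [l2_opNorm_def]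
  refine ContinuousLinearMap.opNorm_le_bound _ hc fun x => ?_
  have := h (WithLp.ofLp x)
  rw [← sq_norm_toLp, ← sq_norm_toLp, ← mul_pow] at this
  change ‖WithLp.toLp 2 (A *ᵥ x.ofLp)‖ ≤ c * ‖x‖
  exact le_of_sq_le_sq this (by positivity)

lemma PosSemidef.quad_nonneg {P : Matrix (Fin p) (Fin p) ℝ} (hP : P.PosSemidef) (x : Fin p → ℝ) :
    0 ≤ P.quad x := by simpa [quad] using hP.dotProduct_mulVec_nonneg x

lemma PosSemidef.transpose_eq {P : Matrix (Fin p) (Fin p) ℝ} (hP : P.PosSemidef) : Pᵀ = P := by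
  simpa using hP.1.eq

lemma posSemidef_of_quad {P : Matrix (Fin p) (Fin p) ℝ} (hs : Pᵀ = P) (h : ∀ x, 0 ≤ P.quad x) :
    P.PosSemidef :=
  .of_dotProduct_mulVec_nonneg (by simpa [IsHermitian] using hs) (by simpa [quad] using h)

lemma PosSemidef.transpose_mul_mul {P : Matrix (Fin p) (Fin p) ℝ} (hP : P.PosSemidef)
    (A : Matrix (Fin p) (Fin q) ℝ) : (Aᵀ * P * A).PosSemidef := by
  simpa using hP.conjTranspose_mul_mul_same A

/-- Cauchy–Schwarz for the semi-inner product of `P`: the polynomial `c ↦ P.quad (c • x + y)` is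
nonnegative, so its discriminant is not positive. -/
lemma PosSemidef.dotProduct_mulVec_sq_le {P : Matrix (Fin p) (Fin p) ℝ} (hP : P.PosSemidef)
    (x y : Fin p → ℝ) : (y ⬝ᵥ (P *ᵥ x)) ^ 2 ≤ P.quad x * P.quad y := by
  have key : ∀ c : ℝ, 0 ≤ P.quad x * (c * c) + 2 * (y ⬝ᵥ (P *ᵥ x)) * c + P.quad y := by
    intro c
    have h := hP.quad_nonneg (c • x + y)
    have hs : x ⬝ᵥ (P *ᵥ y) = y ⬝ᵥ (P *ᵥ x) := by
      rw [dotProduct_mulVec, ← mulVec_transpose, hP.transpose_eq, dotProduct_comm]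
    simp only [quad, mulVec_add, mulVec_smul, dotProduct_add, add_dotProduct, smul_dotProduct,
      dotProduct_smul, smul_eq_mul, hs] at h ⊢
    linarith
  have := discrim_le_zero key
  rw [discrim] at this
  nlinarith

/-- Cauchy–Schwarz with `y = P x` gives `|Px|⁴ ≤ P.quad x * P.quad (P x) ≤ c² |x|² |Px|²`; cancel
`|Px|²`. -/
lemma PosSemidef.l2_opNorm_le {P : Matrix (Fin p) (Fin p) ℝ} (hP : P.PosSemidef) {c : ℝ}
    (hc : 0 ≤ c) (h : ∀ x, P.quad x ≤ c * (x ⬝ᵥ x)) : ‖P‖ ≤ c := by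
  refine l2_opNorm_le_of_forall P hc fun x => ?_
  have h1 := hP.dotProduct_mulVec_sq_le x (P *ᵥ x)
  have h2 := h x
  have h3 := h (P *ᵥ x)
  have h4 := hP.quad_nonneg x
  have h5 := hP.quad_nonneg (P *ᵥ x)
  have h6 := dotProduct_self_nonneg' x
  have h7 := dotProduct_self_nonneg' (P *ᵥ x)
  set a := (P *ᵥ x) ⬝ᵥ (P *ᵥ x)
  rcases h7.eq_or_lt with h0 | h0
  · rw [← h0]; positivity
  · have : a * a ≤ (c ^ 2 * (x ⬝ᵥ x)) * a := by
      calc a * a = a ^ 2 := by ring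
        _ ≤ _ := h1
        _ ≤ (c * (x ⬝ᵥ x)) * (c * a) := by gcongr
        _ = _ := by ring
    exact le_of_mul_le_mul_right this h0

lemma PosSemidef.l2_opNorm_le_of_sub {P Q : Matrix (Fin p) (Fin p) ℝ} (hP : P.PosSemidef)
    (hQ : (Q - P).PosSemidef) : ‖P‖ ≤ ‖Q‖ := by
  refine hP.l2_opNorm_le (norm_nonneg _) fun x => ?_
  have := hQ.quad_nonneg x
  rw [quad_sub] at this
  linarith [quad_le Q x]

/-- Used with `A = P₂` and `G = G₂`: this is how the value controls the size of `P₂`. -/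
lemma mul_sq_l2_opNorm_le {G : Matrix (Fin p) (Fin p) ℝ} {δ : ℝ} (hδ : 0 < δ)
    (hG : (G - δ • 1).PosSemidef) (A : Matrix (Fin p) (Fin q) ℝ) :
    δ * ‖A‖ ^ 2 ≤ ‖Aᵀ * G * A‖ := by
  have h : ‖A‖ ≤ Real.sqrt (‖Aᵀ * G * A‖ / δ) := by
    refine l2_opNorm_le_of_forall A (Real.sqrt_nonneg _) fun x => ?_
    rw [Real.sq_sqrt (by positivity)]
    have h1 := hG.quad_nonneg (A *ᵥ x)
    rw [quad_sub, quad_smul_one, ← quad_transpose_mul_mul] at h1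
    have h2 := quad_le (Aᵀ * G * A) x
    rw [div_mul_eq_mul_div, le_div_iff₀ hδ]
    linarith
  have h2 : ‖A‖ ^ 2 ≤ ‖Aᵀ * G * A‖ / δ := by
    rw [← Real.sq_sqrt (show 0 ≤ ‖Aᵀ * G * A‖ / δ by positivity)]
    gcongr
  rw [le_div_iff₀ hδ] at h2
  linarith

lemma posDef_of_sub_smul_one {X : Matrix (Fin p) (Fin p) ℝ} {δ : ℝ} (hδ : 0 < δ)
    (hX : (X - δ • 1).PosSemidef) : X.PosDef := by
  have : ((δ • 1 : Matrix (Fin p) (Fin p) ℝ)).PosDef := PosDef.one.smul hδ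
  simpa using this.posSemidef_add hX

/-- With `y = X⁻¹ x`, coercivity and Young's inequality give `δ |y|² ≤ y ⬝ᵥ x ≤ (δ |y|² + |x|² / δ)
/ 2`. -/
lemma l2_opNorm_inv_le {X : Matrix (Fin p) (Fin p) ℝ} {δ : ℝ} (hδ : 0 < δ)
    (hX : (X - δ • 1).PosSemidef) : ‖X⁻¹‖ ≤ 1 / δ := by
  have hu := (posDef_of_sub_smul_one hδ hX).isUnit
  have hdet : IsUnit X.det := (isUnit_iff_isUnit_det X).1 hu
  refine l2_opNorm_le_of_forall _ (by positivity) fun x => ?_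
  set y := X⁻¹ *ᵥ x with hy
  have hxy : X *ᵥ y = x := by rw [hy, mulVec_mulVec, mul_nonsing_inv _ hdet, one_mulVec]
  have h1 := hX.quad_nonneg y
  rw [quad_sub, quad_smul_one, quad, hxy] at h1
  have h2 : y ⬝ᵥ x ≤ (δ * (y ⬝ᵥ y) + (x ⬝ᵥ x) / δ) / 2 := by
    have := dotProduct_self_nonneg' (δ • y - x)
    simp only [dotProduct_sub, sub_dotProduct, smul_dotProduct, dotProduct_smul, smul_eq_mul,
      dotProduct_comm x y] at this
    have h3 : δ * ((δ * (y ⬝ᵥ y) + (x ⬝ᵥ x) / δ) / 2) = (δ ^ 2 * (y ⬝ᵥ y) + x ⬝ᵥ x) / 2 := by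
      field_simp
    have : δ * (y ⬝ᵥ x) ≤ δ * ((δ * (y ⬝ᵥ y) + (x ⬝ᵥ x) / δ) / 2) := by rw [h3]; linarith
    exact le_of_mul_le_mul_left this hδ
  have h4 : δ * (y ⬝ᵥ y) ≤ (x ⬝ᵥ x) / δ := by linarith
  rw [div_pow, one_pow, one_div_mul_eq_div, le_div_iff₀ (by positivity)]
  rw [le_div_iff₀ hδ] at h4
  linarith

lemma sub_smul_one_posSemidef_add {R : Matrix (Fin p) (Fin p) ℝ} {δ : ℝ}
    (hR : (R - δ • 1).PosSemidef) {S : Matrix (Fin p) (Fin p) ℝ} (hS : S.PosSemidef) :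
    (R + S - δ • 1).PosSemidef := by
  rw [add_sub_right_comm]; exact hR.add hS

end Matrix

/-! ### Retractions onto closed convex sets -/

section Retraction

/-- The nearest-point projection. Adding its variational inequalities at `x` and at `y` gives `‖ρ x
- ρ y‖² ≤ ⟪x - y, ρ x - ρ y⟫`. -/
lemma exists_nonexpansive_retraction {F : Type*} [NormedAddCommGroup F] [InnerProductSpace ℝ F]
    [CompleteSpace F] {S : Set F} (hne : S.Nonempty) (hcl : IsClosed S) (hcv : Convex ℝ S) :
    ∃ ρ : F → F, LipschitzWith 1 ρ ∧ (∀ x, ρ x ∈ S) ∧ ∀ x ∈ S, ρ x = x := by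
  choose ρ hρ hmin using exists_norm_eq_iInf_of_complete_convex hne hcl.isComplete hcv
  have hin : ∀ u, ∀ w ∈ S, inner ℝ (u - ρ u) (w - ρ u) ≤ 0 := fun u =>
    (norm_eq_iInf_iff_real_inner_le_zero hcv (hρ u)).1 (hmin u)
  have hle : ∀ x y, ‖ρ x - ρ y‖ ≤ ‖x - y‖ := by
    intro x y
    have h1 := hin x (ρ y) (hρ y)
    have h2 := hin y (ρ x) (hρ x)
    have h3 : inner ℝ (x - y) (ρ x - ρ y) ≤ ‖x - y‖ * ‖ρ x - ρ y‖ := real_inner_le_norm _ _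
    have h4 : ‖ρ x - ρ y‖ * ‖ρ x - ρ y‖ ≤ ‖x - y‖ * ‖ρ x - ρ y‖ := by
      rw [← real_inner_self_eq_norm_mul_norm]
      refine le_trans ?_ h3
      have e : inner ℝ (x - y) (ρ x - ρ y) - inner ℝ (ρ x - ρ y) (ρ x - ρ y)
          = -inner ℝ (x - ρ x) (ρ y - ρ x) - inner ℝ (y - ρ y) (ρ x - ρ y) := by
        simp only [inner_sub_left, inner_sub_right]; ring
      linarith
    rcases (norm_nonneg (ρ x - ρ y)).eq_or_lt with h0 | h0
    · rw [← h0]; positivity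
    · exact le_of_mul_le_mul_right h4 h0
  refine ⟨ρ, LipschitzWith.of_dist_le_mul fun x y => ?_, hρ, fun x hx => ?_⟩
  · simpa [dist_eq_norm] using hle x y
  · have := hin x x hx
    rw [real_inner_self_eq_norm_mul_norm] at this
    have h0 : ‖x - ρ x‖ = 0 := by nlinarith [norm_nonneg (x - ρ x)]
    exact (sub_eq_zero.1 (norm_eq_zero.1 h0)).symm

/-- The spaces to be truncated carry maximum norms of operator norms, which are not Hilbertian. A
linear isomorphism with a Euclidean space costs only a Lipschitz constant. -/
lemma exists_lipschitz_retraction {F : Type*} [NormedAddCommGroup F] [NormedSpace ℝ F]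
    [FiniteDimensional ℝ F] {S : Set F} (hne : S.Nonempty) (hcl : IsClosed S) (hcv : Convex ℝ S) :
    ∃ (ρ : F → F) (L : NNReal), LipschitzWith L ρ ∧ (∀ x, ρ x ∈ S) ∧ ∀ x ∈ S, ρ x = x := by
  let e := toEuclidean (E := F)
  have hS : e.symm ⁻¹' S = e '' S := by
    ext x; constructor
    · intro h; exact ⟨_, h, by simp⟩
    · rintro ⟨y, hy, rfl⟩; simpa using hy
  obtain ⟨ρ, h1, h2, h3⟩ := exists_nonexpansive_retraction (S := e.symm ⁻¹' S)
    (by rw [hS]; exact hne.image _) (hcl.preimage e.symm.continuous)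
    (by exact hcv.linear_preimage e.symm.toLinearEquiv.toLinearMap)
  refine ⟨fun x => e.symm (ρ (e x)), _, (e.symm.lipschitz.comp h1).comp e.lipschitz,
    fun x => h2 _, fun x hx => ?_⟩
  have : e x ∈ e.symm ⁻¹' S := by simpa using hx
  simp [h3 _ this]

end Retraction

/-! ### A Grönwall inequality from one-step estimates -/

section Gronwall

/-- Cut `[t, b]` into `N` equal steps shorter than `η`; the errors `ε * (step)` add up to `ε * (b -
t)`. -/
lemma le_of_step {w : ℝ → ℝ} {a b ε η : ℝ} (hη : 0 < η)
    (h : ∀ t τ, a ≤ t → t ≤ τ → τ ≤ b → τ - t < η → w t ≤ w τ + ε * (τ - t)) {t : ℝ}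
    (ha : a ≤ t) (hb : t ≤ b) : w t ≤ w b + ε * (b - t) := by
  obtain ⟨N, hN⟩ := exists_nat_gt ((b - t) / η)
  have hN0 : (0 : ℝ) < N := lt_of_le_of_lt (div_nonneg (sub_nonneg.2 hb) hη.le) hN
  have hstep : (b - t) / N < η := by
    rw [div_lt_iff₀ hη] at hN; rw [div_lt_iff₀ hN0]; linarith
  have hs0 : 0 ≤ (b - t) / N := div_nonneg (sub_nonneg.2 hb) hN0.le
  have key : ∀ j : ℕ, j ≤ N → w t ≤ w (t + j * ((b - t) / N)) + ε * (j * ((b - t) / N)) := by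
    intro j
    induction j with
    | zero => intro _; simp
    | succ j ih =>
      intro hj
      have h1 := ih (by omega)
      have hj0 : 0 ≤ (j : ℝ) * ((b - t) / N) := by positivity
      have hj1 : ((j : ℝ) + 1) * ((b - t) / N) ≤ b - t := by
        have : ((j : ℝ) + 1) ≤ N := by exact_mod_cast hj
        calc _ ≤ (N : ℝ) * ((b - t) / N) := by gcongr
          _ = _ := by field_simp
      have h2 := h (t + j * ((b - t) / N)) (t + (j + 1) * ((b - t) / N)) (by linarith)
        (by linarith) (by linarith) (by linarith)
      push_cast
      linarith
  have := key N le_rfl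
  have e : (N : ℝ) * ((b - t) / N) = b - t := by field_simp
  rw [e] at this
  simpa using this

/-- If `f t ≤ (1 + ∫_t^τ α) f τ + ∫_t^τ β` up to an error that is uniformly small compared with
`τ - t`, then `f` obeys the backward Grönwall bound. -/
lemma backward_gronwall {f α β : ℝ → ℝ} {a b : ℝ}
    (hα : IntervalIntegrable α volume a b) (hβ : IntervalIntegrable β volume a b)
    (hα0 : ∀ r, 0 ≤ α r) (hβ0 : ∀ r, 0 ≤ β r) (hf : ∀ t, 0 ≤ f t)
    (h : ∀ ε > 0, ∃ η > 0, ∀ t τ, a ≤ t → t ≤ τ → τ ≤ b → τ - t < η →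
      f t ≤ f τ * (1 + ∫ r in t..τ, α r) + (∫ r in t..τ, β r) + ε * (τ - t))
    {t : ℝ} (ha : a ≤ t) (hb : t ≤ b) :
    f t ≤ (f b + ∫ r in t..b, β r) * Real.exp (∫ r in t..b, α r) := by
  have sub : ∀ {g : ℝ → ℝ}, IntervalIntegrable g volume a b → ∀ {x y}, a ≤ x → x ≤ b → a ≤ y →
      y ≤ b → IntervalIntegrable g volume x y := by
    intro g hg x y h1 h2 h3 h4
    refine hg.mono_set ?_
    have hab : a ≤ b := h1.trans h2
    rw [uIcc_of_le hab]
    exact uIcc_subset_Icc ⟨h1, h2⟩ ⟨h3, h4⟩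
  -- Integrating factor. As `1 + x ≤ exp x` and `E ≤ 1`, the one-step hypothesis on `f` becomes the
  -- hypothesis of `le_of_step` for `w`; then `ε` tends to zero.
  let E : ℝ → ℝ := fun s => Real.exp (-∫ r in s..b, α r)
  let w : ℝ → ℝ := fun s => f s * E s - ∫ r in s..b, β r
  have hw : ∀ ε > 0, w t ≤ w b + ε * (b - t) := by
    intro ε hε
    obtain ⟨η, hη, H⟩ := h ε hε
    refine le_of_step (a := a) hη (fun s τ h1 h2 h3 h4 => ?_) ha hb
    have hs := H s τ h1 h2 h3 h4
    have i1 := intervalIntegral.integral_add_adjacent_intervals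
      (sub hα h1 (h2.trans h3) (h1.trans h2) h3)
      (sub hα (h1.trans h2) h3 (h1.trans (h2.trans h3)) le_rfl)
    have i2 := intervalIntegral.integral_add_adjacent_intervals
      (sub hβ h1 (h2.trans h3) (h1.trans h2) h3)
      (sub hβ (h1.trans h2) h3 (h1.trans (h2.trans h3)) le_rfl)
    have hE : E s = E τ * Real.exp (-∫ r in s..τ, α r) := by
      simp only [E]; rw [← Real.exp_add, ← i1]; ring_nf
    have hE1 : E s ≤ 1 := by
      refine Real.exp_le_one_iff.2 (neg_nonpos.2 ?_)
      exact intervalIntegral.integral_nonneg (h2.trans h3) fun r _ => hα0 r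
    have hE0 : 0 < E s := Real.exp_pos _
    have hβi : 0 ≤ ∫ r in s..τ, β r := intervalIntegral.integral_nonneg h2 fun r _ => hβ0 r
    have hm : E s * (1 + ∫ r in s..τ, α r) ≤ E τ := by
      calc E s * (1 + ∫ r in s..τ, α r) ≤ E s * Real.exp (∫ r in s..τ, α r) := by
            gcongr; linarith [Real.add_one_le_exp (∫ r in s..τ, α r)]
        _ = E τ := by rw [hE, mul_assoc, ← Real.exp_add]; simp
    have : f s * E s ≤ f τ * E τ + (∫ r in s..τ, β r) + ε * (τ - s) := by
      calc f s * E s ≤ (f τ * (1 + ∫ r in s..τ, α r) + (∫ r in s..τ, β r) + ε * (τ - s)) * E s := by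
            gcongr
        _ = f τ * (E s * (1 + ∫ r in s..τ, α r)) + ((∫ r in s..τ, β r) + ε * (τ - s)) * E s := by
            ring
        _ ≤ f τ * E τ + ((∫ r in s..τ, β r) + ε * (τ - s)) * 1 := by
            have : 0 ≤ ε * (τ - s) := mul_nonneg hε.le (sub_nonneg.2 h2)
            have := hf τ
            gcongr
        _ = _ := by ring
    simp only [w]
    linarith
  have hlim : w t ≤ w b := by
    refine le_of_forall_pos_le_add fun ε hε => ?_
    have := hw (ε / (b - t + 1)) (by have : 0 ≤ b - t := sub_nonneg.2 hb; positivity)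
    refine this.trans ?_
    have h0 : 0 ≤ b - t := sub_nonneg.2 hb
    have : ε / (b - t + 1) * (b - t) ≤ ε := by
      rw [div_mul_eq_mul_div, div_le_iff₀ (by linarith)]; nlinarith
    linarith
  have h1 : f t * E t ≤ f b + ∫ r in t..b, β r := by
    simp only [w, E, intervalIntegral.integral_same, neg_zero, Real.exp_zero] at hlim ⊢; linarith
  calc f t = f t * E t * Real.exp (∫ r in t..b, α r) := by
        rw [mul_assoc, ← Real.exp_add]; simp
    _ ≤ _ := by gcongr

end Gronwall

/-! ### Volterra equations on the triangle -/

section Volterra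

lemma isCompact_triangle (T : ℝ) : IsCompact (triangle T) := by
  refine IsCompact.of_isClosed_subset (isCompact_Icc (a := ((0 : ℝ), (0 : ℝ))) (b := (T, T))) ?_ ?_
  · have : triangle T = {p : ℝ × ℝ | 0 ≤ p.1} ∩ {p | p.1 ≤ p.2} ∩ {p | p.2 ≤ T} := by
      ext p; simp [triangle, and_assoc]
    rw [this]
    exact ((isClosed_le continuous_const continuous_fst).inter
      (isClosed_le continuous_fst continuous_snd)).inter
      (isClosed_le continuous_snd continuous_const)
  · rintro ⟨t, s⟩ ⟨h1, h2, h3⟩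
    exact ⟨⟨h1, h1.trans h2⟩, ⟨h2.trans h3, h3⟩⟩

/-- The retraction of the plane onto the triangle by clamping both coordinates. -/
noncomputable def clampTriangle (T : ℝ) (p : ℝ × ℝ) : ℝ × ℝ :=
  (min (max 0 (min p.1 T)) (max 0 (min p.2 T)), max 0 (min p.2 T))

lemma clampTriangle_mem {T : ℝ} (hT : 0 ≤ T) (p : ℝ × ℝ) : clampTriangle T p ∈ triangle T := by
  refine ⟨le_min (le_max_left _ _) (le_max_left _ _), min_le_right _ _, ?_⟩
  exact max_le hT (min_le_right _ _)

lemma clampTriangle_of_mem {T : ℝ} {t s : ℝ} (h0 : 0 ≤ t) (hts : t ≤ s) (hs : s ≤ T) :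
    clampTriangle T (t, s) = (t, s) := by
  simp [clampTriangle, hs, hts.trans hs, h0, h0.trans hts, hts]

lemma continuous_clampTriangle (T : ℝ) : Continuous (clampTriangle T) := by
  unfold clampTriangle; fun_prop

lemma intervalIntegrable_of_bounded {E : Type*} [NormedAddCommGroup E] {f : ℝ → E} {K T : ℝ}
    (hm : AEStronglyMeasurable f (volume.restrict (Icc 0 T))) (hb : ∀ r, ‖f r‖ ≤ K) {x y : ℝ}
    (hx : x ∈ Icc 0 T) (hy : y ∈ Icc 0 T) : IntervalIntegrable f volume x y := by
  have h1 : IntegrableOn f (Icc 0 T) := by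
    refine Integrable.mono' (g := fun _ => K) (by simp) hm ?_
    exact Filter.Eventually.of_forall hb
  have h0 : (0 : ℝ) ≤ T := hx.1.trans hx.2
  refine (IntervalIntegrable.mono_set (a := 0) (b := T) ?_ ?_)
  · rw [intervalIntegrable_iff_integrableOn_Icc_of_le h0]; exact h1
  · rw [uIcc_of_le h0]; exact uIcc_subset_Icc hx hy

variable {C E : Type*} [NormedAddCommGroup C] [NormedAddCommGroup E] [NormedSpace ℝ E]

/-- Split `∫_s^T = ∫_{s₀}^T - ∫_{s₀}^s`. The first integral has fixed limits and is continuous in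
`t` by dominated convergence; the second is at most `K |s - s₀|`, whatever `t` is. -/
lemma continuousOn_integral_of_bounded {f : ℝ → ℝ → E} {K T : ℝ}
    (hm : ∀ t ∈ Icc 0 T, AEStronglyMeasurable (f t) (volume.restrict (Icc 0 T)))
    (hb : ∀ t r, ‖f t r‖ ≤ K) (hc : ∀ r ∈ Icc 0 T, ContinuousOn (fun t => f t r) (Icc 0 T)) :
    ContinuousOn (fun p : ℝ × ℝ => ∫ r in p.2..T, f p.1 r) (Icc 0 T ×ˢ Icc 0 T) := by
  rintro ⟨t₀, s₀⟩ ⟨ht₀, hs₀⟩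
  simp only at ht₀ hs₀
  have hT : T ∈ Icc 0 T := ⟨hs₀.1.trans hs₀.2, le_rfl⟩
  have h1 : ContinuousWithinAt (fun t => ∫ r in s₀..T, f t r) (Icc 0 T) t₀ := by
    refine intervalIntegral.continuousWithinAt_of_dominated_interval (bound := fun _ => K)
      ?_ ?_ ?_ ?_
    · filter_upwards [self_mem_nhdsWithin] with t ht
      refine (hm t ht).mono_measure (Measure.restrict_mono ?_ le_rfl)
      rw [uIoc_of_le hs₀.2]
      exact fun r hr => ⟨hs₀.1.trans hr.1.le, hr.2⟩
    · exact Filter.Eventually.of_forall fun t => Filter.Eventually.of_forall fun r _ => hb t r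
    · simp
    · refine Filter.Eventually.of_forall fun r hr => ?_
      rw [uIoc_of_le hs₀.2] at hr
      exact hc r ⟨hs₀.1.trans hr.1.le, hr.2⟩ t₀ ht₀
  have h2 : ContinuousWithinAt (fun p : ℝ × ℝ => ∫ r in s₀..T, f p.1 r) (Icc 0 T ×ˢ Icc 0 T)
      (t₀, s₀) := by
    refine ContinuousWithinAt.comp (t := Icc 0 T) (f := Prod.fst) (x := (t₀, s₀)) h1
      continuous_fst.continuousWithinAt fun p hp => hp.1
  have h3 : Filter.Tendsto (fun p : ℝ × ℝ => ∫ r in s₀..p.2, f p.1 r)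
      (nhdsWithin (t₀, s₀) (Icc 0 T ×ˢ Icc 0 T)) (nhds 0) := by
    refine squeeze_zero_norm (a := fun p : ℝ × ℝ => K * |p.2 - s₀|)
      (fun p => intervalIntegral.norm_integral_le_of_norm_le_const fun r _ => hb _ _) ?_
    have : Continuous fun p : ℝ × ℝ => K * |p.2 - s₀| := by fun_prop
    have h := (this.tendsto (t₀, s₀)).mono_left (nhdsWithin_le_nhds (s := Icc 0 T ×ˢ Icc 0 T))
    simpa using h
  have h4 := h2.tendsto.sub h3
  rw [sub_zero] at h4
  refine Filter.Tendsto.congr' ?_ h4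
  filter_upwards [self_mem_nhdsWithin] with p hp
  have := intervalIntegral.integral_add_adjacent_intervals
    (intervalIntegrable_of_bounded (hm p.1 hp.1) (hb p.1) hs₀ hp.2)
    (intervalIntegrable_of_bounded (hm p.1 hp.1) (hb p.1) hp.2 hT)
  rw [← this]; abel

/-- One inductive step of the Picard estimate for the `k`-th iterates. -/
lemma integral_pow_div_factorial (L s T : ℝ) (k : ℕ) :
    ∫ r in s..T, L * ((L * (T - r)) ^ k / k.factorial)
      = (L * (T - s)) ^ (k + 1) / (k + 1).factorial := by
  have h : ∫ r in s..T, (T - r) ^ k = (T - s) ^ (k + 1) / (k + 1) := by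
    rw [intervalIntegral.integral_comp_sub_left (fun x => x ^ k) T, integral_pow]
    simp
  have : ∀ r : ℝ, L * ((L * (T - r)) ^ k / k.factorial)
      = (L ^ (k + 1) / k.factorial) * (T - r) ^ k := by intro r; rw [mul_pow]; ring
  simp_rw [this]
  rw [intervalIntegral.integral_const_mul, h, Nat.factorial_succ, mul_pow]
  have : (k.factorial : ℝ) ≠ 0 := by positivity
  push_cast
  field_simp

/-- Existence and uniqueness for a Volterra equation on the triangle whose integrand depends on the
unknown at `(t, r)` and on the diagonal at `(r, r)`. -/
theorem exists_unique_volterra [CompleteSpace E] {T : ℝ} (hT : 0 ≤ T)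
    {Φ : (C × E) × (C × E) → E} {L : NNReal} (hΦ : LipschitzWith L Φ) {K : ℝ}
    (hK : ∀ z, ‖Φ z‖ ≤ K) {c : ℝ → ℝ → C}
    (hc₁ : ∀ t ∈ Icc 0 T, AEStronglyMeasurable (c t) (volume.restrict (Icc 0 T)))
    (hc₀ : AEStronglyMeasurable (fun r => c r r) (volume.restrict (Icc 0 T)))
    (hc : ∀ r ∈ Icc 0 T, ContinuousOn (fun t => c t r) (Icc 0 T))
    {g : ℝ → E} (hg : ContinuousOn g (Icc 0 T)) :
    ∃ Z : ℝ → ℝ → E, (ContinuousOn (Function.uncurry Z) (triangle T) ∧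
      ∀ t s, 0 ≤ t → t ≤ s → s ≤ T →
        Z t s = g t + ∫ r in s..T, Φ ((c t r, Z t r), (c r r, Z r r))) ∧
      ∀ Y : ℝ → ℝ → E, ContinuousOn (Function.uncurry Y) (triangle T) →
        (∀ t s, 0 ≤ t → t ≤ s → s ≤ T →
          Y t s = g t + ∫ r in s..T, Φ ((c t r, Y t r), (c r r, Y r r))) →
        ∀ t s, 0 ≤ t → t ≤ s → s ≤ T → Y t s = Z t s := by
  have hcomp : CompactSpace (triangle T) := isCompact_iff_compactSpace.1 (isCompact_triangle T)
  let X := C(triangle T, E)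
  -- Clamping extends a function on the triangle continuously to the plane, so that the integrand is
  -- defined and measurable for all times.
  let ext : X → ℝ → ℝ → E := fun Z t r => Z ⟨clampTriangle T (t, r), clampTriangle_mem hT _⟩
  have hext : ∀ Z : X, Continuous (Function.uncurry (ext Z)) := fun Z =>
    Z.continuous.comp ((continuous_clampTriangle T).subtype_mk _)
  have hextp : ∀ (Z : X) (t s : ℝ) (h : (t, s) ∈ triangle T), ext Z t s = Z ⟨(t, s), h⟩ := by
    intro Z t s h
    simp only [ext, clampTriangle_of_mem h.1 h.2.1 h.2.2]
  let I : X → ℝ → ℝ → E := fun Z t r => Φ ((c t r, ext Z t r), (c r r, ext Z r r))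
  have hIm : ∀ Z, ∀ t ∈ Icc 0 T, AEStronglyMeasurable (I Z t) (volume.restrict (Icc 0 T)) := by
    intro Z t ht
    refine hΦ.continuous.comp_aestronglyMeasurable (((hc₁ t ht).prodMk ?_).prodMk (hc₀.prodMk ?_))
    · exact ((hext Z).comp (Continuous.prodMk_right t)).aestronglyMeasurable
    · exact ((hext Z).comp (continuous_id.prodMk continuous_id)).aestronglyMeasurable
  have hIc : ∀ Z, ∀ r ∈ Icc 0 T, ContinuousOn (fun t => I Z t r) (Icc 0 T) := by
    intro Z r hr
    refine hΦ.continuous.comp_continuousOn (((hc r hr).prodMk ?_).prodMk continuousOn_const)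
    exact ((hext Z).comp (Continuous.prodMk_left r)).continuousOn
  have hcont : ∀ Z : X, Continuous fun p : triangle T =>
      g p.1.1 + ∫ r in p.1.2..T, I Z p.1.1 r := by
    intro Z
    have h1 := continuousOn_integral_of_bounded (hIm Z) (fun _ _ => hK _) (hIc Z)
    have h2 : ContinuousOn (fun p : ℝ × ℝ => g p.1) (Icc 0 T ×ˢ Icc 0 T) :=
      hg.comp continuousOn_fst fun p hp => hp.1
    have hsub : triangle T ⊆ Icc 0 T ×ˢ Icc 0 T := by
      rintro ⟨t, s⟩ ⟨h1, h2, h3⟩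
      exact ⟨⟨h1, h2.trans h3⟩, ⟨h1.trans h2, h3⟩⟩
    have h3 : ContinuousOn (fun p : ℝ × ℝ => g p.1 + ∫ r in p.2..T, I Z p.1 r) (triangle T) :=
      (h2.add h1).mono hsub
    exact continuousOn_iff_continuous_domRestrict.1 h3
  let Ψ : X → X := fun Z => ⟨_, hcont Z⟩
  have hΨ : ∀ Z p, Ψ Z p = g p.1.1 + ∫ r in p.1.2..T, I Z p.1.1 r := fun _ _ => rfl
  -- The bound depends on the second coordinate only. It is therefore the same at `(t, r)` and at
  -- `(r, r)`, which makes the diagonal term harmless.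
  have hiter : ∀ (k : ℕ) (Z W : X) (p : triangle T), ‖(Ψ^[k] Z) p - (Ψ^[k] W) p‖
      ≤ (L * (T - p.1.2)) ^ k / k.factorial * dist Z W := by
    intro k Z W
    induction k with
    | zero =>
      intro p
      rw [← dist_eq_norm]
      simpa using ContinuousMap.dist_apply_le_dist p
    | succ k ih =>
      rintro ⟨⟨t, s⟩, hp⟩
      have ⟨h1, h2, h3⟩ := hp
      simp only at h1 h2 h3
      rw [Function.iterate_succ_apply', Function.iterate_succ_apply', hΨ, hΨ,
        add_sub_add_left_eq_sub]
      simp only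
      have ht : t ∈ Icc 0 T := ⟨h1, h2.trans h3⟩
      have hs : s ∈ Icc 0 T := ⟨h1.trans h2, h3⟩
      have hTT : T ∈ Icc 0 T := ⟨hT, le_rfl⟩
      rw [← intervalIntegral.integral_sub
        (intervalIntegrable_of_bounded (hIm _ t ht) (fun _ => hK _) hs hTT)
        (intervalIntegrable_of_bounded (hIm _ t ht) (fun _ => hK _) hs hTT),
        ← integral_pow_div_factorial, ← intervalIntegral.integral_mul_const]
      refine intervalIntegral.norm_integral_le_of_norm_le h3 ?_ ?_
      · refine Filter.Eventually.of_forall fun r hr => ?_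
        have hr1 : (t, r) ∈ triangle T := ⟨h1, h2.trans hr.1.le, hr.2⟩
        have hr2 : (r, r) ∈ triangle T := ⟨h1.trans (h2.trans hr.1.le), le_rfl, hr.2⟩
        simp only [I]
        refine (hΦ.norm_sub_le _ _).trans ?_
        rw [mul_assoc]
        refine mul_le_mul_of_nonneg_left ?_ L.2
        have e1 := ih ⟨(t, r), hr1⟩
        have e2 := ih ⟨(r, r), hr2⟩
        simp only [Prod.norm_def, Prod.fst_sub, Prod.snd_sub, sub_self, norm_zero,
          hextp _ _ _ hr1, hextp _ _ _ hr2]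
        have e3 := (norm_nonneg _).trans e1
        simp only at e1 e2 e3
        exact max_le (max_le e3 e1) (max_le e3 e2)
      · exact Continuous.intervalIntegrable (by fun_prop) _ _
  obtain ⟨k, hk⟩ : ∃ k : ℕ, ((L : ℝ) * T) ^ k / k.factorial < 1 :=
    ((FloorSemiring.tendsto_pow_div_factorial_atTop ((L : ℝ) * T)).eventually
      (gt_mem_nhds one_pos)).exists
  have hk0 : 0 ≤ ((L : ℝ) * T) ^ k / k.factorial := by positivity
  have hcontr : ContractingWith (Real.toNNReal (((L : ℝ) * T) ^ k / k.factorial)) (Ψ^[k]) := by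
    refine ⟨Real.toNNReal_lt_one.2 hk, LipschitzWith.of_dist_le_mul ?_⟩
    intro Z W
    refine (ContinuousMap.dist_le (by positivity)).2 fun p => ?_
    rw [dist_eq_norm]
    refine (hiter k Z W p).trans ?_
    rw [Real.coe_toNNReal _ hk0]
    have : 0 ≤ T - p.1.2 := sub_nonneg.2 p.2.2.2
    have : T - p.1.2 ≤ T := sub_le_self _ (p.2.1.trans p.2.2.1)
    gcongr
  have hne : Nonempty X := ⟨0⟩
  have hfix := hcontr.isFixedPt_fixedPoint_iterate
  set Z₀ : X := ContractingWith.fixedPoint (Ψ^[k]) hcontr with hZ₀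
  have hcongr : ∀ (Y : ℝ → ℝ → E) (Z : X)
      (_ : ∀ t s (h : (t, s) ∈ triangle T), Y t s = Z ⟨(t, s), h⟩)
      (t s : ℝ) (_ : (t, s) ∈ triangle T),
      ∫ r in s..T, Φ ((c t r, Y t r), (c r r, Y r r)) = ∫ r in s..T, I Z t r := by
    intro Y Z hYZ t s h
    refine intervalIntegral.integral_congr fun r hr => ?_
    rw [uIcc_of_le h.2.2] at hr
    have hr1 : (t, r) ∈ triangle T := ⟨h.1, h.2.1.trans hr.1, hr.2⟩
    have hr2 : (r, r) ∈ triangle T := ⟨h.1.trans (h.2.1.trans hr.1), le_rfl, hr.2⟩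
    simp only [I, hextp _ _ _ hr1, hextp _ _ _ hr2, hYZ _ _ hr1, hYZ _ _ hr2]
  refine ⟨ext Z₀, ⟨(hext Z₀).continuousOn, fun t s h1 h2 h3 => ?_⟩,
    fun Y hY hYeq t s h1 h2 h3 => ?_⟩
  · have h : (t, s) ∈ triangle T := ⟨h1, h2, h3⟩
    rw [hcongr _ Z₀ (fun t s h => hextp _ _ _ h) t s h, hextp _ _ _ h]
    conv_lhs => rw [← hfix.eq]
    exact hΨ _ _
  · have h : (t, s) ∈ triangle T := ⟨h1, h2, h3⟩
    let Z : X := ⟨fun p => Y p.1.1 p.1.2, continuousOn_iff_continuous_domRestrict.1 hY⟩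
    have hZ : Function.IsFixedPt Ψ Z := by
      ext ⟨⟨t, s⟩, h⟩
      rw [hΨ]
      refine Eq.trans ?_ (hYeq t s h.1 h.2.1 h.2.2).symm
      rw [hcongr Y Z (fun _ _ _ => rfl) t s h]
    have : Z = Z₀ := hcontr.fixedPoint_unique (hZ.iterate k)
    rw [hextp _ _ _ h, ← this]
    rfl

end Volterra

/-! ### Essentially bounded matrix functions -/

section EssentiallyBounded

variable {p q l : ℕ} {μ : Measure ℝ}

lemma MeasureTheory.MemLp.ae_norm_le {E : Type*} [NormedAddCommGroup E] {f : ℝ → E}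
    (hf : MemLp f ⊤ μ) : ∀ᵐ r ∂μ, ‖f r‖ ≤ (eLpNorm f ⊤ μ).toReal := by
  filter_upwards [ae_le_eLpNormEssSup (f := f) (μ := μ)] with r hr
  rw [← toReal_enorm]
  exact ENNReal.toReal_mono hf.2.ne (by rwa [eLpNorm_exponent_top])

lemma MeasureTheory.MemLp.matrix_mul {f : ℝ → Matrix (Fin p) (Fin q) ℝ}
    {g : ℝ → Matrix (Fin q) (Fin l) ℝ} (hf : MemLp f ⊤ μ) (hg : MemLp g ⊤ μ) :
    MemLp (fun r => f r * g r) ⊤ μ := by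
  have hc : Continuous fun z : Matrix (Fin p) (Fin q) ℝ × Matrix (Fin q) (Fin l) ℝ => z.1 * z.2 :=
    continuous_fst.matrix_mul continuous_snd
  refine memLp_top_of_bound (hc.comp_aestronglyMeasurable (hf.1.prodMk hg.1))
    ((eLpNorm f ⊤ μ).toReal * (eLpNorm g ⊤ μ).toReal) ?_
  filter_upwards [hf.ae_norm_le, hg.ae_norm_le] with r h1 h2
  exact (Matrix.l2_opNorm_mul _ _).trans (by gcongr)

lemma MeasureTheory.MemLp.matrix_transpose {f : ℝ → Matrix (Fin p) (Fin q) ℝ} (hf : MemLp f ⊤ μ) :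
    MemLp (fun r => (f r)ᵀ) ⊤ μ := by
  have hc : Continuous fun z : Matrix (Fin p) (Fin q) ℝ => zᵀ := continuous_id.matrix_transpose
  exact hf.of_le (hc.comp_aestronglyMeasurable hf.1)
    (Filter.Eventually.of_forall fun r => (Matrix.l2_opNorm_transpose _).le)

lemma ContinuousOn.memLp_top {E : Type*} [NormedAddCommGroup E] {f : ℝ → E} {a b : ℝ}
    (hf : ContinuousOn f (Icc a b)) : MemLp f ⊤ (volume.restrict (Icc a b)) := by
  obtain ⟨K, hK⟩ := isCompact_Icc.exists_bound_of_continuousOn hf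
  exact memLp_top_of_bound (hf.aestronglyMeasurable_of_isCompact isCompact_Icc measurableSet_Icc) K
    (ae_restrict_of_forall_mem measurableSet_Icc hK)

lemma MeasureTheory.MemLp.intervalIntegrable {E : Type*} [NormedAddCommGroup E] {f : ℝ → E}
    {a b x y : ℝ} (hf : MemLp f ⊤ (volume.restrict (Icc a b))) (hx : x ∈ Icc a b)
    (hy : y ∈ Icc a b) : IntervalIntegrable f volume x y := by
  have h1 : IntegrableOn f (Icc a b) := hf.integrable (by simp)
  have h0 : a ≤ b := hx.1.trans hx.2
  refine (IntervalIntegrable.mono_set (a := a) (b := b) ?_ ?_)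
  · rw [intervalIntegrable_iff_integrableOn_Icc_of_le h0]; exact h1
  · rw [uIcc_of_le h0]; exact uIcc_subset_Icc hx hy

lemma intervalIntegral_linearMap_comm {E F : Type*} [NormedAddCommGroup E] [NormedSpace ℝ E]
    [FiniteDimensional ℝ E] [NormedAddCommGroup F] [NormedSpace ℝ F] [CompleteSpace F]
    (ℓ : E →ₗ[ℝ] F) {f : ℝ → E} {a b : ℝ} (hf : IntervalIntegrable f volume a b) :
    ∫ r in a..b, ℓ (f r) = ℓ (∫ r in a..b, f r) := by
  have : CompleteSpace E := FiniteDimensional.complete ℝ E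
  exact (LinearMap.toContinuousLinearMap ℓ).intervalIntegral_comp_comm hf

lemma intervalIntegrable_linearMap {E F : Type*} [NormedAddCommGroup E] [NormedSpace ℝ E]
    [FiniteDimensional ℝ E] [NormedAddCommGroup F] [NormedSpace ℝ F]
    (ℓ : E →ₗ[ℝ] F) {f : ℝ → E} {a b : ℝ} (hf : IntervalIntegrable f volume a b) :
    IntervalIntegrable (fun r => ℓ (f r)) volume a b :=
  ⟨(LinearMap.toContinuousLinearMap ℓ).integrable_comp hf.1,
    (LinearMap.toContinuousLinearMap ℓ).integrable_comp hf.2⟩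

/-- The quadratic form at a fixed vector, as a linear map in the matrix. -/
def Matrix.quadLin (x : Fin p → ℝ) : Matrix (Fin p) (Fin p) ℝ →ₗ[ℝ] ℝ where
  toFun P := P.quad x
  map_add' P Q := P.quad_add Q x
  map_smul' c P := by simp [Matrix.quad, Matrix.smul_mulVec]

lemma ae_restrict_mono_Icc {P : ℝ → Prop} {a b x y : ℝ} (h : ∀ᵐ r ∂volume.restrict (Icc a b), P r)
    (hx : a ≤ x) (hy : y ≤ b) : ∀ᵐ r ∂volume.restrict (Icc x y), P r :=
  ae_restrict_of_ae_restrict_of_subset (Icc_subset_Icc hx hy) h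

lemma ae_of_ae_restrict_Icc {P : ℝ → Prop} {a b : ℝ} (h : ∀ᵐ r ∂volume.restrict (Icc a b), P r) :
    ∀ᵐ r, r ∈ Icc a b → P r := (ae_restrict_iff' measurableSet_Icc).1 h

lemma norm_integral_le_of_ae_bound {E : Type*} [NormedAddCommGroup E] [NormedSpace ℝ E] {f : ℝ → E}
    {x y K : ℝ} (hxy : x ≤ y) (h : ∀ᵐ r ∂volume.restrict (Icc x y), ‖f r‖ ≤ K) :
    ‖∫ r in x..y, f r‖ ≤ K * (y - x) := by
  rw [← abs_of_nonneg (sub_nonneg.2 hxy)]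
  refine intervalIntegral.norm_integral_le_of_norm_le_const_ae ?_
  filter_upwards [ae_of_ae_restrict_Icc h] with r hr h2
  rw [uIoc_of_le hxy] at h2
  exact hr ⟨h2.1.le, h2.2⟩

end EssentiallyBounded

/-! ### Linear Lyapunov equations -/

section Lyapunov

open Matrix

variable {p : ℕ} {a b Λ : ℝ} {P A C S : ℝ → Matrix (Fin p) (Fin p) ℝ}

lemma exists_modulus {E : Type*} [NormedAddCommGroup E] {f : ℝ → E} (hf : ContinuousOn f (Icc a b))
    {ε : ℝ} (hε : 0 < ε) : ∃ η > 0, ∀ t τ, a ≤ t → t ≤ τ → τ ≤ b → τ - t < η →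
      ∀ r ∈ Icc t τ, ‖f r - f τ‖ ≤ ε := by
  have hu := isCompact_Icc.uniformContinuousOn_of_continuous hf
  obtain ⟨η, hη, H⟩ := Metric.uniformContinuousOn_iff.1 hu ε hε
  refine ⟨η, hη, fun t τ h1 h2 h3 h4 r hr => ?_⟩
  rw [← dist_eq_norm]
  refine (H r ⟨h1.trans hr.1, hr.2.trans h3⟩ τ ⟨h1.trans h2, h3⟩ ?_).le
  rw [Real.dist_eq, abs_sub_comm, abs_of_nonneg (sub_nonneg.2 hr.2)]
  linarith [hr.1]

lemma integral_eq_of_backward {E : Type*} [NormedAddCommGroup E] [NormedSpace ℝ E] {f F : ℝ → E}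
    (hF : MemLp F ⊤ (volume.restrict (Icc a b)))
    (h : ∀ s ∈ Icc a b, f s = f b + ∫ r in s..b, F r) {t τ : ℝ} (ha : a ≤ t) (ht : t ≤ τ)
    (hb : τ ≤ b) : f t = f τ + ∫ r in t..τ, F r := by
  have h1 : t ∈ Icc a b := ⟨ha, ht.trans hb⟩
  have h2 : τ ∈ Icc a b := ⟨ha.trans ht, hb⟩
  have h3 : b ∈ Icc a b := ⟨h2.1.trans h2.2, le_rfl⟩
  rw [h t h1, h τ h2, ← intervalIntegral.integral_add_adjacent_intervals
    (hF.intervalIntegrable h1 h2) (hF.intervalIntegrable h2 h3)]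
  abel

/-- `X A + Aᵀ X + Cᵀ X C`. -/
def lyapunov (A C X : Matrix (Fin p) (Fin p) ℝ) : Matrix (Fin p) (Fin p) ℝ :=
  X * A + Aᵀ * X + Cᵀ * X * C

lemma norm_lyapunov_le {A C : Matrix (Fin p) (Fin p) ℝ} (hA : ‖A‖ ≤ Λ) (hC : ‖C‖ ≤ Λ)
    (X : Matrix (Fin p) (Fin p) ℝ) : ‖lyapunov A C X‖ ≤ (2 * Λ + Λ ^ 2) * ‖X‖ := by
  have h1 := l2_opNorm_mul X A
  have h2 := l2_opNorm_mul Aᵀ X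
  have h3 := l2_opNorm_mul (Cᵀ * X) C
  have h4 := l2_opNorm_mul Cᵀ X
  rw [l2_opNorm_transpose] at h2 h4
  have h0 : 0 ≤ Λ := (norm_nonneg _).trans hA
  calc ‖lyapunov A C X‖ ≤ ‖X * A‖ + ‖Aᵀ * X‖ + ‖Cᵀ * X * C‖ := norm_add₃_le
    _ ≤ ‖X‖ * Λ + Λ * ‖X‖ + Λ * ‖X‖ * Λ := by
      refine add_le_add_three (h1.trans ?_) (h2.trans ?_) (h3.trans ?_)
      · gcongr
      · gcongr
      · exact mul_le_mul (h4.trans (by gcongr)) hC (norm_nonneg _) (by positivity)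
    _ = _ := by ring

lemma lyapunov_sub (A C X Y : Matrix (Fin p) (Fin p) ℝ) :
    lyapunov A C (X - Y) = lyapunov A C X - lyapunov A C Y := by
  simp only [lyapunov, mul_sub, sub_mul]; abel

lemma lyapunov_transpose (A C X : Matrix (Fin p) (Fin p) ℝ) :
    lyapunov A C Xᵀ = (lyapunov A C X)ᵀ := by
  simp only [lyapunov, transpose_add, transpose_mul, transpose_transpose, Matrix.mul_assoc]; abel

lemma memLp_lyapunov {μ : Measure ℝ} (hA : MemLp A ⊤ μ) (hC : MemLp C ⊤ μ) (hP : MemLp P ⊤ μ) :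
    MemLp (fun r => lyapunov (A r) (C r) (P r)) ⊤ μ :=
  ((hP.matrix_mul hA).add (hA.matrix_transpose.matrix_mul hP)).add
    ((hC.matrix_transpose.matrix_mul hP).matrix_mul hC)

/-- Grönwall for `‖P‖`, with `P r` replaced by `P τ` on each short step. It yields the symmetry of
solutions, since `Pᵀ - P` solves the homogeneous equation when the source is symmetric. -/
lemma eq_zero_of_lyapunov (hA : MemLp A ⊤ (volume.restrict (Icc a b)))
    (hC : MemLp C ⊤ (volume.restrict (Icc a b))) (hP : ContinuousOn P (Icc a b))
    (hAΛ : ∀ᵐ r ∂volume.restrict (Icc a b), ‖A r‖ ≤ Λ)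
    (hCΛ : ∀ᵐ r ∂volume.restrict (Icc a b), ‖C r‖ ≤ Λ) (hΛ : 0 ≤ Λ)
    (heq : ∀ s ∈ Icc a b, P s = P b + ∫ r in s..b, lyapunov (A r) (C r) (P r))
    (hb : P b = 0) : ∀ s ∈ Icc a b, P s = 0 := by
  intro s hs
  set κ := 2 * Λ + Λ ^ 2 with hκ
  have hκ0 : 0 ≤ κ := by positivity
  have hF := memLp_lyapunov hA hC hP.memLp_top
  have hg := backward_gronwall (f := fun s => ‖P s‖) (α := fun _ => κ) (β := fun _ => 0)
    (a := a) (b := b) (by simp) (by simp) (fun _ => hκ0) (fun _ => le_rfl) (fun _ => norm_nonneg _)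
    (fun ε hε => ?_) hs.1 hs.2
  · simp only [hb, norm_zero, intervalIntegral.integral_zero, add_zero, zero_mul] at hg
    exact norm_le_zero_iff.1 hg
  · obtain ⟨η, hη, H⟩ := exists_modulus hP (ε := ε / (κ + 1)) (by positivity)
    refine ⟨η, hη, fun t τ h1 h2 h3 h4 => ?_⟩
    have hH := H t τ h1 h2 h3 h4
    have hle : ‖∫ r in t..τ, lyapunov (A r) (C r) (P r)‖ ≤ κ * (‖P τ‖ + ε / (κ + 1)) * (τ - t) := by
      refine norm_integral_le_of_ae_bound h2 ?_
      filter_upwards [ae_restrict_mono_Icc hAΛ h1 h3, ae_restrict_mono_Icc hCΛ h1 h3,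
        ae_restrict_mem measurableSet_Icc] with r e1 e2 e3
      refine (norm_lyapunov_le e1 e2 _).trans ?_
      gcongr
      have := norm_le_norm_add_norm_sub' (P r) (P τ)
      linarith [hH r e3]
    have e := integral_eq_of_backward hF heq h1 h2 h3
    have h5 : κ * (ε / (κ + 1)) ≤ ε := by
      rw [← mul_div_assoc, div_le_iff₀ (by positivity)]; nlinarith
    have h6 : 0 ≤ τ - t := sub_nonneg.2 h2
    simp only [intervalIntegral.integral_const, smul_eq_mul, mul_zero, add_zero]
    rw [e]
    calc ‖P τ + ∫ r in t..τ, lyapunov (A r) (C r) (P r)‖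
        ≤ ‖P τ‖ + κ * (‖P τ‖ + ε / (κ + 1)) * (τ - t) := (norm_add_le _ _).trans (by gcongr)
      _ = ‖P τ‖ * (1 + (τ - t) * κ) + κ * (ε / (κ + 1)) * (τ - t) := by ring
      _ ≤ _ := by gcongr

/-- To first order in `M`, `X + X M + Mᵀ X` is the congruence `(1 + M)ᵀ X (1 + M)`, which preserves
positivity. The drift terms can thus destroy positivity only at second order. -/
lemma quad_add_mulVec (X M : Matrix (Fin p) (Fin p) ℝ) (x : Fin p → ℝ) :
    X.quad (x + M *ᵥ x) = X.quad x + (X * M + Mᵀ * X).quad x + X.quad (M *ᵥ x) := by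
  rw [← quad_transpose_mul_mul X M, ← quad_add, ← quad_add]
  have : x + M *ᵥ x = (1 + M) *ᵥ x := by rw [add_mulVec, one_mulVec]
  rw [this, ← quad_transpose_mul_mul]
  congr 1
  simp only [transpose_add, transpose_one, add_mul, mul_add, one_mul, mul_one]; abel

/-- A constant that measures how far `X` is from being positive semidefinite. -/
noncomputable def psdDefect (X : Matrix (Fin p) (Fin p) ℝ) : ℝ :=
  sInf {c | 0 ≤ c ∧ ∀ x, -(c * (x ⬝ᵥ x)) ≤ X.quad x}

lemma psdDefect_nonneg (X : Matrix (Fin p) (Fin p) ℝ) : 0 ≤ psdDefect X :=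
  Real.sInf_nonneg fun _ h => h.1

lemma psdDefect_le {X : Matrix (Fin p) (Fin p) ℝ} {c : ℝ} (hc : 0 ≤ c)
    (h : ∀ x, -(c * (x ⬝ᵥ x)) ≤ X.quad x) : psdDefect X ≤ c :=
  csInf_le ⟨0, fun _ h => h.1⟩ ⟨hc, h⟩

lemma neg_psdDefect_mul_le (X : Matrix (Fin p) (Fin p) ℝ) (x : Fin p → ℝ) :
    -(psdDefect X * (x ⬝ᵥ x)) ≤ X.quad x := by
  rcases (dotProduct_self_nonneg' x).eq_or_lt with h0 | h0
  · have := abs_quad_le X x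
    rw [← h0, mul_zero] at this ⊢
    simp [abs_nonpos_iff.1 this]
  · have : -(X.quad x) / (x ⬝ᵥ x) ≤ psdDefect X := by
      refine le_csInf ⟨‖X‖, norm_nonneg _, fun y => (abs_le.1 (abs_quad_le X y)).1⟩ ?_
      rintro c ⟨_, hc⟩
      rw [div_le_iff₀ h0]; linarith [hc x]
    rw [div_le_iff₀ h0] at this
    linarith

/-- One backward step: `Y.quad x = X.quad (x + M x) - X.quad (M x) + W.quad x`. The first term costs
the factor `(1 + κ h)² ≤ 1 + (2 κ + κ²) h`, which needs `h ≤ 1`; the second is of order `h²`. -/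
lemma psdDefect_step {X Y W M : Matrix (Fin p) (Fin p) ℝ} {κ h c ρ : ℝ} (hh : 0 ≤ h)
    (hM : ‖M‖ ≤ κ * h) (hh1 : h ≤ 1) (hc : 0 ≤ c)
    (hY : Y = X + (X * M + Mᵀ * X) + W)
    (hX : ∀ x, -(c * (x ⬝ᵥ x)) ≤ X.quad x) (hW : ∀ x, -(ρ * (x ⬝ᵥ x)) ≤ W.quad x) (x : Fin p → ℝ) :
    -((c * (1 + (2 * κ + κ ^ 2) * h) + ‖X‖ * κ ^ 2 * h ^ 2 + ρ) * (x ⬝ᵥ x)) ≤ Y.quad x := by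
  have e : Y.quad x = X.quad (x + M *ᵥ x) - X.quad (M *ᵥ x) + W.quad x := by
    rw [hY, quad_add, quad_add, quad_add_mulVec]; ring
  have hx := dotProduct_self_nonneg' x
  have h1 := hX (x + M *ᵥ x)
  have h2 := quad_le X (M *ᵥ x)
  have h3 : (M *ᵥ x) ⬝ᵥ (M *ᵥ x) ≤ (κ * h) ^ 2 * (x ⬝ᵥ x) :=
    (dotProduct_mulVec_self_le M x).trans (by gcongr)
  have h4 : (x + M *ᵥ x) ⬝ᵥ (x + M *ᵥ x) ≤ (1 + κ * h) ^ 2 * (x ⬝ᵥ x) := by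
    have : x + M *ᵥ x = (1 + M) *ᵥ x := by rw [add_mulVec, one_mulVec]
    rw [this]
    refine (dotProduct_mulVec_self_le _ x).trans ?_
    have h1 : ‖(1 : Matrix (Fin p) (Fin p) ℝ)‖ ≤ 1 :=
      l2_opNorm_le_of_forall _ zero_le_one fun x => by simp
    have : ‖1 + M‖ ≤ 1 + κ * h := (norm_add_le _ _).trans (add_le_add h1 hM)
    gcongr
  have h5 : (1 + κ * h) ^ 2 ≤ 1 + (2 * κ + κ ^ 2) * h := by nlinarith [mul_nonneg (sq_nonneg κ) hh]
  have h6 : c * ((x + M *ᵥ x) ⬝ᵥ (x + M *ᵥ x)) ≤ c * ((1 + (2 * κ + κ ^ 2) * h) * (x ⬝ᵥ x)) := by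
    gcongr; exact h4.trans (by gcongr)
  have h7 : ‖X‖ * ((M *ᵥ x) ⬝ᵥ (M *ᵥ x)) ≤ ‖X‖ * ((κ * h) ^ 2 * (x ⬝ᵥ x)) := by gcongr
  rw [e]
  nlinarith [hW x]

/-- The solution of a linear Lyapunov equation with positive semidefinite source and terminal value
is positive semidefinite. -/
theorem posSemidef_of_lyapunov (hA : MemLp A ⊤ (volume.restrict (Icc a b)))
    (hC : MemLp C ⊤ (volume.restrict (Icc a b))) (hS : MemLp S ⊤ (volume.restrict (Icc a b)))
    (hP : ContinuousOn P (Icc a b))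
    (hSp : ∀ᵐ r ∂volume.restrict (Icc a b), (S r).PosSemidef)
    (heq : ∀ s ∈ Icc a b, P s = P b + ∫ r in s..b, (lyapunov (A r) (C r) (P r) + S r))
    (hb : (P b).PosSemidef) : ∀ s ∈ Icc a b, (P s).PosSemidef := by
  set Λ := max (eLpNorm A ⊤ (volume.restrict (Icc a b))).toReal
    (eLpNorm C ⊤ (volume.restrict (Icc a b))).toReal with hΛdef
  have hΛ : 0 ≤ Λ := le_max_of_le_left ENNReal.toReal_nonneg
  have hAΛ : ∀ᵐ r ∂volume.restrict (Icc a b), ‖A r‖ ≤ Λ :=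
    hA.ae_norm_le.mono fun r h => h.trans (le_max_left _ _)
  have hCΛ : ∀ᵐ r ∂volume.restrict (Icc a b), ‖C r‖ ≤ Λ :=
    hC.ae_norm_le.mono fun r h => h.trans (le_max_right _ _)
  have hF := memLp_lyapunov hA hC hP.memLp_top
  have hFS : MemLp (fun r => lyapunov (A r) (C r) (P r) + S r) ⊤ (volume.restrict (Icc a b)) :=
    hF.add hS
  have hsymm : ∀ s ∈ Icc a b, (P s)ᵀ = P s := by
    intro s hs
    have hPt : ContinuousOn (fun s => (P s)ᵀ) (Icc a b) :=
      (continuous_id.matrix_transpose).comp_continuousOn hP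
    have hbI : b ∈ Icc a b := ⟨hs.1.trans hs.2, le_rfl⟩
    -- The source is symmetric almost everywhere, so it drops out of the equation for `Pᵀ - P`.
    refine sub_eq_zero.1 (eq_zero_of_lyapunov (P := fun s => (P s)ᵀ - P s) hA hC (hPt.sub hP)
      hAΛ hCΛ hΛ (fun s hs => ?_) ?_ s hs)
    · have i1 := hFS.intervalIntegrable hs hbI
      have i2 := hFS.matrix_transpose.intervalIntegrable hs hbI
      have ht : (P s)ᵀ = (P b)ᵀ + ∫ r in s..b, (lyapunov (A r) (C r) (P r) + S r)ᵀ := by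
        have := intervalIntegral_linearMap_comm
          (Matrix.transposeLinearEquiv (Fin p) (Fin p) ℝ ℝ).toLinearMap i1
        rw [heq s hs, transpose_add]
        congr 1
        exact this.symm
      rw [ht, heq s hs, add_sub_add_comm]
      congr 1
      rw [← intervalIntegral.integral_sub i2 i1]
      refine intervalIntegral.integral_congr_ae ?_
      filter_upwards [ae_of_ae_restrict_Icc hSp] with r hr hr2
      rw [uIoc_of_le hs.2] at hr2
      have := (hr ⟨hs.1.trans hr2.1.le, hr2.2⟩).transpose_eq
      rw [lyapunov_sub, lyapunov_transpose, transpose_add, this]; abel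
    · simp [hb.transpose_eq]
  intro s hs
  refine posSemidef_of_quad (hsymm s hs) fun x => ?_
  obtain ⟨K, hK⟩ := isCompact_Icc.exists_bound_of_continuousOn hP
  have hK0 : 0 ≤ K := (norm_nonneg _).trans (hK s hs)
  set κ := 2 * Λ + Λ ^ 2 with hκ
  have hκ0 : 0 ≤ κ := by positivity
  -- In the rate, `κ` is the cost of the congruence by `1 + ∫ A`, and `Λ ^ 2` that of the term `Cᵀ P
  -- C`.
  have hg := backward_gronwall (f := fun s => psdDefect (P s)) (α := fun _ => κ + Λ ^ 2)
    (β := fun _ => 0) (a := a) (b := b) (by simp) (by simp) (fun _ => by positivity)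
    (fun _ => le_rfl) (fun _ => psdDefect_nonneg _) (fun ε hε => ?_) hs.1 hs.2
  · have h0 : psdDefect (P b) = 0 :=
      le_antisymm (psdDefect_le le_rfl fun x => by simpa using hb.quad_nonneg x)
        (psdDefect_nonneg _)
    simp only [h0, intervalIntegral.integral_zero, add_zero, zero_mul] at hg
    have := neg_psdDefect_mul_le (P s) x
    rw [le_antisymm hg (psdDefect_nonneg _)] at this
    simpa using this
  · obtain ⟨η, hη, H⟩ := exists_modulus hP (ε := ε / 2 / (κ + 1)) (by positivity)
    set θ := ε / 2 / (K * Λ ^ 2 + 1)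
    have hθ : 0 < θ := by positivity
    refine ⟨min η (min 1 θ), by positivity, fun t τ h1 h2 h3 h4 => ?_⟩
    have hη1 : τ - t < η := h4.trans_le (min_le_left _ _)
    have hη2 : τ - t ≤ 1 := (h4.trans_le ((min_le_right _ _).trans (min_le_left _ _))).le
    have hη3 : τ - t ≤ θ := (h4.trans_le ((min_le_right _ _).trans (min_le_right _ _))).le
    have hH := H t τ h1 h2 h3 hη1
    have hh : 0 ≤ τ - t := sub_nonneg.2 h2
    have htI : t ∈ Icc a b := ⟨h1, h2.trans h3⟩
    have hτI : τ ∈ Icc a b := ⟨h1.trans h2, h3⟩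
    have iA := hA.intervalIntegrable htI hτI
    have iFS := hFS.intervalIntegrable htI hτI
    -- The drift part with `P` frozen at `τ`. By linearity its integral is exactly `P τ * M + Mᵀ * P
    -- τ` with `M = ∫ A`; everything else goes into `W`.
    let ℓ : Matrix (Fin p) (Fin p) ℝ →ₗ[ℝ] Matrix (Fin p) (Fin p) ℝ :=
      { toFun := fun M => P τ * M + Mᵀ * P τ
        map_add' := fun M N => by simp only [mul_add, transpose_add, add_mul]; abel
        map_smul' := fun c M => by simp }
    have iℓ := intervalIntegrable_linearMap ℓ iA
    have hℓ := intervalIntegral_linearMap_comm ℓ iA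
    set M := ∫ r in t..τ, A r with hMdef
    set W := ∫ r in t..τ, (lyapunov (A r) (C r) (P r) + S r - ℓ (A r)) with hWdef
    have hY : P t = P τ + (P τ * M + Mᵀ * P τ) + W := by
      rw [hWdef, intervalIntegral.integral_sub iFS iℓ, hℓ]
      have := integral_eq_of_backward hFS heq h1 h2 h3
      rw [this]
      simp [ℓ]
    have hM : ‖M‖ ≤ Λ * (τ - t) := norm_integral_le_of_ae_bound h2 (ae_restrict_mono_Icc hAΛ h1 h3)
    have hW : ∀ x, -(((psdDefect (P τ) * Λ ^ 2 + κ * (ε / 2 / (κ + 1))) * (τ - t)) * (x ⬝ᵥ x))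
        ≤ W.quad x := by
      intro x
      have hx := dotProduct_self_nonneg' x
      have e : W.quad x = ∫ r in t..τ, (lyapunov (A r) (C r) (P r) + S r - ℓ (A r)).quad x :=
        (intervalIntegral_linearMap_comm (quadLin x) (iFS.sub iℓ)).symm
      rw [e]
      have hconst : -(((psdDefect (P τ) * Λ ^ 2 + κ * (ε / 2 / (κ + 1))) * (τ - t)) * (x ⬝ᵥ x))
          = ∫ r in t..τ, -((psdDefect (P τ) * Λ ^ 2 + κ * (ε / 2 / (κ + 1))) * (x ⬝ᵥ x)) := by
        rw [intervalIntegral.integral_const, smul_eq_mul]; ring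
      rw [hconst]
      refine intervalIntegral.integral_mono_ae_restrict h2 (by simp)
        (intervalIntegrable_linearMap (quadLin x) (iFS.sub iℓ)) ?_
      filter_upwards [ae_restrict_mono_Icc hAΛ h1 h3, ae_restrict_mono_Icc hCΛ h1 h3,
        ae_restrict_mono_Icc hSp h1 h3, ae_restrict_mem measurableSet_Icc] with r e1 e2 e3 e4
      have d : lyapunov (A r) (C r) (P r) + S r - ℓ (A r)
          = lyapunov (A r) (C r) (P r - P τ) + (C r)ᵀ * P τ * C r + S r := by
        rw [lyapunov_sub]; simp only [lyapunov, ℓ, LinearMap.coe_mk, AddHom.coe_mk]; abel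
      rw [d, quad_add, quad_add, quad_transpose_mul_mul]
      have b1 := e3.quad_nonneg x
      have b2 := neg_psdDefect_mul_le (P τ) (C r *ᵥ x)
      have b3 : (C r *ᵥ x) ⬝ᵥ (C r *ᵥ x) ≤ Λ ^ 2 * (x ⬝ᵥ x) :=
        (dotProduct_mulVec_self_le _ x).trans (by gcongr)
      have b4 := (abs_le.1 (abs_quad_le (lyapunov (A r) (C r) (P r - P τ)) x)).1
      have b5 : ‖lyapunov (A r) (C r) (P r - P τ)‖ ≤ κ * (ε / 2 / (κ + 1)) :=
        (norm_lyapunov_le e1 e2 _).trans (by gcongr; exact hH r e4)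
      have b6 := mul_le_mul_of_nonneg_right b5 hx
      have b7 := mul_le_mul_of_nonneg_left b3 (psdDefect_nonneg (P τ))
      linarith
    have h5 : κ * (ε / 2 / (κ + 1)) ≤ ε / 2 := by
      rw [← mul_div_assoc, div_le_iff₀ (by positivity)]; nlinarith
    have h6 : K * Λ ^ 2 * θ ≤ ε / 2 := by
      rw [← mul_div_assoc, div_le_iff₀ (by positivity)]
      nlinarith [show 0 ≤ K * Λ ^ 2 by positivity]
    have hnn := psdDefect_nonneg (P τ)
    have hρ : 0 ≤ (psdDefect (P τ) * Λ ^ 2 + κ * (ε / 2 / (κ + 1))) * (τ - t) := by positivity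
    have hstep := psdDefect_step hh hM hη2 hnn hY (neg_psdDefect_mul_le _) hW
    have hfin := psdDefect_le (by positivity) hstep
    refine hfin.trans ?_
    simp only [intervalIntegral.integral_const, smul_eq_mul, mul_zero, add_zero]
    have h7 : ‖P τ‖ * Λ ^ 2 * (τ - t) ^ 2 ≤ ε / 2 * (τ - t) := by
      calc ‖P τ‖ * Λ ^ 2 * (τ - t) ^ 2 = (‖P τ‖ * Λ ^ 2 * (τ - t)) * (τ - t) := by ring
        _ ≤ (K * Λ ^ 2 * θ) * (τ - t) := by
          gcongr; exact hK τ hτI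
        _ ≤ _ := by gcongr
    have h8 := mul_le_mul_of_nonneg_right h5 hh
    rw [← hκ]
    linarith

end Lyapunov

/-! ### Bounded Lipschitz functions on a set -/

section BoundedLipschitz

variable {X Y E F : Type*} [NormedAddCommGroup X] [NormedAddCommGroup Y] [NormedAddCommGroup E]
  [NormedAddCommGroup F]

/-- `f` is bounded and Lipschitz on `S`. -/
def BddLip (S : Set X) (f : X → E) : Prop :=
  ∃ K, 0 ≤ K ∧ (∀ x ∈ S, ‖f x‖ ≤ K) ∧ ∀ x ∈ S, ∀ y ∈ S, ‖f x - f y‖ ≤ K * ‖x - y‖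

namespace BddLip

variable {S : Set X} {f g : X → E}

lemma id_of_bounded {K : ℝ} (h : ∀ x ∈ S, ‖x‖ ≤ K) : BddLip S fun x => x := by
  refine ⟨max K 1, le_max_of_le_right zero_le_one, fun x hx => (h x hx).trans (le_max_left _ _),
    fun x _ y _ => ?_⟩
  exact le_mul_of_one_le_left (norm_nonneg _) (le_max_right _ _)

lemma of_le {h : X → F} (hf : BddLip S f) (h1 : ∀ x ∈ S, ‖h x‖ ≤ ‖f x‖)
    (h2 : ∀ x ∈ S, ∀ y ∈ S, ‖h x - h y‖ ≤ ‖f x - f y‖) : BddLip S h := by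
  obtain ⟨K, h0, hb, hl⟩ := hf
  exact ⟨K, h0, fun x hx => (h1 x hx).trans (hb x hx),
    fun x hx y hy => (h2 x hx y hy).trans (hl x hx y hy)⟩

lemma fst {f : X → E × F} (hf : BddLip S f) : BddLip S fun x => (f x).1 :=
  hf.of_le (fun x _ => norm_fst_le (f x)) fun x _ y _ => norm_fst_le (f x - f y)

lemma snd {f : X → E × F} (hf : BddLip S f) : BddLip S fun x => (f x).2 :=
  hf.of_le (fun x _ => norm_snd_le (f x)) fun x _ y _ => norm_snd_le (f x - f y)

lemma prodMk {g : X → F} (hf : BddLip S f) (hg : BddLip S g) : BddLip S fun x => (f x, g x) := by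
  obtain ⟨K, h0, hb, hl⟩ := hf
  obtain ⟨K', h0', hb', hl'⟩ := hg
  refine ⟨max K K', le_max_of_le_left h0, fun x hx => ?_, fun x hx y hy => ?_⟩
  · exact max_le_max (hb x hx) (hb' x hx)
  · rw [max_mul_of_nonneg _ _ (norm_nonneg _)]
    exact max_le_max (hl x hx y hy) (hl' x hx y hy)

lemma add (hf : BddLip S f) (hg : BddLip S g) : BddLip S fun x => f x + g x := by
  obtain ⟨K, h0, hb, hl⟩ := hf
  obtain ⟨K', h0', hb', hl'⟩ := hg
  refine ⟨K + K', add_nonneg h0 h0', fun x hx => ?_, fun x hx y hy => ?_⟩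
  · exact (norm_add_le _ _).trans (add_le_add (hb x hx) (hb' x hx))
  · rw [add_sub_add_comm, add_mul]
    exact (norm_add_le _ _).trans (add_le_add (hl x hx y hy) (hl' x hx y hy))

lemma neg (hf : BddLip S f) : BddLip S fun x => -f x :=
  hf.of_le (fun x _ => (norm_neg _).le) fun x _ y _ => by rw [← neg_sub', norm_neg]

lemma comp {S' : Set Y} {φ : Y → X} (hf : BddLip S f) (hφ : BddLip S' φ) (hm : MapsTo φ S' S) :
    BddLip S' fun y => f (φ y) := by
  obtain ⟨K, h0, hb, hl⟩ := hf
  obtain ⟨K', h0', _, hl'⟩ := hφ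
  -- The maximum with `1` keeps the constant above `K`, which still has to bound the values.
  refine ⟨K * max K' 1, by positivity, fun x hx => ?_, fun x hx y hy => ?_⟩
  · exact (hb _ (hm hx)).trans (le_mul_of_one_le_right h0 (le_max_right _ _))
  · rw [mul_assoc]
    refine (hl _ (hm hx) _ (hm hy)).trans ?_
    gcongr
    exact (hl' x hx y hy).trans (by gcongr; exact le_max_left _ _)

variable {p q l : ℕ}

/-- Boundedness is part of `BddLip` for the sake of this lemma: a product of Lipschitz functions is
Lipschitz when the factors are bounded. -/
lemma mul {f : X → Matrix (Fin p) (Fin q) ℝ} {g : X → Matrix (Fin q) (Fin l) ℝ}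
    (hf : BddLip S f) (hg : BddLip S g) : BddLip S fun x => f x * g x := by
  obtain ⟨K, h0, hb, hl⟩ := hf
  obtain ⟨K', h0', hb', hl'⟩ := hg
  refine ⟨K * K' + K * K', by positivity, fun x hx => ?_, fun x hx y hy => ?_⟩
  · have : ‖f x * g x‖ ≤ K * K' :=
      (Matrix.l2_opNorm_mul _ _).trans (mul_le_mul (hb x hx) (hb' x hx) (norm_nonneg _) h0)
    have : 0 ≤ K * K' := by positivity
    linarith
  · have e : f x * g x - f y * g y = f x * (g x - g y) + (f x - f y) * g y := by
      simp only [Matrix.mul_sub, Matrix.sub_mul]; abel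
    rw [e]
    have h1 : ‖f x * (g x - g y)‖ ≤ K * (K' * ‖x - y‖) :=
      (Matrix.l2_opNorm_mul _ _).trans
        (mul_le_mul (hb x hx) (hl' x hx y hy) (norm_nonneg _) h0)
    have h2 : ‖(f x - f y) * g y‖ ≤ (K * ‖x - y‖) * K' :=
      (Matrix.l2_opNorm_mul _ _).trans
        (mul_le_mul (hl x hx y hy) (hb' y hy) (norm_nonneg _) (by positivity))
    refine (norm_add_le _ _).trans ((add_le_add h1 h2).trans (le_of_eq ?_))
    ring

lemma transpose {f : X → Matrix (Fin p) (Fin q) ℝ} (hf : BddLip S f) :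
    BddLip S fun x => (f x)ᵀ :=
  hf.of_le (fun x _ => (Matrix.l2_opNorm_transpose _).le) fun x _ y _ => by
    rw [← Matrix.transpose_sub, Matrix.l2_opNorm_transpose]

/-- Resolvent identity `X⁻¹ - Y⁻¹ = X⁻¹ (Y - X) Y⁻¹`. -/
lemma inv {f : X → Matrix (Fin p) (Fin p) ℝ} (hf : BddLip S f) {c : ℝ} (hc : 0 ≤ c)
    (hu : ∀ x ∈ S, IsUnit (f x)) (hi : ∀ x ∈ S, ‖(f x)⁻¹‖ ≤ c) : BddLip S fun x => (f x)⁻¹ := by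
  obtain ⟨K, h0, hb, hl⟩ := hf
  refine ⟨max c (c * K * c), le_max_of_le_left hc, fun x hx => (hi x hx).trans (le_max_left _ _),
    fun x hx y hy => ?_⟩
  have hx' := (Matrix.isUnit_iff_isUnit_det _).1 (hu x hx)
  have hy' := (Matrix.isUnit_iff_isUnit_det _).1 (hu y hy)
  have e : (f x)⁻¹ - (f y)⁻¹ = (f x)⁻¹ * (f y - f x) * (f y)⁻¹ := by
    rw [Matrix.mul_sub, Matrix.sub_mul, Matrix.nonsing_inv_mul _ hx', Matrix.mul_assoc,
      Matrix.mul_nonsing_inv _ hy']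
    simp
  rw [e]
  calc ‖(f x)⁻¹ * (f y - f x) * (f y)⁻¹‖ ≤ ‖(f x)⁻¹‖ * ‖f y - f x‖ * ‖(f y)⁻¹‖ :=
        (Matrix.l2_opNorm_mul _ _).trans (by gcongr; exact Matrix.l2_opNorm_mul _ _)
    _ ≤ c * (K * ‖x - y‖) * c := by
      gcongr
      · exact hi x hx
      · rw [norm_sub_rev]; exact hl x hx y hy
      · exact hi y hy
    _ = c * K * c * ‖x - y‖ := by ring
    _ ≤ _ := by gcongr; exact le_max_right _ _

/-- The purpose of the truncation: precomposing with a Lipschitz map into `S` turns bounds on `S`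
into global ones. -/
lemma lipschitzWith_comp {φ : Y → X} {L : NNReal} (hf : BddLip S f) (hφ : LipschitzWith L φ)
    (hm : ∀ y, φ y ∈ S) : (∃ L', LipschitzWith L' fun y => f (φ y)) ∧ ∃ K, ∀ y, ‖f (φ y)‖ ≤ K := by
  obtain ⟨K, h0, hb, hl⟩ := hf
  refine ⟨⟨Real.toNNReal K * L, LipschitzWith.of_dist_le_mul fun x y => ?_⟩, K,
    fun y => hb _ (hm y)⟩
  rw [dist_eq_norm, NNReal.coe_mul, mul_assoc, Real.coe_toNNReal _ h0]
  refine (hl _ (hm x) _ (hm y)).trans ?_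
  have := hφ.dist_le_mul x y
  rw [dist_eq_norm] at this
  exact mul_le_mul_of_nonneg_left this h0

end BddLip

end BoundedLipschitz

/-! ### The right-hand sides as functions of the coefficients and of the unknowns -/

namespace LQData

/-- The values of all coefficients at one pair of times, in the order of the fields of `LQData`. -/
abbrev Coeff (n m k : ℕ) : Type :=
  (Matrix (Fin n) (Fin n) ℝ × Matrix (Fin n) (Fin k) ℝ × Matrix (Fin n) (Fin n) ℝ ×
    Matrix (Fin n) (Fin k) ℝ) ×
  (Matrix (Fin m) (Fin n) ℝ × Matrix (Fin m) (Fin k) ℝ × Matrix (Fin m) (Fin m) ℝ ×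
    Matrix (Fin m) (Fin m) ℝ) ×
  (Matrix (Fin n) (Fin n) ℝ × Matrix (Fin k) (Fin k) ℝ × Matrix (Fin m) (Fin m) ℝ ×
    Matrix (Fin m) (Fin m) ℝ) × Matrix (Fin m) (Fin m) ℝ

noncomputable instance (n m k : ℕ) : NormedAddCommGroup (Coeff n m k) := inferInstance

/-- The values of the pair of unknowns. -/
abbrev Unknown (n m : ℕ) : Type := Matrix (Fin n) (Fin n) ℝ × Matrix (Fin m) (Fin n) ℝ

/-- The values of the coefficients together with those of the unknowns. -/
abbrev Config (n m k : ℕ) : Type := Coeff n m k × Unknown n m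

noncomputable instance (n m k : ℕ) : NormedAddCommGroup (Config n m k) := inferInstance

variable {n m k : ℕ}

/-- The coefficients of `d` at `(t, r)`. -/
def coeff (d : LQData n m k) (t r : ℝ) : Coeff n m k :=
  ((d.A r, d.B r, d.C r, d.D r), (d.Ah r, d.Bh r, d.Ch r, d.Dh r),
    (d.Q t r, d.R t r, d.M t r, d.N t r), d.G2 r)

/-- The data with constant coefficients `c`. -/
def Coeff.toData (c : Coeff n m k) : LQData n m k where
  A _ := c.1.1
  B _ := c.1.2.1
  C _ := c.1.2.2.1
  D _ := c.1.2.2.2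
  Ah _ := c.2.1.1
  Bh _ := c.2.1.2.1
  Ch _ := c.2.1.2.2.1
  Dh _ := c.2.1.2.2.2
  H := 0
  Q _ _ := c.2.2.1.1
  R _ _ := c.2.2.1.2.1
  M _ _ := c.2.2.1.2.2.1
  N _ _ := c.2.2.1.2.2.2
  G1 _ := 0
  G2 _ := c.2.2.2

namespace Config

/-- The matrix inverted in the feedback. -/
def gram (ζ : Config n m k) : Matrix (Fin k) (Fin k) ℝ :=
  ζ.1.toData.gram (fun _ _ => ζ.2.1) (fun _ => ζ.2.2) 0

/-- The feedback. -/
noncomputable def feedback (ζ : Config n m k) : Matrix (Fin k) (Fin n) ℝ :=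
  ζ.1.toData.feedback (fun _ _ => ζ.2.1) (fun _ => ζ.2.2) 0

/-- The closed-loop drift. -/
noncomputable def closedA (ζ : Config n m k) : Matrix (Fin n) (Fin n) ℝ :=
  ζ.1.toData.closedA (fun _ => ζ.feedback) 0

/-- The closed-loop diffusion. -/
noncomputable def closedC (ζ : Config n m k) : Matrix (Fin n) (Fin n) ℝ :=
  ζ.1.toData.closedC (fun _ => ζ.feedback) 0

/-- The part of the first right-hand side that does not contain `P₁(t, r)`. The weights are taken
from `c`, everything else from the diagonal configuration `ζ`. -/
noncomputable def source (c : Coeff n m k) (ζ : Config n m k) : Matrix (Fin n) (Fin n) ℝ :=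
  c.2.2.1.1 + ζ.feedbackᵀ * c.2.2.1.2.1 * ζ.feedback + ζ.2.2ᵀ * c.2.2.1.2.2.1 * ζ.2.2
    + ζ.closedCᵀ * ζ.2.2ᵀ * c.2.2.1.2.2.2 * ζ.2.2 * ζ.closedC

/-- The second right-hand side. -/
noncomputable def rhs₂ (ζ : Config n m k) : Matrix (Fin m) (Fin n) ℝ :=
  ζ.1.toData.rhs₂ (fun _ => ζ.2.2) (fun _ => ζ.feedback) 0

/-- The first right-hand side. -/
noncomputable def rhs₁ (ξ ζ : Config n m k) : Matrix (Fin n) (Fin n) ℝ :=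
  lyapunov ζ.closedA ζ.closedC ξ.2.1 + source ξ.1 ζ

end Config

lemma rhs₂_eq (d : LQData n m k) (P₁ : ℝ → ℝ → Matrix (Fin n) (Fin n) ℝ)
    (P₂ : ℝ → Matrix (Fin m) (Fin n) ℝ) (r : ℝ) :
    d.rhs₂ P₂ (d.feedback P₁ P₂) r = Config.rhs₂ (d.coeff r r, (P₁ r r, P₂ r)) := rfl

/-- `Y` is arbitrary because the equation reads `P₂` from the diagonal configuration alone. -/
lemma rhs₁_eq (d : LQData n m k) (P₁ : ℝ → ℝ → Matrix (Fin n) (Fin n) ℝ)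
    (P₂ : ℝ → Matrix (Fin m) (Fin n) ℝ) (t r : ℝ) (Y : Matrix (Fin m) (Fin n) ℝ) :
    d.rhs₁ P₁ P₂ (d.feedback P₁ P₂) t r
      = Config.rhs₁ (d.coeff t r, (P₁ t r, Y)) (d.coeff r r, (P₁ r r, P₂ r)) := by
  have h1 : Config.closedA (d.coeff r r, (P₁ r r, P₂ r)) = d.closedA (d.feedback P₁ P₂) r := rfl
  have h2 : Config.closedC (d.coeff r r, (P₁ r r, P₂ r)) = d.closedC (d.feedback P₁ P₂) r := rfl
  have h3 : Config.feedback (d.coeff r r, (P₁ r r, P₂ r)) = d.feedback P₁ P₂ r := rfl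
  simp only [Config.rhs₁, Config.source, h1, h2, h3, rhs₁, lyapunov]
  simp only [coeff]
  abel

/-- The configurations of norm at most `K` at which the feedback is under control. -/
def admissible (n m k : ℕ) (δ K : ℝ) : Set (Config n m k) :=
  {ζ | ‖ζ‖ ≤ K ∧ (ζ.1.2.2.1.2.1 - δ • 1).PosSemidef ∧ (ζ.1.2.2.1.2.2.2).PosSemidef ∧
    ζ.2.1.PosSemidef}

/-! ### Regularity of the right-hand sides on admissible configurations. -/

section Regularity

variable {δ K : ℝ}

/-- On admissible configurations `Dᵀ (P + Yᵀ N Y) D ≥ 0`, so the inverted matrix inherits the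
coercivity of `R`. This bounds its inverse by `1 / δ`. -/
lemma gram_sub_posSemidef {ζ : Config n m k} (hζ : ζ ∈ admissible n m k δ K) :
    (ζ.gram - δ • 1).PosSemidef :=
  Matrix.sub_smul_one_posSemidef_add hζ.2.1
    ((hζ.2.2.2.add (hζ.2.2.1.transpose_mul_mul _)).transpose_mul_mul _)

lemma bddLip_id : BddLip (admissible n m k δ K) fun ζ => ζ :=
  .id_of_bounded fun _ h => h.1

lemma bddLip_gram : BddLip (admissible n m k δ K) fun ζ => ζ.gram :=
  have h := bddLip_id (n := n) (m := m) (k := k) (δ := δ) (K := K)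
  have hD := h.fst.fst.snd.snd.snd
  have hP := h.snd.snd
  h.fst.snd.snd.fst.snd.fst.add
    ((hD.transpose.mul
      (h.snd.fst.add ((hP.transpose.mul h.fst.snd.snd.fst.snd.snd.snd).mul hP))).mul hD)

lemma bddLip_feedback (hδ : 0 < δ) :
    BddLip (admissible n m k δ K) fun ζ => ζ.feedback :=
  have h := bddLip_id (n := n) (m := m) (k := k) (δ := δ) (K := K)
  have hB := h.fst.fst.snd.fst
  have hC := h.fst.fst.snd.snd.fst
  have hD := h.fst.fst.snd.snd.snd
  have hN := h.fst.snd.snd.fst.snd.snd.snd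
  have hBh := h.fst.snd.fst.snd.fst
  have hDh := h.fst.snd.fst.snd.snd.snd
  have hG := h.fst.snd.snd.snd
  have hP := h.snd.fst
  have hY := h.snd.snd
  have hi : BddLip (admissible n m k δ K) fun ζ => ζ.gram⁻¹ :=
    bddLip_gram.inv (c := 1 / δ) (by positivity)
      (fun _ hζ => (Matrix.posDef_of_sub_smul_one hδ (gram_sub_posSemidef hζ)).isUnit)
      (fun _ hζ => Matrix.l2_opNorm_inv_le hδ (gram_sub_posSemidef hζ))
  (hi.mul ((hB.transpose.mul hP |>.add
    ((hD.transpose.mul (hP.add ((hY.transpose.mul hN).mul hY))).mul hC)).add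
    (((hBh.transpose.add (hB.transpose.mul hY.transpose)).add
      ((hD.transpose.mul hY.transpose).mul hDh.transpose)).mul hG |>.mul hY))).neg

lemma bddLip_closedA (hδ : 0 < δ) : BddLip (admissible n m k δ K) fun ζ => ζ.closedA :=
  bddLip_id.fst.fst.fst.add (bddLip_id.fst.fst.snd.fst.mul (bddLip_feedback hδ))

lemma bddLip_closedC (hδ : 0 < δ) : BddLip (admissible n m k δ K) fun ζ => ζ.closedC :=
  bddLip_id.fst.fst.snd.snd.fst.add (bddLip_id.fst.fst.snd.snd.snd.mul (bddLip_feedback hδ))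

lemma bddLip_rhs₂ (hδ : 0 < δ) : BddLip (admissible n m k δ K) fun ζ => ζ.rhs₂ :=
  have h := bddLip_id (n := n) (m := m) (k := k) (δ := δ) (K := K)
  have hY := h.snd.snd
  ((hY.mul (bddLip_closedA hδ)).add
    (h.fst.snd.fst.fst.add (h.fst.snd.fst.snd.fst.mul (bddLip_feedback hδ)))).add
    (h.fst.snd.fst.snd.snd.fst.mul hY) |>.add
    ((h.fst.snd.fst.snd.snd.snd.mul hY).mul (bddLip_closedC hδ))

/-- Pairs of configurations, off and on the diagonal, on which the right-hand sides are regular. -/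
def admissiblePairs (n m k : ℕ) (δ K : ℝ) : Set (Config n m k × Config n m k) :=
  {ξ | ‖ξ‖ ≤ K} ×ˢ admissible n m k δ K

lemma bddLip_pairs : BddLip (admissiblePairs n m k δ K) fun w => w :=
  .id_of_bounded (K := K) fun _ hw => max_le hw.1 hw.2.1

lemma bddLip_source (hδ : 0 < δ) :
    BddLip (admissiblePairs n m k δ K) fun w => Config.source w.1.1 w.2 :=
  have h := bddLip_pairs (n := n) (m := m) (k := k) (δ := δ) (K := K)
  have hmap : MapsTo Prod.snd (admissiblePairs n m k δ K) (admissible n m k δ K) := fun _ hw => hw.2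
  have hΘ := (bddLip_feedback hδ).comp h.snd hmap
  have hC := (bddLip_closedC hδ).comp h.snd hmap
  have hw := h.fst.fst.snd.snd.fst
  have hY := h.snd.snd.snd
  ((hw.fst.add ((hΘ.transpose.mul hw.snd.fst).mul hΘ)).add
    ((hY.transpose.mul hw.snd.snd.fst).mul hY)).add
    ((((hC.transpose.mul hY.transpose).mul hw.snd.snd.snd).mul hY).mul hC)

lemma bddLip_rhs₁ (hδ : 0 < δ) :
    BddLip (admissiblePairs n m k δ K) fun w => Config.rhs₁ w.1 w.2 :=
  have h := bddLip_pairs (n := n) (m := m) (k := k) (δ := δ) (K := K)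
  have hmap : MapsTo Prod.snd (admissiblePairs n m k δ K) (admissible n m k δ K) := fun _ hw => hw.2
  have hA := (bddLip_closedA hδ).comp h.snd hmap
  have hC := (bddLip_closedC hδ).comp h.snd hmap
  have hP := h.fst.snd.fst
  ((((hP.mul hA).add (hA.transpose.mul hP)).add ((hC.transpose.mul hP).mul hC))).add
    (bddLip_source hδ)

end Regularity

end LQData

/-! ### Truncation of the system -/

namespace Matrix

variable {p : ℕ}

lemma isClosed_posSemidef : IsClosed {P : Matrix (Fin p) (Fin p) ℝ | P.PosSemidef} := by
  have : {P : Matrix (Fin p) (Fin p) ℝ | P.PosSemidef}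
      = {P | Pᵀ = P} ∩ ⋂ x : Fin p → ℝ, {P | 0 ≤ quadLin x P} := by
    ext P
    simp only [mem_ofPred_eq, mem_inter_iff, mem_iInter]
    exact ⟨fun h => ⟨h.transpose_eq, h.quad_nonneg⟩, fun h => posSemidef_of_quad h.1 h.2⟩
  rw [this]
  refine (isClosed_eq continuous_id.matrix_transpose continuous_id).inter
    (isClosed_iInter fun x => isClosed_le continuous_const ?_)
  exact LinearMap.continuous_of_finiteDimensional (quadLin x)

lemma convex_posSemidef : Convex ℝ {P : Matrix (Fin p) (Fin p) ℝ | P.PosSemidef} :=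
  fun _ hP _ hQ _ _ ha hb _ => (hP.smul ha).add (hQ.smul hb)

end Matrix

namespace LQData

variable {n m k : ℕ} {δ K : ℝ}

lemma isClosed_admissible : IsClosed (admissible n m k δ K) := by
  have h1 : IsClosed {ζ : Config n m k | ‖ζ‖ ≤ K} := isClosed_le continuous_norm continuous_const
  have h2 : Continuous fun ζ : Config n m k => ζ.1.2.2.1.2.1 - δ • 1 := by fun_prop
  have h3 : Continuous fun ζ : Config n m k => ζ.1.2.2.1.2.2.2 := by fun_prop
  have h4 : Continuous fun ζ : Config n m k => ζ.2.1 := by fun_prop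
  exact h1.inter ((Matrix.isClosed_posSemidef.preimage h2).inter
    ((Matrix.isClosed_posSemidef.preimage h3).inter (Matrix.isClosed_posSemidef.preimage h4)))

lemma convex_norm_le : Convex ℝ {ζ : Config n m k | ‖ζ‖ ≤ K} := by
  have : {ζ : Config n m k | ‖ζ‖ ≤ K} = Metric.closedBall 0 K := by ext; simp
  rw [this]
  exact convex_closedBall 0 K

lemma convex_admissible : Convex ℝ (admissible n m k δ K) := by
  intro ζ hζ ξ hξ a b ha hb hab
  refine ⟨convex_norm_le hζ.1 hξ.1 ha hb hab, ?_, ?_, ?_⟩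
  · have := Matrix.convex_posSemidef hζ.2.1 hξ.2.1 ha hb hab
    have e : a • (ζ.1.2.2.1.2.1 - δ • 1) + b • (ξ.1.2.2.1.2.1 - δ • 1)
        = (a • ζ + b • ξ).1.2.2.1.2.1 - (a + b) • δ • 1 := by
      simp only [Prod.fst_add, Prod.snd_add, Prod.smul_fst, Prod.smul_snd, smul_sub, add_smul]; abel
    rw [e, hab, one_smul] at this
    exact this
  · exact Matrix.convex_posSemidef hζ.2.2.1 hξ.2.2.1 ha hb hab
  · exact Matrix.convex_posSemidef hζ.2.2.2 hξ.2.2.2 ha hb hab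

lemma admissible_nonempty (hδ : 0 ≤ δ) (hK : δ ≤ K) : (admissible n m k δ K).Nonempty := by
  -- Everything can vanish except `R`, which must dominate `δ`; this point lies in the ball because
  -- `δ ≤ K`.
  refine ⟨(((0, 0, 0, 0), (0, 0, 0, 0), (0, δ • 1, 0, 0), 0), (0, 0)), ?_, ?_, .zero, .zero⟩
  · have h1 : ‖(1 : Matrix (Fin k) (Fin k) ℝ)‖ ≤ 1 :=
      Matrix.l2_opNorm_le_of_forall _ zero_le_one fun x => by simp
    have h2 : ‖(δ • 1 : Matrix (Fin k) (Fin k) ℝ)‖ ≤ K := by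
      rw [norm_smul, Real.norm_of_nonneg hδ]
      exact (mul_le_of_le_one_right hδ h1).trans hK
    have hK0 : 0 ≤ K := hδ.trans hK
    simp only [Prod.norm_def, norm_zero, sup_le_iff]
    exact ⟨⟨by simpa using hK0, by simpa using hK0, ⟨hK0, h2, by simpa using hK0⟩, hK0⟩, hK0, hK0⟩
  · simpa using Matrix.PosSemidef.zero

/-- Lipschitz retractions onto the configurations that are kept off the diagonal and on it. -/
structure Truncation (n m k : ℕ) (δ K : ℝ) where
  /-- the retraction off the diagonal -/
  off : Config n m k → Config n m k
  /-- the retraction on the diagonal -/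
  diag : Config n m k → Config n m k
  lipschitz_off : ∃ L, LipschitzWith L off
  lipschitz_diag : ∃ L, LipschitzWith L diag
  norm_off_le : ∀ ζ, ‖off ζ‖ ≤ K
  diag_mem : ∀ ζ, diag ζ ∈ admissible n m k δ K
  off_eq : ∀ ζ, ‖ζ‖ ≤ K → off ζ = ζ
  diag_eq : ∀ ζ ∈ admissible n m k δ K, diag ζ = ζ

lemma nonempty_truncation (hδ : 0 ≤ δ) (hK : δ ≤ K) : Nonempty (Truncation n m k δ K) := by
  obtain ⟨ρ, L, h1, h2, h3⟩ := exists_lipschitz_retraction (S := {ζ : Config n m k | ‖ζ‖ ≤ K})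
    ⟨0, by simpa using hδ.trans hK⟩ (isClosed_le continuous_norm continuous_const) convex_norm_le
  obtain ⟨ρ', L', h1', h2', h3'⟩ := exists_lipschitz_retraction
    (admissible_nonempty (n := n) (m := m) (k := k) hδ hK) isClosed_admissible convex_admissible
  exact ⟨⟨ρ, ρ', ⟨L, h1⟩, ⟨L', h1'⟩, h2, h2', h3, h3'⟩⟩

/-! ### Measurability, continuity and bounds of the coefficients. -/

section Coefficients

variable {d : LQData n m k} {T : ℝ}

/-- The path `φ` is a constant off the diagonal and the identity on it. -/
lemma Regular.aestronglyMeasurable_coeff (h : d.Regular T) {a : ℝ} (ha : 0 ≤ a) {φ : ℝ → ℝ}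
    (hφ : ContinuousOn φ (Icc a T)) (hm : MapsTo φ (Icc a T) (Icc 0 T)) :
    AEStronglyMeasurable (fun r => d.coeff (φ r) r) (volume.restrict (Icc a T)) := by
  have hsub : Icc a T ⊆ Icc 0 T := Icc_subset_Icc_left ha
  have w : ∀ {p : ℕ} {F : ℝ → ℝ → Matrix (Fin p) (Fin p) ℝ}, SymmContinuous₂ T F →
      AEStronglyMeasurable (fun r => F (φ r) r) (volume.restrict (Icc a T)) := by
    intro p F hF
    have : ContinuousOn (fun r => F (φ r) r) (Icc a T) :=
      hF.1.comp (hφ.prodMk continuousOn_id) fun r hr => ⟨hm hr, hsub hr⟩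
    exact this.memLp_top.1
  have v : ∀ {p q : ℕ} {f : ℝ → Matrix (Fin p) (Fin q) ℝ}, BoundedMeasurable T f →
      AEStronglyMeasurable f (volume.restrict (Icc a T)) := fun hf =>
    (MemLp.aestronglyMeasurable hf).mono_measure (Measure.restrict_mono hsub le_rfl)
  exact ((v h.A).prodMk ((v h.B).prodMk ((v h.C).prodMk (v h.D)))).prodMk
    (((v h.Ah).prodMk ((v h.Bh).prodMk ((v h.Ch).prodMk (v h.Dh)))).prodMk
      (((w h.Q).prodMk ((w h.R).prodMk ((w h.M).prodMk (w h.N)))).prodMk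
        (h.G2.1.mono hsub).memLp_top.1))

lemma Regular.continuousOn_coeff (h : d.Regular T) {r : ℝ} (hr : r ∈ Icc 0 T) :
    ContinuousOn (fun t => d.coeff t r) (Icc 0 T) := by
  have w : ∀ {p : ℕ} {F : ℝ → ℝ → Matrix (Fin p) (Fin p) ℝ}, SymmContinuous₂ T F →
      ContinuousOn (fun t => F t r) (Icc 0 T) := fun hF =>
    hF.1.comp (continuousOn_id.prodMk continuousOn_const) fun t ht => ⟨ht, hr⟩
  exact continuousOn_const.prodMk (continuousOn_const.prodMk
    (((w h.Q).prodMk ((w h.R).prodMk ((w h.M).prodMk (w h.N)))).prodMk continuousOn_const))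

/-- The exceptional null set must not depend on `t`. It does not: the merely measurable coefficients
are functions of `r` alone, and the weights are bounded everywhere. -/
lemma Regular.exists_norm_coeff_le (h : d.Regular T) :
    ∃ Λ, ∀ᵐ r ∂volume.restrict (Icc 0 T), ∀ t ∈ Icc 0 T, ‖d.coeff t r‖ ≤ Λ := by
  have w : ∀ {p : ℕ} {F : ℝ → ℝ → Matrix (Fin p) (Fin p) ℝ}, SymmContinuous₂ T F →
      ∃ c, ∀ t ∈ Icc 0 T, ∀ r ∈ Icc 0 T, ‖F t r‖ ≤ c := by
    intro p F hF
    obtain ⟨c, hc⟩ := (isCompact_Icc.prod isCompact_Icc).exists_bound_of_continuousOn hF.1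
    exact ⟨c, fun t ht r hr => hc (t, r) ⟨ht, hr⟩⟩
  have v : ∀ {p q : ℕ} {f : ℝ → Matrix (Fin p) (Fin q) ℝ}, BoundedMeasurable T f →
      ∃ c, ∀ᵐ r ∂volume.restrict (Icc 0 T), ‖f r‖ ≤ c := fun hf =>
    ⟨_, MemLp.ae_norm_le hf⟩
  obtain ⟨c1, h1⟩ := v h.A
  obtain ⟨c2, h2⟩ := v h.B
  obtain ⟨c3, h3⟩ := v h.C
  obtain ⟨c4, h4⟩ := v h.D
  obtain ⟨c5, h5⟩ := v h.Ah
  obtain ⟨c6, h6⟩ := v h.Bh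
  obtain ⟨c7, h7⟩ := v h.Ch
  obtain ⟨c8, h8⟩ := v h.Dh
  obtain ⟨c9, h9⟩ := w h.Q
  obtain ⟨c10, h10⟩ := w h.R
  obtain ⟨c11, h11⟩ := w h.M
  obtain ⟨c12, h12⟩ := w h.N
  obtain ⟨c13, h13⟩ := isCompact_Icc.exists_bound_of_continuousOn h.G2.1
  refine ⟨max (max c1 (max c2 (max c3 c4))) (max (max c5 (max c6 (max c7 c8)))
    (max (max c9 (max c10 (max c11 c12))) c13)), ?_⟩
  filter_upwards [h1, h2, h3, h4, h5, h6, h7, h8, ae_restrict_mem measurableSet_Icc]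
    with r e1 e2 e3 e4 e5 e6 e7 e8 hr t ht
  exact max_le_max (max_le_max e1 (max_le_max e2 (max_le_max e3 e4)))
    (max_le_max (max_le_max e5 (max_le_max e6 (max_le_max e7 e8)))
      (max_le_max (max_le_max (h9 t ht r hr) (max_le_max (h10 t ht r hr)
        (max_le_max (h11 t ht r hr) (h12 t ht r hr)))) (h13 r hr)))

end Coefficients

/-! ### Well-posedness of the truncated system. -/

namespace Truncation

variable (τ : Truncation n m k δ K) {d : LQData n m k} {T : ℝ} {Z : ℝ → ℝ → Unknown n m}

/-- The right-hand sides after truncation of their arguments. -/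
noncomputable def rhs (w : Config n m k × Config n m k) : Unknown n m :=
  ((τ.off w.1).rhs₁ (τ.diag w.2), (τ.diag w.2).rhs₂)

lemma regular_comp {E : Type*} [NormedAddCommGroup E] {f : Config n m k × Config n m k → E}
    (hf : BddLip (admissiblePairs n m k δ K) f) :
    (∃ L, LipschitzWith L fun w => f (Prod.map τ.off τ.diag w)) ∧
      ∃ c, ∀ w, ‖f (Prod.map τ.off τ.diag w)‖ ≤ c := by
  obtain ⟨L, hL⟩ := τ.lipschitz_off
  obtain ⟨L', hL'⟩ := τ.lipschitz_diag
  exact hf.lipschitzWith_comp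
    ((hL.comp LipschitzWith.prod_fst).prodMk (hL'.comp LipschitzWith.prod_snd))
    fun w => ⟨τ.norm_off_le _, τ.diag_mem _⟩

lemma mapsTo_snd : MapsTo Prod.snd (admissiblePairs n m k δ K) (admissible n m k δ K) :=
  fun _ hw => hw.2

lemma bddLip_snd {E : Type*} [NormedAddCommGroup E] {f : Config n m k → E}
    (hf : BddLip (admissible n m k δ K) f) :
    BddLip (admissiblePairs n m k δ K) fun w => f w.2 :=
  hf.comp bddLip_pairs.snd mapsTo_snd

/-- The truncated system. -/
structure Solves (d : LQData n m k) (T : ℝ) (Z : ℝ → ℝ → Unknown n m) : Prop where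
  cont : ContinuousOn (Function.uncurry Z) (triangle T)
  eq : ∀ t s, 0 ≤ t → t ≤ s → s ≤ T → Z t s =
    (d.G1 t, d.H) + ∫ r in s..T, τ.rhs ((d.coeff t r, Z t r), (d.coeff r r, Z r r))

/-- Both components are treated as functions on the triangle; that the second one does not depend on
`t` comes out afterwards, since neither its equation nor its terminal value involves `t`. -/
theorem exists_unique_solves (hδ : 0 < δ) (hT : 0 ≤ T) (h : d.Regular T) :
    ∃ Z, τ.Solves d T Z ∧ ∀ Y, τ.Solves d T Y →
      ∀ t s, 0 ≤ t → t ≤ s → s ≤ T → Y t s = Z t s := by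
  obtain ⟨⟨L, hL⟩, c, hc⟩ := τ.regular_comp ((bddLip_rhs₁ hδ).prodMk (bddLip_snd (bddLip_rhs₂ hδ)))
  obtain ⟨Z, ⟨h1, h2⟩, h3⟩ := exists_unique_volterra hT (Φ := τ.rhs) hL hc (c := d.coeff)
    (fun t ht => h.aestronglyMeasurable_coeff le_rfl continuousOn_const fun _ _ => ht)
    (h.aestronglyMeasurable_coeff le_rfl continuousOn_id fun _ hr => hr)
    (fun r hr => h.continuousOn_coeff hr) (g := fun t => (d.G1 t, d.H))
    (h.G1.1.prodMk continuousOn_const)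
  exact ⟨Z, ⟨h1, h2⟩, fun Y hY => h3 Y hY.cont hY.eq⟩

end Truncation

end LQData

/-! ### The drift of the value along the diagonal -/

section Drift

open Matrix

variable {n m k : ℕ} {A C P Q : Matrix (Fin n) (Fin n) ℝ} {B D : Matrix (Fin n) (Fin k) ℝ}
  {Ah Y : Matrix (Fin m) (Fin n) ℝ} {Bh : Matrix (Fin m) (Fin k) ℝ}
  {Ch Dh M N G : Matrix (Fin m) (Fin m) ℝ} {R : Matrix (Fin k) (Fin k) ℝ}
  {Θ : Matrix (Fin k) (Fin n) ℝ}

/-- Completion of the square: the part of the drift that contains the feedback. -/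
lemma drift_expand (hP : Pᵀ = P) (hN : Nᵀ = N) (hG : Gᵀ = G) :
    lyapunov (A + B * Θ) (C + D * Θ) P + (Q + Θᵀ * R * Θ + Yᵀ * M * Y
        + (C + D * Θ)ᵀ * Yᵀ * N * Y * (C + D * Θ))
      + (Y * (A + B * Θ) + (Ah + Bh * Θ) + Ch * Y + Dh * Y * (C + D * Θ))ᵀ * G * Y
      + Yᵀ * G * (Y * (A + B * Θ) + (Ah + Bh * Θ) + Ch * Y + Dh * Y * (C + D * Θ))
    = (lyapunov A C P + (Q + Yᵀ * M * Y + Cᵀ * Yᵀ * N * Y * C)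
      + (Y * A + Ah + Ch * Y + Dh * Y * C)ᵀ * G * Y + Yᵀ * G * (Y * A + Ah + Ch * Y + Dh * Y * C))
      + Θᵀ * (R + Dᵀ * (P + Yᵀ * N * Y) * D) * Θ
      + Θᵀ * (Bᵀ * P + Dᵀ * (P + Yᵀ * N * Y) * C + (Bhᵀ + Bᵀ * Yᵀ + Dᵀ * Yᵀ * Dhᵀ) * G * Y)
      + (Bᵀ * P + Dᵀ * (P + Yᵀ * N * Y) * C + (Bhᵀ + Bᵀ * Yᵀ + Dᵀ * Yᵀ * Dhᵀ) * G * Y)ᵀ * Θ := by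
  simp only [lyapunov, transpose_add, transpose_mul, transpose_transpose, Matrix.mul_add,
    Matrix.add_mul, Matrix.mul_assoc, hP, hN, hG]
  abel

/-- The terms with `A` combine to `V A + (V A)ᵀ`, whence `2 ‖A‖ ‖V‖`. The remaining terms use `‖P‖ ≤
‖V‖` and `‖Y‖² ≤ ‖V‖ / δ`. Only the term with `Ah` is linear in `Y`; Young's inequality `2 ‖Y‖ g
‖Ah‖ ≤ ‖Y‖² + g² ‖Ah‖²` produces the summand `1` in the bracket and the inhomogeneity `g² ‖Ah‖²`. -/
lemma norm_uncontrolled_drift_le {δ q μ ν g : ℝ} (hδ : 0 < δ) (hP : P.PosSemidef)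
    (hG : (G - δ • 1).PosSemidef) (hq : ‖Q‖ ≤ q) (hμ : ‖M‖ ≤ μ) (hν : ‖N‖ ≤ ν) (hg : ‖G‖ ≤ g) :
    ‖lyapunov A C P + (Q + Yᵀ * M * Y + Cᵀ * Yᵀ * N * Y * C)
      + (Y * A + Ah + Ch * Y + Dh * Y * C)ᵀ * G * Y
      + Yᵀ * G * (Y * A + Ah + Ch * Y + Dh * Y * C)‖
    ≤ (2 * ‖A‖ + ‖C‖ ^ 2 + 1 / δ * (1 + μ + ν * ‖C‖ ^ 2 + 2 * g * ‖Ch‖ + 2 * g * ‖C‖ * ‖Dh‖))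
        * ‖P + Yᵀ * G * Y‖ + (q + g ^ 2 * ‖Ah‖ ^ 2) := by
  have hGp : G.PosSemidef := by
    have := hG.add ((PosSemidef.one (n := Fin m) (R := ℝ)).smul hδ.le)
    simpa using this
  have hGt := hGp.transpose_eq
  have hYGY := hGp.transpose_mul_mul Y
  set V := P + Yᵀ * G * Y with hV
  have hPV : ‖P‖ ≤ ‖V‖ := hP.l2_opNorm_le_of_sub (by simpa [hV] using hYGY)
  have hYV : ‖Y‖ ^ 2 ≤ ‖V‖ / δ := by
    rw [le_div_iff₀ hδ, mul_comm]
    exact (mul_sq_l2_opNorm_le hδ hG Y).trans (hYGY.l2_opNorm_le_of_sub (by simpa [hV] using hP))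
  have e : lyapunov A C P + (Q + Yᵀ * M * Y + Cᵀ * Yᵀ * N * Y * C)
      + (Y * A + Ah + Ch * Y + Dh * Y * C)ᵀ * G * Y
      + Yᵀ * G * (Y * A + Ah + Ch * Y + Dh * Y * C)
      = (V * A + (V * A)ᵀ) + Cᵀ * P * C + Q + Yᵀ * M * Y + Cᵀ * (Yᵀ * N * Y) * C
        + (Yᵀ * G * Ah + (Yᵀ * G * Ah)ᵀ) + (Yᵀ * G * (Ch * Y) + (Yᵀ * G * (Ch * Y))ᵀ)
        + (Yᵀ * G * (Dh * Y * C) + (Yᵀ * G * (Dh * Y * C))ᵀ) := by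
    simp only [hV, lyapunov, transpose_add, transpose_mul, transpose_transpose, Matrix.mul_add,
      Matrix.add_mul, Matrix.mul_assoc, hP.transpose_eq, hGt]
    abel
  rw [e]
  have two : ∀ X : Matrix (Fin n) (Fin n) ℝ, ‖X + Xᵀ‖ ≤ 2 * ‖X‖ := fun X => by
    refine (norm_add_le _ _).trans ?_
    rw [l2_opNorm_transpose]; linarith
  have m3 : ∀ {p q r s : ℕ} (X : Matrix (Fin p) (Fin q) ℝ) (X' : Matrix (Fin q) (Fin r) ℝ)
      (X'' : Matrix (Fin r) (Fin s) ℝ), ‖X * X' * X''‖ ≤ ‖X‖ * ‖X'‖ * ‖X''‖ := fun X X' X'' =>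
    (l2_opNorm_mul _ _).trans (by gcongr; exact l2_opNorm_mul _ _)
  have hg0 : 0 ≤ g := (norm_nonneg _).trans hg
  have t1 : ‖V * A + (V * A)ᵀ‖ ≤ 2 * (‖V‖ * ‖A‖) :=
    (two _).trans (by gcongr; exact l2_opNorm_mul _ _)
  have t2 : ‖Cᵀ * P * C‖ ≤ ‖C‖ * ‖V‖ * ‖C‖ := by
    refine (m3 _ _ _).trans ?_
    rw [l2_opNorm_transpose]; gcongr
  have t4 : ‖Yᵀ * M * Y‖ ≤ ‖Y‖ * μ * ‖Y‖ := by
    refine (m3 _ _ _).trans ?_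
    rw [l2_opNorm_transpose]; gcongr
  have t5 : ‖Cᵀ * (Yᵀ * N * Y) * C‖ ≤ ‖C‖ * (‖Y‖ * ν * ‖Y‖) * ‖C‖ := by
    refine (m3 _ _ _).trans ?_
    rw [l2_opNorm_transpose]; gcongr
    refine (m3 _ _ _).trans ?_
    rw [l2_opNorm_transpose]; gcongr
  have t6 : ‖Yᵀ * G * Ah + (Yᵀ * G * Ah)ᵀ‖ ≤ 2 * (‖Y‖ * g * ‖Ah‖) := by
    refine (two _).trans ?_
    gcongr
    refine (m3 _ _ _).trans ?_
    rw [l2_opNorm_transpose]; gcongr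
  have t7 : ‖Yᵀ * G * (Ch * Y) + (Yᵀ * G * (Ch * Y))ᵀ‖ ≤ 2 * (‖Y‖ * g * (‖Ch‖ * ‖Y‖)) := by
    refine (two _).trans ?_
    gcongr
    refine (m3 _ _ _).trans ?_
    rw [l2_opNorm_transpose]; gcongr
    exact l2_opNorm_mul _ _
  have t8 : ‖Yᵀ * G * (Dh * Y * C) + (Yᵀ * G * (Dh * Y * C))ᵀ‖
      ≤ 2 * (‖Y‖ * g * (‖Dh‖ * ‖Y‖ * ‖C‖)) := by
    refine (two _).trans ?_
    gcongr
    refine (m3 _ _ _).trans ?_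
    rw [l2_opNorm_transpose]; gcongr
    exact m3 _ _ _
  have hμ0 : 0 ≤ μ := (norm_nonneg _).trans hμ
  have hν0 : 0 ≤ ν := (norm_nonneg _).trans hν
  have t9 : 2 * (‖Y‖ * g * ‖Ah‖) ≤ ‖Y‖ ^ 2 + g ^ 2 * ‖Ah‖ ^ 2 := by
    nlinarith [sq_nonneg (‖Y‖ - g * ‖Ah‖)]
  have t10 : (1 + μ + ν * ‖C‖ ^ 2 + 2 * g * ‖Ch‖ + 2 * g * ‖C‖ * ‖Dh‖) * ‖Y‖ ^ 2
      ≤ (1 + μ + ν * ‖C‖ ^ 2 + 2 * g * ‖Ch‖ + 2 * g * ‖C‖ * ‖Dh‖) * (‖V‖ / δ) := by gcongr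
  have t11 : (1 + μ + ν * ‖C‖ ^ 2 + 2 * g * ‖Ch‖ + 2 * g * ‖C‖ * ‖Dh‖) * (‖V‖ / δ)
      = 1 / δ * (1 + μ + ν * ‖C‖ ^ 2 + 2 * g * ‖Ch‖ + 2 * g * ‖C‖ * ‖Dh‖) * ‖V‖ := by ring
  rw [t11] at t10
  have n1 := norm_add_le ((V * A + (V * A)ᵀ) + Cᵀ * P * C + Q + Yᵀ * M * Y + Cᵀ * (Yᵀ * N * Y) * C
        + (Yᵀ * G * Ah + (Yᵀ * G * Ah)ᵀ) + (Yᵀ * G * (Ch * Y) + (Yᵀ * G * (Ch * Y))ᵀ))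
        (Yᵀ * G * (Dh * Y * C) + (Yᵀ * G * (Dh * Y * C))ᵀ)
  have n2 := norm_add_le ((V * A + (V * A)ᵀ) + Cᵀ * P * C + Q + Yᵀ * M * Y
        + Cᵀ * (Yᵀ * N * Y) * C + (Yᵀ * G * Ah + (Yᵀ * G * Ah)ᵀ))
        (Yᵀ * G * (Ch * Y) + (Yᵀ * G * (Ch * Y))ᵀ)
  have n3 := norm_add_le ((V * A + (V * A)ᵀ) + Cᵀ * P * C + Q + Yᵀ * M * Y
        + Cᵀ * (Yᵀ * N * Y) * C) (Yᵀ * G * Ah + (Yᵀ * G * Ah)ᵀ)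
  have n4 := norm_add_le ((V * A + (V * A)ᵀ) + Cᵀ * P * C + Q + Yᵀ * M * Y) (Cᵀ * (Yᵀ * N * Y) * C)
  have n5 := norm_add_le ((V * A + (V * A)ᵀ) + Cᵀ * P * C + Q) (Yᵀ * M * Y)
  have n6 := norm_add₃_le (a := V * A + (V * A)ᵀ) (b := Cᵀ * P * C) (c := Q)
  linarith

end Drift

namespace LQData

namespace Config

variable {n m k : ℕ} {δ K : ℝ}

/-- The value `P₁ + P₂ᵀ G₂ P₂`. -/
def value (ζ : Config n m k) : Matrix (Fin n) (Fin n) ℝ := ζ.2.1 + ζ.2.2ᵀ * ζ.1.2.2.2 * ζ.2.2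

/-- The rate at which the value decreases along the diagonal. -/
noncomputable def drift (ζ : Config n m k) : Matrix (Fin n) (Fin n) ℝ :=
  rhs₁ ζ ζ + ζ.rhs₂ᵀ * ζ.1.2.2.2 * ζ.2.2 + ζ.2.2ᵀ * ζ.1.2.2.2 * ζ.rhs₂

/-- With `L` the linear term, the feedback satisfies `gram * Θ = -L`. Hence `Θᵀ gram Θ + Θᵀ L + Lᵀ Θ
= -Θᵀ gram Θ ≤ 0`, and only the uncontrolled drift remains to be bounded. -/
lemma quad_drift_le {ζ : Config n m k} (hζ : ζ ∈ admissible n m k δ K) (hδ : 0 < δ)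
    (hG : (ζ.1.2.2.2 - δ • 1).PosSemidef) {q μ ν g : ℝ} (hq : ‖ζ.1.2.2.1.1‖ ≤ q)
    (hμ : ‖ζ.1.2.2.1.2.2.1‖ ≤ μ) (hν : ‖ζ.1.2.2.1.2.2.2‖ ≤ ν) (hg : ‖ζ.1.2.2.2‖ ≤ g)
    (x : Fin n → ℝ) :
    ζ.drift.quad x ≤ ((2 * ‖ζ.1.1.1‖ + ‖ζ.1.1.2.2.1‖ ^ 2 + 1 / δ * (1 + μ + ν * ‖ζ.1.1.2.2.1‖ ^ 2
      + 2 * g * ‖ζ.1.2.1.2.2.1‖ + 2 * g * ‖ζ.1.1.2.2.1‖ * ‖ζ.1.2.1.2.2.2‖)) * ‖ζ.value‖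
      + (q + g ^ 2 * ‖ζ.1.2.1.1‖ ^ 2)) * (x ⬝ᵥ x) := by
  obtain ⟨⟨⟨A, B, C, D⟩, ⟨Ah, Bh, Ch, Dh⟩, ⟨Q, R, M, N⟩, G⟩, P, Y⟩ := ζ
  obtain ⟨-, hR, hN, hP⟩ := hζ
  have hgram :
      (Config.gram (((A, B, C, D), (Ah, Bh, Ch, Dh), (Q, R, M, N), G), P, Y) - δ • 1).PosSemidef :=
    Matrix.sub_smul_one_posSemidef_add hR ((hP.add (hN.transpose_mul_mul _)).transpose_mul_mul _)
  set ζ : Config n m k := (((A, B, C, D), (Ah, Bh, Ch, Dh), (Q, R, M, N), G), P, Y) with hζdef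
  set L := Bᵀ * P + Dᵀ * (P + Yᵀ * N * Y) * C + (Bhᵀ + Bᵀ * Yᵀ + Dᵀ * Yᵀ * Dhᵀ) * G * Y with hL
  have hpd := Matrix.posDef_of_sub_smul_one hδ hgram
  have hΘ : ζ.gram * ζ.feedback = -L := by
    have : ζ.feedback = -(ζ.gram⁻¹ * L) := rfl
    rw [this, Matrix.mul_neg, ← Matrix.mul_assoc,
      Matrix.mul_nonsing_inv _ ((Matrix.isUnit_iff_isUnit_det _).1 hpd.isUnit), Matrix.one_mul]
  have hGt : Gᵀ = G := by
    have := hG.transpose_eq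
    simpa using this
  have hexp := drift_expand (A := A) (B := B) (C := C) (D := D) (Q := Q) (R := R) (M := M)
    (Ah := Ah) (Bh := Bh) (Ch := Ch) (Dh := Dh) (Y := Y) (Θ := ζ.feedback) hP.transpose_eq
    hN.transpose_eq hGt
  have h1 : ζ.feedbackᵀ * L = -(ζ.feedbackᵀ * ζ.gram * ζ.feedback) := by
    rw [Matrix.mul_assoc, hΘ, Matrix.mul_neg, neg_neg]
  have h2 : Lᵀ * ζ.feedback = -(ζ.feedbackᵀ * ζ.gram * ζ.feedback) := by
    have : Lᵀ = -(ζ.feedbackᵀ * ζ.gram) := by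
      rw [← neg_neg L, ← hΘ, Matrix.transpose_neg, Matrix.transpose_mul,
        hpd.posSemidef.transpose_eq]
    rw [this, Matrix.neg_mul]
  rw [← hL] at hexp
  rw [h1, h2] at hexp
  have hd : ζ.drift = _ := hexp
  rw [hd, Matrix.quad_add, Matrix.quad_add, Matrix.quad_add]
  have h3 := (hpd.posSemidef.transpose_mul_mul ζ.feedback).quad_nonneg x
  have h4 : ∀ X : Matrix (Fin n) (Fin n) ℝ, (-X).quad x = -X.quad x := fun X => by
    simp [Matrix.quad, Matrix.neg_mulVec]
  have hgr : R + Dᵀ * (P + Yᵀ * N * Y) * D = ζ.gram := rfl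
  rw [h4, hgr]
  have h5 := norm_uncontrolled_drift_le (A := A) (C := C) (Ah := Ah) (Ch := Ch) (Dh := Dh) (Y := Y)
    hδ hP hG hq hμ hν hg
  have h6 := mul_le_mul_of_nonneg_right h5 (Matrix.dotProduct_self_nonneg' x)
  have h7 := Matrix.quad_le (lyapunov A C P + (Q + Yᵀ * M * Y + Cᵀ * Yᵀ * N * Y * C)
      + (Y * A + Ah + Ch * Y + Dh * Y * C)ᵀ * G * Y
      + Yᵀ * G * (Y * A + Ah + Ch * Y + Dh * Y * C)) x
  have h8 : ζ.value = P + Yᵀ * G * Y := rfl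
  rw [h8]
  linarith

/-- The source is linear in the weights, and each weight other than `Q` enters through a congruence,
which preserves the Loewner order. -/
lemma source_sub_posSemidef {c c' : Coeff n m k} (ζ : Config n m k)
    (hQ : (c.2.2.1.1 - c'.2.2.1.1).PosSemidef) (hR : (c.2.2.1.2.1 - c'.2.2.1.2.1).PosSemidef)
    (hM : (c.2.2.1.2.2.1 - c'.2.2.1.2.2.1).PosSemidef)
    (hN : (c.2.2.1.2.2.2 - c'.2.2.1.2.2.2).PosSemidef) :
    (source c ζ - source c' ζ).PosSemidef := by
  have h := ((hQ.add (hR.transpose_mul_mul ζ.feedback)).add (hM.transpose_mul_mul ζ.2.2)).add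
    (hN.transpose_mul_mul (ζ.2.2 * ζ.closedC))
  convert h using 1
  simp only [source, Matrix.transpose_mul, Matrix.mul_sub, Matrix.sub_mul, Matrix.mul_assoc]
  abel

lemma source_posSemidef {c : Coeff n m k} (ζ : Config n m k)
    (hQ : (c.2.2.1.1).PosSemidef) (hR : (c.2.2.1.2.1).PosSemidef)
    (hM : (c.2.2.1.2.2.1).PosSemidef) (hN : (c.2.2.1.2.2.2).PosSemidef) :
    (source c ζ).PosSemidef := by
  have h0 : source (0 : Coeff n m k) ζ = 0 := by simp [source]
  have := source_sub_posSemidef (c' := 0) ζ (by simpa using hQ) (by simpa using hR)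
    (by simpa using hM) (by simpa using hN)
  simpa [h0] using this

end Config

end LQData

/-! ### Properties of confined solutions -/

namespace LQData

namespace Truncation

variable {n m k : ℕ} {δ K : ℝ} {τ : Truncation n m k δ K} {d : LQData n m k} {T a : ℝ}
  {Z : ℝ → ℝ → Unknown n m} {b : WeightBounds n m k}

/-- The truncated configuration off the diagonal. -/
def offAt (τ : Truncation n m k δ K) (d : LQData n m k) (Z : ℝ → ℝ → Unknown n m) (t r : ℝ) :
    Config n m k := τ.off (d.coeff t r, Z t r)

/-- The truncated configuration on the diagonal. -/
def diagAt (τ : Truncation n m k δ K) (d : LQData n m k) (Z : ℝ → ℝ → Unknown n m) (r : ℝ) :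
    Config n m k := τ.diag (d.coeff r r, Z r r)

namespace Solves

lemma continuousOn_comp (h : τ.Solves d T Z) {φ : ℝ → ℝ}
    (hφ : ContinuousOn φ (Icc a T)) (hm : ∀ r ∈ Icc a T, φ r ∈ Icc 0 r) :
    ContinuousOn (fun r => Z (φ r) r) (Icc a T) :=
  h.cont.comp (hφ.prodMk continuousOn_id) fun r hr => ⟨(hm r hr).1, (hm r hr).2, hr.2⟩

lemma memLp (h : τ.Solves d T Z) (hreg : d.Regular T) {E : Type*} [NormedAddCommGroup E]
    {f : Config n m k × Config n m k → E} (hf : BddLip (admissiblePairs n m k δ K) f) (ha : 0 ≤ a)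
    {φ : ℝ → ℝ} (hφ : ContinuousOn φ (Icc a T)) (hm : ∀ r ∈ Icc a T, φ r ∈ Icc 0 r) :
    MemLp (fun r => f (τ.offAt d Z (φ r) r, τ.diagAt d Z r)) ⊤ (volume.restrict (Icc a T)) := by
  obtain ⟨⟨L, hL⟩, c, hc⟩ := τ.regular_comp hf
  have hid : ∀ r ∈ Icc a T, r ∈ Icc 0 r := fun r hr => ⟨ha.trans hr.1, le_rfl⟩
  refine memLp_top_of_bound ?_ c (Filter.Eventually.of_forall fun r =>
    hc ((d.coeff (φ r) r, Z (φ r) r), (d.coeff r r, Z r r)))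
  refine hL.continuous.comp_aestronglyMeasurable (((hreg.aestronglyMeasurable_coeff ha hφ ?_).prodMk
    (h.continuousOn_comp hφ hm).memLp_top.1).prodMk
    ((hreg.aestronglyMeasurable_coeff ha continuousOn_id ?_).prodMk
      (h.continuousOn_comp continuousOn_id hid).memLp_top.1))
  · exact fun r hr => ⟨(hm r hr).1, (hm r hr).2.trans hr.2⟩
  · exact fun r hr => ⟨ha.trans hr.1, hr.2⟩

lemma memLp_diag (h : τ.Solves d T Z) (hreg : d.Regular T) {E : Type*} [NormedAddCommGroup E]
    {f : Config n m k → E} (hf : BddLip (admissible n m k δ K) f) (ha : 0 ≤ a) :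
    MemLp (fun r => f (τ.diagAt d Z r)) ⊤ (volume.restrict (Icc a T)) :=
  h.memLp hreg (bddLip_snd hf) ha continuousOn_id fun _ hr => ⟨ha.trans hr.1, le_rfl⟩

lemma memLp_off (h : τ.Solves d T Z) (hreg : d.Regular T) {E : Type*} [NormedAddCommGroup E]
    {f : Config n m k × Config n m k → E} (hf : BddLip (admissiblePairs n m k δ K) f) {t : ℝ}
    (ht : 0 ≤ t) (hta : t ≤ a) :
    MemLp (fun r => f (τ.offAt d Z t r, τ.diagAt d Z r)) ⊤ (volume.restrict (Icc a T)) :=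
  h.memLp hreg hf (ht.trans hta) continuousOn_const fun _ hr => ⟨ht, hta.trans hr.1⟩

lemma eq_pair (h : τ.Solves d T Z) (hδ : 0 < δ) (hreg : d.Regular T) {t s : ℝ} (ht : 0 ≤ t)
    (hts : t ≤ s) (hs : s ≤ T) :
    (Z t s).1 = d.G1 t + ∫ r in s..T, Config.rhs₁ (τ.offAt d Z t r) (τ.diagAt d Z r) ∧
    (Z t s).2 = d.H + ∫ r in s..T, (τ.diagAt d Z r).rhs₂ := by
  have hm := (h.memLp_off hreg ((bddLip_rhs₁ hδ).prodMk (bddLip_snd (bddLip_rhs₂ hδ))) ht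
    hts).intervalIntegrable ⟨le_rfl, hs⟩ ⟨hs, le_rfl⟩
  have e1 := intervalIntegral_linearMap_comm
    (LinearMap.fst ℝ (Matrix (Fin n) (Fin n) ℝ) (Matrix (Fin m) (Fin n) ℝ)) hm
  have e2 := intervalIntegral_linearMap_comm
    (LinearMap.snd ℝ (Matrix (Fin n) (Fin n) ℝ) (Matrix (Fin m) (Fin n) ℝ)) hm
  rw [h.eq t s ht hts hs]
  exact ⟨congrArg (d.G1 t + ·) e1.symm, congrArg (d.H + ·) e2.symm⟩

end Solves

/-- A solution of the truncated system that stays in the region without truncation on `[a, T]`, up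
to the truncation of its first component at the positive semidefinite cone. -/
structure Confined (τ : Truncation n m k δ K) (d : LQData n m k) (T a : ℝ)
    (Z : ℝ → ℝ → Unknown n m) (b : WeightBounds n m k) : Prop where
  solves : τ.Solves d T Z
  reg : d.Regular T
  pos : d.Positive T δ
  mono : d.Monotone T b
  a_nonneg : 0 ≤ a
  coeff_le : ∀ᵐ r ∂volume.restrict (Icc 0 T), ∀ t ∈ Icc 0 T, ‖d.coeff t r‖ ≤ K
  norm_le : ∀ t r, 0 ≤ t → t ≤ r → a ≤ r → r ≤ T → ‖Z t r‖ ≤ K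

namespace Confined

lemma off_eq (h : Confined τ d T a Z b) : ∀ᵐ r ∂volume.restrict (Icc a T),
    ∀ t ∈ Icc 0 r, τ.offAt d Z t r = (d.coeff t r, Z t r) := by
  filter_upwards [ae_restrict_mono_Icc h.coeff_le h.a_nonneg le_rfl,
    ae_restrict_mem measurableSet_Icc] with r h1 hr t ht
  exact τ.off_eq _ (max_le (h1 t ⟨ht.1, ht.2.trans hr.2⟩) (h.norm_le t r ht.1 ht.2 hr.1 hr.2))

/-- Only the truncation off the diagonal is removed. The one on the diagonal may still act, but it
affects just the coefficients and the source of an equation that is linear in `P₁(t, ·)`, so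
positivity can be proved without circularity. -/
lemma eq₁ (h : Confined τ d T a Z b) {t s : ℝ} (ht : 0 ≤ t)
    (hts : t ≤ s) (has : a ≤ s) (hs : s ≤ T) :
    (Z t s).1 = d.G1 t + ∫ r in s..T, (lyapunov (τ.diagAt d Z r).closedA (τ.diagAt d Z r).closedC
      (Z t r).1 + Config.source (τ.offAt d Z t r).1 (τ.diagAt d Z r)) := by
  rw [(h.solves.eq_pair h.pos.δ_pos h.reg ht hts hs).1]
  congr 1
  refine intervalIntegral.integral_congr_ae ?_
  filter_upwards [ae_of_ae_restrict_Icc h.off_eq] with r hr hr2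
  rw [uIoc_of_le hs] at hr2
  rw [hr ⟨has.trans hr2.1.le, hr2.2⟩ t ⟨ht, hts.trans hr2.1.le⟩]
  rfl

lemma terminal (h : Confined τ d T a Z b) {t : ℝ} (ht : 0 ≤ t) (htT : t ≤ T) :
    (Z t T).1 = d.G1 t := by
  simpa using (h.solves.eq_pair h.pos.δ_pos h.reg ht htT le_rfl).1

lemma continuousOn_fst (h : Confined τ d T a Z b) {t a' : ℝ} (ht : 0 ≤ t) (hta : t ≤ a') :
    ContinuousOn (fun s => (Z t s).1) (Icc a' T) :=
  (h.solves.continuousOn_comp continuousOn_const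
    fun _ hr => ⟨ht, hta.trans hr.1⟩).fst

lemma posSemidef (h : Confined τ d T a Z b) {t s : ℝ} (ht : 0 ≤ t)
    (hts : t ≤ s) (has : a ≤ s) (hs : s ≤ T) : ((Z t s).1).PosSemidef := by
  have hδ := h.pos.δ_pos
  have hs0 : 0 ≤ s := ht.trans hts
  -- The interval starts at `s`, not at `a`, because `P₁(t, ·)` is governed by the equation only to
  -- the right of `t`.
  refine posSemidef_of_lyapunov (a := s) (b := T) (P := fun s => (Z t s).1)
    (h.solves.memLp_diag h.reg (bddLip_closedA hδ) hs0)
    (h.solves.memLp_diag h.reg (bddLip_closedC hδ) hs0)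
    (h.solves.memLp_off h.reg (bddLip_source hδ) ht hts)
    (h.continuousOn_fst ht hts) ?_ (fun r hr => ?_) ?_ s ⟨le_rfl, hs⟩
  · filter_upwards [ae_restrict_mono_Icc h.off_eq has le_rfl, ae_restrict_mem measurableSet_Icc]
      with r h1 hr
    rw [h1 t ⟨ht, hts.trans hr.1⟩]
    have htr := hts.trans hr.1
    have hR : (d.R t r).PosSemidef :=
      (Matrix.posDef_of_sub_smul_one hδ (h.pos.R t r ht htr hr.2)).posSemidef
    exact Config.source_posSemidef _ (h.pos.Q t r ht htr hr.2) hR (h.pos.M t r ht htr hr.2)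
      (h.pos.N t r ht htr hr.2)
  · rw [h.terminal ht (hts.trans hs)]
    exact h.eq₁ ht (hts.trans hr.1) (has.trans hr.1) hr.2
  · rw [h.terminal ht (hts.trans hs)]
    exact h.pos.G1 t ht (hts.trans hs)

/-- For `t` and `u` the Lyapunov equations have the same coefficients, and monotone weights order
the sources and terminal values. The case `u = s` lets the diagonal dominate the whole triangle. -/
lemma sub_posSemidef (h : Confined τ d T a Z b) {t u s : ℝ} (ht : 0 ≤ t) (htu : t ≤ u)
    (hus : u ≤ s) (has : a ≤ s) (hs : s ≤ T) : ((Z u s).1 - (Z t s).1).PosSemidef := by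
  have hδ := h.pos.δ_pos
  have hts := htu.trans hus
  have hu := ht.trans htu
  have hs0 : 0 ≤ s := ht.trans hts
  have huT := hus.trans hs
  have iS : ∀ {v}, 0 ≤ v → v ≤ s → MemLp (fun r => Config.source (τ.offAt d Z v r).1
      (τ.diagAt d Z r)) ⊤ (volume.restrict (Icc s T)) := fun hv hvs =>
    h.solves.memLp_off h.reg (bddLip_source hδ) hv hvs
  have mA := h.solves.memLp_diag h.reg (bddLip_closedA hδ) hs0
  have mC := h.solves.memLp_diag h.reg (bddLip_closedC hδ) hs0
  refine posSemidef_of_lyapunov (a := s) (b := T) (P := fun s => (Z u s).1 - (Z t s).1) mA mC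
    ((iS hu hus).sub (iS ht hts))
    ((h.continuousOn_fst hu hus).sub (h.continuousOn_fst ht hts)) ?_ (fun r hr => ?_) ?_
    s ⟨le_rfl, hs⟩
  · filter_upwards [ae_restrict_mono_Icc h.off_eq has le_rfl, ae_restrict_mem measurableSet_Icc]
      with r h1 hr
    simp only [Pi.sub_apply]
    rw [h1 t ⟨ht, hts.trans hr.1⟩, h1 u ⟨hu, hus.trans hr.1⟩]
    have hur := hus.trans hr.1
    exact Config.source_sub_posSemidef _ (h.mono.Q t u r ht htu hur hr.2).1
      (h.mono.R t u r ht htu hur hr.2).1 (h.mono.M t u r ht htu hur hr.2).1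
      (h.mono.N t u r ht htu hur hr.2).1
  · have i : ∀ {v}, 0 ≤ v → v ≤ s → IntervalIntegrable (fun r => lyapunov (τ.diagAt d Z r).closedA
        (τ.diagAt d Z r).closedC (Z v r).1 + Config.source (τ.offAt d Z v r).1 (τ.diagAt d Z r))
        volume r T := fun hv hvs =>
      ((memLp_lyapunov mA mC (h.continuousOn_fst hv hvs).memLp_top).add
        (iS hv hvs)).intervalIntegrable hr ⟨hs, le_rfl⟩
    rw [h.terminal ht (hts.trans hs), h.terminal hu huT,
      h.eq₁ ht (hts.trans hr.1) (has.trans hr.1) hr.2,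
      h.eq₁ hu (hus.trans hr.1) (has.trans hr.1) hr.2, add_sub_add_comm,
      ← intervalIntegral.integral_sub (i hu hus) (i ht hts)]
    congr 1
    refine intervalIntegral.integral_congr fun r _ => ?_
    simp only [Pi.sub_apply, lyapunov_sub]
    abel
  · rw [h.terminal ht (hts.trans hs), h.terminal hu huT]
    exact (h.mono.G1 t u ht htu huT).1

lemma snd_eq (h : Confined τ d T a Z b) {t s : ℝ} (ht : 0 ≤ t) (hts : t ≤ s) (hs : s ≤ T) :
    (Z t s).2 = (Z s s).2 := by
  rw [(h.solves.eq_pair h.pos.δ_pos h.reg ht hts hs).2,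
    (h.solves.eq_pair h.pos.δ_pos h.reg (ht.trans hts) le_rfl hs).2]

lemma diag_eq (h : Confined τ d T a Z b) : ∀ᵐ r ∂volume.restrict (Icc a T),
    (d.coeff r r, Z r r) ∈ admissible n m k δ K ∧ τ.diagAt d Z r = (d.coeff r r, Z r r) := by
  filter_upwards [ae_restrict_mono_Icc h.coeff_le h.a_nonneg le_rfl,
    ae_restrict_mem measurableSet_Icc] with r h1 hr
  have h0 : 0 ≤ r := h.a_nonneg.trans hr.1
  have hmem : (d.coeff r r, Z r r) ∈ admissible n m k δ K :=
    ⟨max_le (h1 r ⟨h0, hr.2⟩) (h.norm_le r r h0 le_rfl hr.1 hr.2), h.pos.R r r h0 le_rfl hr.2,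
      h.pos.N r r h0 le_rfl hr.2, h.posSemidef h0 le_rfl hr.1 hr.2⟩
  exact ⟨hmem, τ.diag_eq _ hmem⟩

end Confined

end Truncation

end LQData

/-! ### The a priori estimate -/

namespace LQData

variable {n m k : ℕ} {δ K : ℝ} {d : LQData n m k} {T a : ℝ} {b : WeightBounds n m k}

/-- The exponent in the growth estimate of the value. -/
noncomputable def growth (d : LQData n m k) (δ : ℝ) (b : WeightBounds n m k) (s : ℝ) : ℝ :=
  2 * ‖d.A s‖ + ‖d.C s‖ ^ 2 + 1 / δ * (1 + ‖b.M‖ + ‖b.N‖ * ‖d.C s‖ ^ 2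
    + 2 * gHat b * ‖d.Ch s‖ + 2 * gHat b * ‖d.C s‖ * ‖d.Dh s‖)

/-- The inhomogeneity in the growth estimate of the value. -/
noncomputable def forcing (d : LQData n m k) (b : WeightBounds n m k) (s : ℝ) : ℝ :=
  ‖b.Q‖ + gHat b ^ 2 * ‖d.Ah s‖ ^ 2

lemma gHat_nonneg (b : WeightBounds n m k) : 0 ≤ gHat b := le_max_of_le_left (norm_nonneg _)

lemma growth_nonneg (hδ : 0 < δ) (s : ℝ) : 0 ≤ d.growth δ b s := by
  have := gHat_nonneg b
  unfold growth; positivity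

lemma forcing_nonneg (s : ℝ) : 0 ≤ d.forcing b s := by unfold forcing; positivity

lemma _root_.MeasureTheory.MemLp.mul_real {μ : Measure ℝ} {f g : ℝ → ℝ} (hf : MemLp f ⊤ μ)
    (hg : MemLp g ⊤ μ) : MemLp (fun s => f s * g s) ⊤ μ := by
  refine memLp_top_of_bound (hf.1.mul hg.1)
    ((eLpNorm f ⊤ μ).toReal * (eLpNorm g ⊤ μ).toReal) ?_
  filter_upwards [hf.ae_norm_le, hg.ae_norm_le] with r h1 h2
  rw [norm_mul]; gcongr

lemma memLp_growth (h : d.Regular T) : MemLp (d.growth δ b) ⊤ (volume.restrict (Icc 0 T)) := by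
  have hA : MemLp (fun s => ‖d.A s‖) ⊤ (volume.restrict (Icc 0 T)) := MemLp.norm h.A
  have hC : MemLp (fun s => ‖d.C s‖) ⊤ (volume.restrict (Icc 0 T)) := MemLp.norm h.C
  have hCh : MemLp (fun s => ‖d.Ch s‖) ⊤ (volume.restrict (Icc 0 T)) := MemLp.norm h.Ch
  have hDh : MemLp (fun s => ‖d.Dh s‖) ⊤ (volume.restrict (Icc 0 T)) := MemLp.norm h.Dh
  have hc : ∀ c : ℝ, MemLp (fun _ : ℝ => c) ⊤ (volume.restrict (Icc 0 T)) := memLp_top_const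
  have hC2 := hC.mul_real hC
  have key := ((((hc 2).mul_real hA).add hC2).add ((hc (1 / δ)).mul_real
    (((((hc (1 + ‖b.M‖)).add ((hc ‖b.N‖).mul_real hC2)).add ((hc (2 * gHat b)).mul_real hCh)).add
      (((hc (2 * gHat b)).mul_real hC).mul_real hDh)))))
  exact key.ae_eq (Filter.Eventually.of_forall fun s => by simp only [growth, Pi.add_apply, sq])

lemma memLp_forcing (h : d.Regular T) : MemLp (d.forcing b) ⊤ (volume.restrict (Icc 0 T)) := by
  have hA : MemLp (fun s => ‖d.Ah s‖) ⊤ (volume.restrict (Icc 0 T)) := MemLp.norm h.Ah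
  have hc : ∀ c : ℝ, MemLp (fun _ : ℝ => c) ⊤ (volume.restrict (Icc 0 T)) := memLp_top_const
  have key := (hc ‖b.Q‖).add ((hc (gHat b ^ 2)).mul_real (hA.mul_real hA))
  convert key using 1
  ext s
  simp only [forcing, Pi.add_apply, sq]

lemma _root_.MeasureTheory.MemLp.restrict_Icc_left {E : Type*} [NormedAddCommGroup E] {f : ℝ → E}
    (hf : MemLp f ⊤ (volume.restrict (Icc 0 T))) (ha : 0 ≤ a) :
    MemLp f ⊤ (volume.restrict (Icc a T)) :=
  hf.mono_measure (Measure.restrict_mono (Icc_subset_Icc_left ha) le_rfl)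

lemma Positive.G2_posSemidef (h : d.Positive T δ) {t : ℝ} (ht : 0 ≤ t) (htT : t ≤ T) :
    (d.G2 t).PosSemidef :=
  (Matrix.posDef_of_sub_smul_one h.δ_pos (h.G2 t ht htT)).posSemidef

lemma norm_G2_le (h : d.Positive T δ) (h' : d.Monotone T b) {t : ℝ} (ht : 0 ≤ t) (htT : t ≤ T) :
    ‖d.G2 t‖ ≤ gHat b :=
  ((h.G2_posSemidef ht htT).l2_opNorm_le_of_sub (h'.G2 t t ht le_rfl htT).2).trans
    (le_max_right _ _)

lemma norm_G1_le (h : d.Positive T δ) (h' : d.Monotone T b) {t : ℝ} (ht : 0 ≤ t) (htT : t ≤ T) :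
    ‖d.G1 t‖ ≤ gHat b :=
  ((h.G1 t ht htT).l2_opNorm_le_of_sub (h'.G1 t t ht le_rfl htT).2).trans (le_max_left _ _)

namespace Truncation

variable {τ : Truncation n m k δ K} {Z : ℝ → ℝ → Unknown n m}

/-- The value on the diagonal. -/
def valueAt (d : LQData n m k) (Z : ℝ → ℝ → Unknown n m) (r : ℝ) : Matrix (Fin n) (Fin n) ℝ :=
  Config.value (d.coeff r r, Z r r)

namespace Confined

lemma continuousOn_diag (h : Confined τ d T a Z b) : ContinuousOn (fun r => Z r r) (Icc a T) :=
  h.solves.continuousOn_comp continuousOn_id fun _ hr => ⟨h.a_nonneg.trans hr.1, le_rfl⟩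

lemma continuousOn_valueAt (h : Confined τ d T a Z b) : ContinuousOn (valueAt d Z) (Icc a T) := by
  have hG : ContinuousOn d.G2 (Icc a T) := h.reg.G2.1.mono (Icc_subset_Icc_left h.a_nonneg)
  have hc : Continuous fun w : Unknown n m × Matrix (Fin m) (Fin m) ℝ =>
      w.1.1 + w.1.2ᵀ * w.2 * w.1.2 := by fun_prop
  exact hc.comp_continuousOn (h.continuousOn_diag.prodMk hG)

lemma valueAt_posSemidef (h : Confined τ d T a Z b) {t : ℝ} (ha : a ≤ t) (ht : t ≤ T) :
    (valueAt d Z t).PosSemidef :=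
  have h0 := h.a_nonneg.trans ha
  (h.posSemidef h0 le_rfl ha ht).add ((h.pos.G2_posSemidef h0 ht).transpose_mul_mul _)

lemma quad_drift_le (h : Confined τ d T a Z b) : ∀ᵐ r ∂volume.restrict (Icc a T), ∀ x,
    (Config.drift (d.coeff r r, Z r r)).quad x
      ≤ (d.growth δ b r * ‖valueAt d Z r‖ + d.forcing b r) * (x ⬝ᵥ x) := by
  filter_upwards [h.diag_eq, ae_restrict_mem measurableSet_Icc] with r h1 hr x
  have h0 := h.a_nonneg.trans hr.1
  exact Config.quad_drift_le h1.1 h.pos.δ_pos (h.pos.G2 r h0 hr.2)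
    ((h.pos.Q r r h0 le_rfl hr.2).l2_opNorm_le_of_sub (h.mono.Q r r r h0 le_rfl le_rfl hr.2).2)
    ((h.pos.M r r h0 le_rfl hr.2).l2_opNorm_le_of_sub (h.mono.M r r r h0 le_rfl le_rfl hr.2).2)
    ((h.pos.N r r h0 le_rfl hr.2).l2_opNorm_le_of_sub (h.mono.N r r r h0 le_rfl le_rfl hr.2).2)
    (norm_G2_le h.pos h.mono h0 hr.2) x

/-- The merely measurable coefficients depend on `r` alone and cancel; the weights and `Z` are
uniformly continuous on the triangle. -/
lemma exists_modulus_config (h : Confined τ d T a Z b) {ε : ℝ} (hε : 0 < ε) :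
    ∃ η > 0, ∀ t r, 0 ≤ t → t ≤ r → r ≤ T → r - t < η →
      ‖(d.coeff t r, Z t r) - (d.coeff r r, Z r r)‖ ≤ ε := by
  have hsub : triangle T ⊆ Icc 0 T ×ˢ Icc 0 T := by
    rintro ⟨t, s⟩ ⟨h1, h2, h3⟩
    exact ⟨⟨h1, h2.trans h3⟩, ⟨h1.trans h2, h3⟩⟩
  have hu := (isCompact_triangle T).uniformContinuousOn_of_continuous
    ((((h.reg.Q.1.mono hsub).prodMk ((h.reg.R.1.mono hsub).prodMk ((h.reg.M.1.mono hsub).prodMk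
      (h.reg.N.1.mono hsub))))).prodMk h.solves.cont)
  obtain ⟨η, hη, H⟩ := Metric.uniformContinuousOn_iff.1 hu ε hε
  refine ⟨η, hη, fun t r h1 h2 h3 h4 => ?_⟩
  have hd := (H (t, r) ⟨h1, h2, h3⟩ (r, r) ⟨h1.trans h2, le_rfl, h3⟩ (by
    rw [Prod.dist_eq, dist_self, Real.dist_eq, abs_sub_comm, abs_of_nonneg (sub_nonneg.2 h2)]
    exact max_lt h4 hη)).le
  rw [dist_eq_norm] at hd
  simp only [Prod.norm_def, Prod.fst_sub, Prod.snd_sub, Function.uncurry, coeff, sub_self,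
    norm_zero,
    sup_le_iff] at hd ⊢
  exact ⟨⟨hε.le, hε.le, hd.1, hε.le⟩, hd.2⟩

/-- Controls the replacement of the running product `G₂(r) P₂(r)` in the drift by the frozen `G₂(t)
P₂(u)` in the expansion of the value. -/
lemma exists_modulus_weighted (h : Confined τ d T a Z b) {ε : ℝ} (hε : 0 < ε) :
    ∃ η > 0, ∀ t u, a ≤ t → t ≤ u → u ≤ T → u - t < η → ∀ r ∈ Icc t u,
      ‖d.G2 t * (Z u u).2 - d.G2 r * (Z r r).2‖ ≤ ε := by
  have hG : ContinuousOn d.G2 (Icc a T) := h.reg.G2.1.mono (Icc_subset_Icc_left h.a_nonneg)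
  have hc : Continuous fun w : Matrix (Fin m) (Fin m) ℝ × Matrix (Fin m) (Fin n) ℝ =>
      w.1 * w.2 := by fun_prop
  have hcont : ContinuousOn (fun p : ℝ × ℝ => d.G2 p.1 * (Z p.2 p.2).2) (Icc a T ×ˢ Icc a T) :=
    hc.comp_continuousOn ((hG.comp _root_.continuousOn_fst fun _ hp => hp.1).prodMk
      (h.continuousOn_diag.snd.comp continuousOn_snd fun _ hp => hp.2))
  have hu := (isCompact_Icc.prod isCompact_Icc).uniformContinuousOn_of_continuous hcont
  obtain ⟨η, hη, H⟩ := Metric.uniformContinuousOn_iff.1 hu ε hε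
  refine ⟨η, hη, fun t u h1 h2 h3 h4 r hr => ?_⟩
  rw [← dist_eq_norm]
  refine (H (t, u) ⟨⟨h1, h2.trans h3⟩, ⟨h1.trans h2, h3⟩⟩ (r, r)
    ⟨⟨h1.trans hr.1, hr.2.trans h3⟩, ⟨h1.trans hr.1, hr.2.trans h3⟩⟩ ?_).le
  rw [Prod.dist_eq, Real.dist_eq, Real.dist_eq, abs_sub_comm, abs_of_nonneg (sub_nonneg.2 hr.1),
    abs_of_nonneg (sub_nonneg.2 hr.2)]
  exact max_lt (by linarith [hr.2]) (by linarith [hr.1])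

lemma snd_diag_eq (h : Confined τ d T a Z b) {t u : ℝ} (ha : a ≤ t) (htu : t ≤ u) (hu : u ≤ T) :
    (Z t t).2 = (Z u u).2 + ∫ r in t..u, (τ.diagAt d Z r).rhs₂ := by
  have hδ := h.pos.δ_pos
  refine integral_eq_of_backward (f := fun s => (Z s s).2) (a := a) (b := T)
    (h.solves.memLp_diag h.reg (bddLip_rhs₂ hδ) h.a_nonneg) (fun s hs => ?_) ha htu hu
  have h0 := h.a_nonneg.trans hs.1
  rw [(h.solves.eq_pair hδ h.reg h0 le_rfl hs.2).2,
    (h.solves.eq_pair hδ h.reg (h0.trans hs.2) le_rfl le_rfl).2]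
  simp

lemma fst_eq (h : Confined τ d T a Z b) {t u : ℝ} (ht : 0 ≤ t) (htu : t ≤ u) (hu : u ≤ T) :
    (Z t t).1 = (Z t u).1 + ∫ r in t..u, Config.rhs₁ (τ.offAt d Z t r) (τ.diagAt d Z r) := by
  have hδ := h.pos.δ_pos
  refine integral_eq_of_backward (f := fun s => (Z t s).1) (a := t) (b := T)
    (h.solves.memLp_off h.reg (bddLip_rhs₁ hδ) ht le_rfl) (fun s hs => ?_) le_rfl htu hu
  rw [(h.solves.eq_pair hδ h.reg ht hs.1 hs.2).1,
    (h.solves.eq_pair hδ h.reg ht (hs.1.trans hs.2) le_rfl).1]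
  simp

/-- The value decreases along the diagonal at least as fast as its drift, up to a small error. -/
lemma value_step (h : Confined τ d T a Z b) {ε : ℝ} (hε : 0 < ε) :
    ∃ η > 0, ∀ t u, a ≤ t → t ≤ u → u ≤ T → u - t < η →
      ‖valueAt d Z t‖ ≤ ‖valueAt d Z u‖ * (1 + ∫ r in t..u, d.growth δ b r)
        + (∫ r in t..u, d.forcing b r) + ε * (u - t) := by
  have hδ := h.pos.δ_pos
  have mα := (memLp_growth (δ := δ) (b := b) h.reg).restrict_Icc_left h.a_nonneg
  have mβ := (memLp_forcing (b := b) h.reg).restrict_Icc_left h.a_nonneg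
  set cα := (eLpNorm (d.growth δ b) ⊤ (volume.restrict (Icc a T))).toReal
  have hcα : ∀ᵐ r ∂volume.restrict (Icc a T), ‖d.growth δ b r‖ ≤ cα := mα.ae_norm_le
  have hcα0 : 0 ≤ cα := ENNReal.toReal_nonneg
  obtain ⟨⟨L, hL⟩, -⟩ := τ.regular_comp (bddLip_rhs₁ hδ)
  obtain ⟨-, c, hc⟩ := τ.regular_comp (bddLip_snd (bddLip_rhs₂ hδ))
  have hρ : ∀ r, ‖(τ.diagAt d Z r).rhs₂‖ ≤ c := fun r => hc (0, (d.coeff r r, Z r r))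
  have hc0 : 0 ≤ c := (norm_nonneg _).trans (hρ 0)
  have hg0 := gHat_nonneg b
  -- `ε'` bounds three freezing errors: that of `‖V‖` (weight `cα`), the passage from `(t, r)` to
  -- `(r, r)` (weight `L`), and that of `G₂ P₂` (weight `2 * c`). The other half of `ε` pays,
  -- through `θ`, for the term quadratic in the increment of `P₂`.
  set ε' := ε / 2 / (cα + L + 2 * c + 1)
  have hε' : 0 < ε' := by positivity
  have hε'2 : (cα + L + 2 * c) * ε' ≤ ε / 2 := by
    rw [← mul_div_assoc, div_le_iff₀ (by positivity)]
    nlinarith [show 0 ≤ cα + L + 2 * c by positivity]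
  set θ := ε / 2 / (gHat b * c ^ 2 + 1)
  have hθ : 0 < θ := by positivity
  have hθ2 : gHat b * c ^ 2 * θ ≤ ε / 2 := by
    rw [← mul_div_assoc, div_le_iff₀ (by positivity)]
    nlinarith [show 0 ≤ gHat b * c ^ 2 by positivity]
  obtain ⟨η₁, hη₁, H₁⟩ := h.exists_modulus_config hε'
  obtain ⟨η₂, hη₂, H₂⟩ := exists_modulus h.continuousOn_valueAt hε'
  obtain ⟨η₃, hη₃, H₃⟩ := h.exists_modulus_weighted hε'
  refine ⟨min (min η₁ η₂) (min η₃ θ), by positivity, fun t u ha htu huT hlt => ?_⟩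
  have hlt₁ : u - t < η₁ := hlt.trans_le ((min_le_left _ _).trans (min_le_left _ _))
  have hlt₂ : u - t < η₂ := hlt.trans_le ((min_le_left _ _).trans (min_le_right _ _))
  have hlt₃ : u - t < η₃ := hlt.trans_le ((min_le_right _ _).trans (min_le_left _ _))
  have hltθ : u - t ≤ θ := (hlt.trans_le ((min_le_right _ _).trans (min_le_right _ _))).le
  have ht0 : 0 ≤ t := h.a_nonneg.trans ha
  have hh : 0 ≤ u - t := sub_nonneg.2 htu
  have htI : t ∈ Icc a T := ⟨ha, htu.trans huT⟩
  have huI : u ∈ Icc a T := ⟨ha.trans htu, huT⟩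
  have hGt := (h.pos.G2_posSemidef ht0 (htu.trans huT)).transpose_eq
  set Yu := (Z u u).2
  set Δ := ∫ r in t..u, (τ.diagAt d Z r).rhs₂ with hΔ
  have hΔn : ‖Δ‖ ≤ c * (u - t) :=
    norm_integral_le_of_ae_bound htu (Filter.Eventually.of_forall fun r => hρ r)
  let ℓ : Matrix (Fin m) (Fin n) ℝ →ₗ[ℝ] Matrix (Fin n) (Fin n) ℝ :=
    { toFun := fun M => Mᵀ * d.G2 t * Yu + Yuᵀ * d.G2 t * M
      map_add' := fun M N => by
        simp only [Matrix.mul_add, Matrix.transpose_add, Matrix.add_mul]; abel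
      map_smul' := fun c M => by simp }
  have i₁ : IntervalIntegrable (fun r => Config.rhs₁ (τ.offAt d Z t r) (τ.diagAt d Z r))
      volume t u :=
    (h.solves.memLp_off h.reg (bddLip_rhs₁ hδ) ht0 le_rfl).intervalIntegrable
      ⟨le_rfl, htu.trans huT⟩ ⟨htu, huT⟩
  have i₂ : IntervalIntegrable (fun r => (τ.diagAt d Z r).rhs₂) volume t u :=
    (h.solves.memLp_diag h.reg (bddLip_rhs₂ hδ) h.a_nonneg).intervalIntegrable htI huI
  have iℓ := intervalIntegrable_linearMap ℓ i₂
  have hℓ := intervalIntegral_linearMap_comm ℓ i₂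
  set F : ℝ → Matrix (Fin n) (Fin n) ℝ := fun r =>
    Config.rhs₁ (τ.offAt d Z t r) (τ.diagAt d Z r) + ℓ (τ.diagAt d Z r).rhs₂
  have iF : IntervalIntegrable F volume t u := i₁.add iℓ
  -- Only the second time moves, from `t` to `u`: `P₁(t, ·)` and `P₂` follow their equations, while
  -- `G₂` stays at `t`. No derivative in the first time is needed.
  have hV : valueAt d Z t = (Z t u).1 + Yuᵀ * d.G2 t * Yu + (∫ r in t..u, F r)
      + Δᵀ * d.G2 t * Δ := by
    have e1 : valueAt d Z t = (Z t t).1 + (Z t t).2ᵀ * d.G2 t * (Z t t).2 := rfl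
    rw [e1, h.fst_eq ht0 htu huT, h.snd_diag_eq ha htu huT,
      intervalIntegral.integral_add i₁ iℓ, hℓ]
    simp only [ℓ, LinearMap.coe_mk, AddHom.coe_mk, Matrix.transpose_add, Matrix.mul_add,
      Matrix.add_mul]
    abel
  have hFle : ∀ x : Fin n → ℝ, (∫ r in t..u, F r).quad x
      ≤ ((∫ r in t..u, d.growth δ b r) * (‖valueAt d Z u‖ + ε') + (∫ r in t..u, d.forcing b r)
        + (L + 2 * c) * ε' * (u - t)) * (x ⬝ᵥ x) := by
    intro x
    have hx := Matrix.dotProduct_self_nonneg' x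
    have e : (∫ r in t..u, F r).quad x = ∫ r in t..u, (F r).quad x :=
      (intervalIntegral_linearMap_comm (Matrix.quadLin x) iF).symm
    have iα := mα.intervalIntegrable htI huI
    have iβ := mβ.intervalIntegrable htI huI
    have ic : IntervalIntegrable (fun _ : ℝ => (L + 2 * c) * ε') volume t u := by simp
    have e2 : ((∫ r in t..u, d.growth δ b r) * (‖valueAt d Z u‖ + ε') + (∫ r in t..u, d.forcing b r)
        + (L + 2 * c) * ε' * (u - t)) * (x ⬝ᵥ x) = ∫ r in t..u, (d.growth δ b r *
          (‖valueAt d Z u‖ + ε') + d.forcing b r + (L + 2 * c) * ε') * (x ⬝ᵥ x) := by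
      rw [intervalIntegral.integral_mul_const, intervalIntegral.integral_add
        ((iα.mul_const _).add iβ) ic, intervalIntegral.integral_add (iα.mul_const _) iβ,
        intervalIntegral.integral_mul_const, intervalIntegral.integral_const, smul_eq_mul,
        mul_comm (u - t)]
    rw [e, e2]
    refine intervalIntegral.integral_mono_ae_restrict htu
      (intervalIntegrable_linearMap (Matrix.quadLin x) iF)
      ((((iα.mul_const _).add iβ).add ic).mul_const _) ?_
    filter_upwards [ae_restrict_mono_Icc h.off_eq ha huT, ae_restrict_mono_Icc h.diag_eq ha huT,
      ae_restrict_mono_Icc h.quad_drift_le ha huT, ae_restrict_mem measurableSet_Icc]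
      with r hoff hdiag hdrift hr
    have hr0 : 0 ≤ r := ht0.trans hr.1
    have hGr := (h.pos.G2_posSemidef hr0 (hr.2.trans huT)).transpose_eq
    set ζ : Config n m k := (d.coeff r r, Z r r)
    set E := d.G2 t * Yu - d.G2 r * (Z r r).2
    have hE : ‖E‖ ≤ ε' := H₃ t u ha htu huT hlt₃ r hr
    set ρ := (τ.diagAt d Z r).rhs₂
    -- The integrand is the drift on the diagonal, plus the error of moving `P₁` and the weights
    -- from `(t, r)` to `(r, r)`, plus that of freezing `G₂ P₂`.
    have hsplit : F r = ζ.drift + ((Config.rhs₁ (τ.offAt d Z t r) (τ.diagAt d Z r)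
        - Config.rhs₁ (τ.offAt d Z r r) (τ.diagAt d Z r)) + (ρᵀ * E + Eᵀ * ρ)) := by
      have e3 : ζ.drift = Config.rhs₁ (τ.offAt d Z r r) (τ.diagAt d Z r)
          + ρᵀ * d.G2 r * (Z r r).2 + (Z r r).2ᵀ * d.G2 r * ρ := by
        simp only [ρ, hoff r ⟨hr0, le_rfl⟩, hdiag.2]; rfl
      rw [e3]
      simp only [F, ℓ, E, ρ, LinearMap.coe_mk, AddHom.coe_mk, Matrix.transpose_sub,
        Matrix.transpose_mul, hGt, hGr, Matrix.mul_sub, Matrix.sub_mul, Matrix.mul_assoc]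
      abel
    have n1 : ‖Config.rhs₁ (τ.offAt d Z t r) (τ.diagAt d Z r)
        - Config.rhs₁ (τ.offAt d Z r r) (τ.diagAt d Z r)‖ ≤ L * ε' := by
      refine (hL.norm_sub_le ((d.coeff t r, Z t r), ζ) (ζ, ζ)).trans ?_
      gcongr
      have hm := H₁ t r ht0 hr.1 (hr.2.trans huT) (by linarith [hr.2])
      rw [Prod.norm_def, Prod.fst_sub, Prod.snd_sub, sub_self, norm_zero]
      exact max_le hm hε'.le
    have n2 : ‖ρᵀ * E + Eᵀ * ρ‖ ≤ 2 * c * ε' := by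
      have a1 : ‖ρᵀ * E‖ ≤ c * ε' := (Matrix.l2_opNorm_mul _ _).trans (by
        rw [Matrix.l2_opNorm_transpose]; gcongr; exact hρ r)
      have a2 : ‖Eᵀ * ρ‖ ≤ ε' * c := (Matrix.l2_opNorm_mul _ _).trans (by
        rw [Matrix.l2_opNorm_transpose]; gcongr; exact hρ r)
      refine (norm_add_le _ _).trans ?_
      linarith
    have n3 := (norm_add_le _ _).trans (add_le_add n1 n2)
    have q1 := hdrift x
    have q2 := (Matrix.quad_le _ x).trans (mul_le_mul_of_nonneg_right n3 hx)
    have hval : ‖valueAt d Z r‖ ≤ ‖valueAt d Z u‖ + ε' := by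
      have := norm_le_norm_add_norm_sub' (valueAt d Z r) (valueAt d Z u)
      linarith [H₂ t u ha htu huT hlt₂ r hr]
    have q3 := mul_le_mul_of_nonneg_right
      (mul_le_mul_of_nonneg_left hval (growth_nonneg (d := d) (b := b) hδ r)) hx
    rw [hsplit, Matrix.quad_add]
    linarith
  have hαint : (∫ r in t..u, d.growth δ b r) ≤ cα * (u - t) :=
    (le_abs_self _).trans (norm_integral_le_of_ae_bound htu (ae_restrict_mono_Icc hcα ha huT))
  have hα0 : 0 ≤ ∫ r in t..u, d.growth δ b r :=
    intervalIntegral.integral_nonneg htu fun r _ => growth_nonneg hδ r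
  have hβ0 : 0 ≤ ∫ r in t..u, d.forcing b r :=
    intervalIntegral.integral_nonneg htu fun r _ => forcing_nonneg r
  refine (h.valueAt_posSemidef ha (htu.trans huT)).l2_opNorm_le (by positivity) fun x => ?_
  have hx := Matrix.dotProduct_self_nonneg' x
  rw [hV, Matrix.quad_add, Matrix.quad_add, Matrix.quad_add]
  -- Monotonicity in the first time enters here: `P₁(t, u) ≤ P₁(u, u)` and `G₂(t) ≤ G₂(u)` bound the
  -- leading terms by the value at `u`.
  have s1 := (h.sub_posSemidef ht0 htu le_rfl (ha.trans htu) huT).quad_nonneg x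
  have s2 := ((h.mono.G2 t u ht0 htu huT).1.transpose_mul_mul Yu).quad_nonneg x
  have s3 : (Yuᵀ * (d.G2 u - d.G2 t) * Yu).quad x
      = (Yuᵀ * d.G2 u * Yu).quad x - (Yuᵀ * d.G2 t * Yu).quad x := by
    rw [Matrix.mul_sub, Matrix.sub_mul, Matrix.quad_sub]
  have s4 : (Z u u).1.quad x + (Yuᵀ * d.G2 u * Yu).quad x ≤ ‖valueAt d Z u‖ * (x ⬝ᵥ x) := by
    rw [← Matrix.quad_add]; exact Matrix.quad_le (valueAt d Z u) x
  have s5 : ‖Δᵀ * d.G2 t * Δ‖ ≤ ε / 2 * (u - t) := by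
    calc ‖Δᵀ * d.G2 t * Δ‖ ≤ ‖Δ‖ * ‖d.G2 t‖ * ‖Δ‖ := by
          refine (Matrix.l2_opNorm_mul _ _).trans ?_
          gcongr
          refine (Matrix.l2_opNorm_mul _ _).trans ?_
          rw [Matrix.l2_opNorm_transpose]
      _ ≤ (c * (u - t)) * gHat b * (c * (u - t)) := by
          gcongr
          exact norm_G2_le h.pos h.mono ht0 (htu.trans huT)
      _ = (gHat b * c ^ 2 * (u - t)) * (u - t) := by ring
      _ ≤ (gHat b * c ^ 2 * θ) * (u - t) := by gcongr
      _ ≤ _ := by gcongr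
  have s6 := (Matrix.quad_le _ x).trans (mul_le_mul_of_nonneg_right s5 hx)
  rw [Matrix.quad_sub] at s1
  have s7 : (∫ r in t..u, d.growth δ b r) * ε' ≤ cα * (u - t) * ε' := by gcongr
  have s8 : ((∫ r in t..u, d.growth δ b r) * (‖valueAt d Z u‖ + ε') + (∫ r in t..u, d.forcing b r)
        + (L + 2 * c) * ε' * (u - t)) * (x ⬝ᵥ x) ≤ ((∫ r in t..u, d.growth δ b r) * ‖valueAt d Z u‖
        + (∫ r in t..u, d.forcing b r) + ε / 2 * (u - t)) * (x ⬝ᵥ x) := by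
    have := mul_le_mul_of_nonneg_right hε'2 hh
    refine mul_le_mul_of_nonneg_right ?_ hx
    linarith
  have s9 := hFle x
  linarith

lemma norm_valueAt_le (h : Confined τ d T a Z b) {t : ℝ} (ha : a ≤ t) (ht : t ≤ T) :
    ‖valueAt d Z t‖ ≤ d.valueBound T δ b := by
  have hδ := h.pos.δ_pos
  have h0 : 0 ≤ t := h.a_nonneg.trans ha
  have hT0 : 0 ≤ T := h0.trans ht
  have hg0 := gHat_nonneg b
  have mα := memLp_growth (δ := δ) (b := b) h.reg
  have mβ := memLp_forcing (b := b) h.reg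
  have haI : a ∈ Icc 0 T := ⟨h.a_nonneg, ha.trans ht⟩
  have htI : t ∈ Icc 0 T := ⟨h0, ht⟩
  have hTI : T ∈ Icc 0 T := ⟨hT0, le_rfl⟩
  have h0I : (0 : ℝ) ∈ Icc 0 T := ⟨le_rfl, hT0⟩
  have hgron := backward_gronwall (mα.intervalIntegrable haI hTI) (mβ.intervalIntegrable haI hTI)
    (growth_nonneg hδ) forcing_nonneg (f := fun s => ‖valueAt d Z s‖) (fun _ => norm_nonneg _)
    (fun ε hε => h.value_step hε) ha ht
  have hVT : ‖valueAt d Z T‖ ≤ gHat b + gHat b * ‖d.H‖ ^ 2 := by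
    have e : valueAt d Z T = d.G1 T + d.Hᵀ * d.G2 T * d.H := by
      have e1 : valueAt d Z T = (Z T T).1 + (Z T T).2ᵀ * d.G2 T * (Z T T).2 := rfl
      have e2 := (h.solves.eq_pair hδ h.reg hT0 le_rfl le_rfl).2
      rw [intervalIntegral.integral_same, add_zero] at e2
      rw [e1, h.terminal hT0 le_rfl, e2]
    rw [e]
    refine (norm_add_le _ _).trans (add_le_add (norm_G1_le h.pos h.mono hT0 le_rfl) ?_)
    calc ‖d.Hᵀ * d.G2 T * d.H‖ ≤ ‖d.H‖ * ‖d.G2 T‖ * ‖d.H‖ := by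
          refine (Matrix.l2_opNorm_mul _ _).trans ?_
          gcongr
          refine (Matrix.l2_opNorm_mul _ _).trans ?_
          rw [Matrix.l2_opNorm_transpose]
      _ ≤ ‖d.H‖ * gHat b * ‖d.H‖ := by
          gcongr; exact norm_G2_le h.pos h.mono hT0 le_rfl
      _ = _ := by ring
  have tail : ∀ {f : ℝ → ℝ}, MemLp f ⊤ (volume.restrict (Icc 0 T)) → (∀ r, 0 ≤ f r) →
      ∫ r in t..T, f r ≤ ∫ r in (0 : ℝ)..T, f r := by
    intro f hf hf0
    rw [← intervalIntegral.integral_add_adjacent_intervals (hf.intervalIntegrable h0I htI)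
      (hf.intervalIntegrable htI hTI)]
    linarith [intervalIntegral.integral_nonneg (f := f) (μ := volume) h0 fun r _ => hf0 r]
  -- The argument yields `1 / δ` where the stated constant has `n / δ`. This suffices for `n ≥ 1`;
  -- for `n = 0` the value is an empty matrix.
  rcases Nat.eq_zero_or_pos n with hn | hn
  · subst hn
    have hz : valueAt d Z t = 0 := Subsingleton.elim _ _
    rw [hz, norm_zero, valueBound]
    have : 0 ≤ ∫ s in (0 : ℝ)..T, (‖b.Q‖ + gHat b ^ 2 * ‖d.Ah s‖ ^ 2) :=
      intervalIntegral.integral_nonneg hT0 fun r _ => by positivity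
    positivity
  · have hβ0 : 0 ≤ ∫ s in (0 : ℝ)..T, d.forcing b s :=
      intervalIntegral.integral_nonneg hT0 fun r _ => forcing_nonneg r
    refine hgron.trans ?_
    rw [valueBound]
    refine mul_le_mul (add_le_add hVT (tail mβ forcing_nonneg)) (Real.exp_le_exp.2 ?_)
      (Real.exp_pos _).le (by positivity)
    refine (tail mα (growth_nonneg hδ)).trans ?_
    have hn1 : (1 : ℝ) ≤ n := by exact_mod_cast hn
    refine intervalIntegral.integral_mono_on hT0 (mα.intervalIntegrable h0I hTI) ?_ fun r _ => ?_
    · have hm : MemLp (fun s => 2 * ‖d.A s‖ + ‖d.C s‖ ^ 2 + (n : ℝ) / δ * (1 + ‖b.M‖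
          + ‖b.N‖ * ‖d.C s‖ ^ 2 + 2 * gHat b * ‖d.Ch s‖ + 2 * gHat b * ‖d.C s‖ * ‖d.Dh s‖)) ⊤
          (volume.restrict (Icc 0 T)) := by
        -- The integrand of the stated constant is the growth rate with `δ / n` in place of `δ`.
        have := memLp_growth (δ := δ / n) (b := b) h.reg
        unfold growth at this
        simpa only [one_div_div] using this
      exact hm.intervalIntegrable h0I hTI
    · unfold growth
      gcongr

end Confined

end Truncation

end LQData

/-! ### Existence and uniqueness -/

namespace LQData

variable {n m k : ℕ} {δ K : ℝ} {d : LQData n m k} {T a : ℝ} {b : WeightBounds n m k}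

/-- A bound for the solution on the triangle that does not depend on the truncation. -/
noncomputable def radius (d : LQData n m k) (T δ : ℝ) (b : WeightBounds n m k) : ℝ :=
  max (d.valueBound T δ b) √(d.valueBound T δ b / δ)

namespace Truncation

variable {τ : Truncation n m k δ K} {Z : ℝ → ℝ → Unknown n m}

namespace Confined

/-- Both summands of the value are positive semidefinite, so each is dominated by it: this bounds
`P₁(s, s)`, hence `P₁(t, s)`, and by coercivity of `G₂` also `P₂(s)`. -/
lemma norm_le_radius (h : Confined τ d T a Z b) {t s : ℝ} (ht : 0 ≤ t) (hts : t ≤ s)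
    (has : a ≤ s) (hs : s ≤ T) : ‖Z t s‖ ≤ d.radius T δ b := by
  have hδ := h.pos.δ_pos
  have hs0 := ht.trans hts
  have hV : ‖valueAt d Z s‖ ≤ d.valueBound T δ b := h.norm_valueAt_le has hs
  have eV : valueAt d Z s = (Z s s).1 + (Z s s).2ᵀ * d.G2 s * (Z s s).2 := rfl
  have pP := h.posSemidef hs0 le_rfl has hs
  have pG : ((Z s s).2ᵀ * d.G2 s * (Z s s).2).PosSemidef :=
    (h.pos.G2_posSemidef hs0 hs).transpose_mul_mul _
  have e1 : ‖(Z t s).1‖ ≤ d.valueBound T δ b := by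
    refine ((h.posSemidef ht hts has hs).l2_opNorm_le_of_sub
      (h.sub_posSemidef ht hts le_rfl has hs)).trans ((pP.l2_opNorm_le_of_sub ?_).trans hV)
    rwa [eV, add_sub_cancel_left]
  have e2 : ‖(Z t s).2‖ ≤ √(d.valueBound T δ b / δ) := by
    rw [h.snd_eq ht hts hs]
    refine Real.le_sqrt_of_sq_le ((le_div_iff₀' hδ).2 ?_)
    refine (Matrix.mul_sq_l2_opNorm_le hδ (h.pos.G2 s hs0 hs) _).trans
      ((pG.l2_opNorm_le_of_sub ?_).trans hV)
    rwa [eV, add_sub_cancel_right]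
  exact max_le_max e1 e2

/-- At second time `a` the norm is at most the radius, and over a length `η` it grows by at most
`1`; hence the `+ 1` in the size of `K`. -/
lemma extend (h : Confined τ d T a Z b) (hK : d.radius T δ b + 1 ≤ K) {η : ℝ}
    (hη : ∀ t r s, 0 ≤ t → t ≤ r → r ≤ s → s ≤ T → s - r ≤ η → ‖Z t r - Z t s‖ ≤ 1) (haT : a ≤ T) :
    Confined τ d T (max 0 (a - η)) Z b where
  __ := h
  a_nonneg := le_max_left _ _
  norm_le t r ht htr har hr := by
    rcases le_total a r with hr' | hr'
    · exact h.norm_le t r ht htr hr' hr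
    have h1 := hη t r a ht htr hr' haT (by linarith [(le_max_right 0 (a - η)).trans har])
    have h2 := h.norm_le_radius ht (htr.trans hr') le_rfl haT
    calc ‖Z t r‖ = ‖(Z t r - Z t a) + Z t a‖ := by rw [sub_add_cancel]
      _ ≤ ‖Z t r - Z t a‖ + ‖Z t a‖ := norm_add_le _ _
      _ ≤ K := by linarith

/-- A solution that starts inside the region without truncation never leaves it, as the a priori
estimate keeps it away from the boundary. -/
lemma to_zero (h : Confined τ d T T Z b) (hK : d.radius T δ b + 1 ≤ K) : Confined τ d T 0 Z b := by
  have hT : 0 ≤ T := h.a_nonneg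
  obtain ⟨η, hη, H⟩ := Metric.uniformContinuousOn_iff.1
    ((isCompact_triangle T).uniformContinuousOn_of_continuous h.solves.cont) 1 one_pos
  -- The step length depends on the modulus of continuity of `Z` alone, not on `a`, so finitely many
  -- steps cover `[0, T]`. Halving `η` turns the weak inequality into the strict one of uniform
  -- continuity.
  have step : ∀ t r s, 0 ≤ t → t ≤ r → r ≤ s → s ≤ T → s - r ≤ η / 2 → ‖Z t r - Z t s‖ ≤ 1 := by
    intro t r s ht htr hrs hs hd
    rw [← dist_eq_norm]
    refine (H (t, r) ⟨ht, htr, hrs.trans hs⟩ (t, s) ⟨ht, htr.trans hrs, hs⟩ ?_).le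
    rw [Prod.dist_eq, dist_self, Real.dist_eq, abs_sub_comm, abs_of_nonneg (sub_nonneg.2 hrs)]
    exact max_lt hη (by linarith)
  have key : ∀ j : ℕ, Confined τ d T (max 0 (T - j * (η / 2))) Z b := by
    intro j
    induction j with
    | zero => simpa [max_eq_right hT] using h
    | succ j ih =>
      have := ih.extend hK step (max_le hT
        (by nlinarith [show 0 ≤ (j : ℝ) * (η / 2) by positivity]))
      convert this using 1
      push_cast
      rcases le_total 0 (T - j * (η / 2)) with h0 | h0
      · rw [max_eq_right h0]; congr 1; ring
      · rw [max_eq_left h0, max_eq_left (by linarith), max_eq_left (by linarith)]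
  obtain ⟨j, hj⟩ := exists_nat_gt (T / (η / 2))
  have hj' := (div_lt_iff₀ (by positivity)).1 hj
  simpa [max_eq_left (sub_nonpos.2 hj'.le)] using key j

lemma isSolution (h : Confined τ d T 0 Z b) (hT : 0 ≤ T) :
    d.IsSolution T (fun t s => (Z t s).1) (fun s => (Z s s).2) := by
  have hδ := h.pos.δ_pos
  have e₂ : ∀ᵐ r ∂volume.restrict (Icc 0 T), (τ.diagAt d Z r).rhs₂ =
      d.rhs₂ (fun s => (Z s s).2) (d.feedback (fun t s => (Z t s).1) (fun s => (Z s s).2)) r := by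
    filter_upwards [h.diag_eq] with r hr
    rw [rhs₂_eq, hr.2]
  have e₁ : ∀ t, 0 ≤ t → ∀ᵐ r ∂volume.restrict (Icc t T),
      Config.rhs₁ (τ.offAt d Z t r) (τ.diagAt d Z r) =
      d.rhs₁ (fun t s => (Z t s).1) (fun s => (Z s s).2)
        (d.feedback (fun t s => (Z t s).1) (fun s => (Z s s).2)) t r := by
    intro t ht
    filter_upwards [ae_restrict_mono_Icc h.diag_eq ht le_rfl,
      ae_restrict_mono_Icc h.off_eq ht le_rfl, ae_restrict_mem measurableSet_Icc] with r h1 h2 hr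
    rw [rhs₁_eq _ _ _ _ _ (Z t r).2, h1.2, h2 t ⟨ht, hr.1⟩]
  have hmem : ∀ {E : Type} [NormedAddCommGroup E] {f g : ℝ → E} {t : ℝ}, t ≤ T →
      MemLp f ⊤ (volume.restrict (Icc t T)) → (∀ᵐ r ∂volume.restrict (Icc t T), f r = g r) →
      IntervalIntegrable g volume t T := fun htT hf hfg =>
    (hf.ae_eq hfg).intervalIntegrable ⟨le_rfl, htT⟩ ⟨htT, le_rfl⟩
  have hint : ∀ {E : Type} [NormedAddCommGroup E] [NormedSpace ℝ E] {f g : ℝ → E} {t s : ℝ},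
      t ≤ s → s ≤ T → (∀ᵐ r ∂volume.restrict (Icc t T), f r = g r) →
      ∫ r in s..T, f r = ∫ r in s..T, g r := by
    intro E _ _ f g t s hts hs hfg
    refine intervalIntegral.integral_congr_ae ?_
    filter_upwards [ae_of_ae_restrict_Icc hfg] with r hr hr2
    rw [uIoc_of_le hs] at hr2
    exact hr ⟨hts.trans hr2.1.le, hr2.2⟩
  refine ⟨h.solves.cont.fst, ?_, fun t s ht hts hs => h.posSemidef ht hts (ht.trans hts) hs,
    fun s hs => ?_, fun t ht => ?_, ?_, fun t s ht hts hs => ?_, fun s hs => ?_⟩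
  · exact (h.solves.continuousOn_comp continuousOn_id fun _ hr => ⟨hr.1, le_rfl⟩).snd
  · refine (Matrix.posDef_of_sub_smul_one hδ (Matrix.sub_smul_one_posSemidef_add
      (h.pos.R s s hs.1 le_rfl hs.2) (Matrix.PosSemidef.transpose_mul_mul ?_ _))).isUnit
    exact (h.posSemidef hs.1 le_rfl hs.1 hs.2).add
      ((h.pos.N s s hs.1 le_rfl hs.2).transpose_mul_mul _)
  · exact hmem ht.2 (h.solves.memLp_off h.reg (bddLip_rhs₁ hδ) ht.1 le_rfl) (e₁ t ht.1)
  · exact hmem hT (h.solves.memLp_diag h.reg (bddLip_rhs₂ hδ) le_rfl) e₂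
  · rw [(h.solves.eq_pair hδ h.reg ht hts hs).1, hint hts hs (e₁ t ht)]
  · rw [(h.solves.eq_pair hδ h.reg hs.1 le_rfl hs.2).2, hint hs.1 hs.2 e₂]

end Confined

end Truncation

/-! ### Uniqueness by reduction to a common truncated system. -/

section Uniqueness

variable {P₁ : ℝ → ℝ → Matrix (Fin n) (Fin n) ℝ} {P₂ : ℝ → Matrix (Fin m) (Fin n) ℝ}

lemma IsSolution.continuousOn_pair (h : d.IsSolution T P₁ P₂) :
    ContinuousOn (Function.uncurry fun t s => ((P₁ t s, P₂ s) : Unknown n m)) (triangle T) :=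
  h.continuousOn₁.prodMk (h.continuousOn₂.comp continuousOn_snd
    fun _ hp => ⟨hp.1.trans hp.2.1, hp.2.2⟩)

lemma IsSolution.exists_norm_le (h : d.IsSolution T P₁ P₂) :
    ∃ c, ∀ t s, 0 ≤ t → t ≤ s → s ≤ T → ‖((P₁ t s, P₂ s) : Unknown n m)‖ ≤ c := by
  obtain ⟨c, hc⟩ := (isCompact_triangle T).exists_bound_of_continuousOn h.continuousOn_pair
  exact ⟨c, fun t s ht hts hs => hc (t, s) ⟨ht, hts, hs⟩⟩

/-- A solution solves every truncated system whose region without truncation contains it. -/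
lemma IsSolution.solves (h : d.IsSolution T P₁ P₂) (τ : Truncation n m k δ K)
    (hpos : d.Positive T δ)
    (hc : ∀ᵐ r ∂volume.restrict (Icc 0 T), ∀ t ∈ Icc 0 T, ‖d.coeff t r‖ ≤ K)
    (hb : ∀ t s, 0 ≤ t → t ≤ s → s ≤ T → ‖((P₁ t s, P₂ s) : Unknown n m)‖ ≤ K) :
    τ.Solves d T fun t s => (P₁ t s, P₂ s) where
  cont := h.continuousOn_pair
  eq t s ht hts hs := by
    have hs0 := ht.trans hts
    set f₁ := d.rhs₁ P₁ P₂ (d.feedback P₁ P₂) t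
    set f₂ := d.rhs₂ P₂ (d.feedback P₁ P₂)
    have i₁ : IntervalIntegrable f₁ volume s T := (h.integrable₁ t ⟨ht, hts.trans hs⟩).mono_set
      (by rw [uIcc_of_le hs, uIcc_of_le (hts.trans hs)]; exact Icc_subset_Icc_left hts)
    have i₂ : IntervalIntegrable f₂ volume s T := h.integrable₂.mono_set
      (by rw [uIcc_of_le hs, uIcc_of_le (hs0.trans hs)]; exact Icc_subset_Icc_left hs0)
    have i : IntervalIntegrable (fun r => ((f₁ r, f₂ r) : Unknown n m)) volume s T :=
      ⟨i₁.1.prodMk i₂.1, i₁.2.prodMk i₂.2⟩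
    have e : ∫ r in s..T, τ.rhs ((d.coeff t r, (P₁ t r, P₂ r)), (d.coeff r r, (P₁ r r, P₂ r)))
        = ∫ r in s..T, ((f₁ r, f₂ r) : Unknown n m) := by
      refine intervalIntegral.integral_congr_ae ?_
      filter_upwards [ae_of_ae_restrict_Icc hc] with r hr hr2
      rw [uIoc_of_le hs] at hr2
      have hsr := hr2.1.le
      have hr0 := hs0.trans hsr
      have e₁ : τ.off (d.coeff t r, (P₁ t r, P₂ r)) = (d.coeff t r, (P₁ t r, P₂ r)) :=
        τ.off_eq _ (max_le (hr ⟨hr0, hr2.2⟩ t ⟨ht, hts.trans hs⟩)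
          (hb t r ht (hts.trans hsr) hr2.2))
      have e₂ : τ.diag (d.coeff r r, (P₁ r r, P₂ r)) = (d.coeff r r, (P₁ r r, P₂ r)) :=
        τ.diag_eq _ ⟨max_le (hr ⟨hr0, hr2.2⟩ r ⟨hr0, hr2.2⟩) (hb r r hr0 le_rfl hr2.2),
          hpos.R r r hr0 le_rfl hr2.2, hpos.N r r hr0 le_rfl hr2.2,
          h.posSemidef r r hr0 le_rfl hr2.2⟩
      simp only [Truncation.rhs, e₁, e₂, f₁, f₂]
      rw [rhs₁_eq _ _ _ _ _ (P₂ r), rhs₂_eq _ P₁]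
    have c₁ := intervalIntegral_linearMap_comm
      (LinearMap.fst ℝ (Matrix (Fin n) (Fin n) ℝ) (Matrix (Fin m) (Fin n) ℝ)) i
    have c₂ := intervalIntegral_linearMap_comm
      (LinearMap.snd ℝ (Matrix (Fin n) (Fin n) ℝ) (Matrix (Fin m) (Fin n) ℝ)) i
    rw [e]
    refine Prod.ext ((h.eq₁ t s ht hts hs).trans (congrArg (d.G1 t + ·) c₁))
      ((h.eq₂ s ⟨hs0, hs⟩).trans (congrArg (d.H + ·) c₂))

/-- Both solutions are bounded on the compact triangle. One `K` above both bounds and that of the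
coefficients makes them solutions of the same truncated system. -/
lemma IsSolution.unique (hpos : d.Positive T δ) (hreg : d.Regular T) (hT : 0 ≤ T)
    {P₁' : ℝ → ℝ → Matrix (Fin n) (Fin n) ℝ} {P₂' : ℝ → Matrix (Fin m) (Fin n) ℝ}
    (h' : d.IsSolution T P₁' P₂') (h : d.IsSolution T P₁ P₂) :
    (∀ t s, 0 ≤ t → t ≤ s → s ≤ T → P₁' t s = P₁ t s) ∧ ∀ s ∈ Icc 0 T, P₂' s = P₂ s := by
  obtain ⟨Λ, hΛ⟩ := hreg.exists_norm_coeff_le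
  obtain ⟨c, hc⟩ := h.exists_norm_le
  obtain ⟨c', hc'⟩ := h'.exists_norm_le
  obtain ⟨τ⟩ := nonempty_truncation (n := n) (m := m) (k := k) (K := max (max δ Λ) (max c c'))
    hpos.δ_pos.le ((le_max_left _ _).trans (le_max_left _ _))
  have hco : ∀ᵐ r ∂volume.restrict (Icc 0 T), ∀ t ∈ Icc 0 T,
      ‖d.coeff t r‖ ≤ max (max δ Λ) (max c c') := by
    filter_upwards [hΛ] with r hr t ht
    exact (hr t ht).trans ((le_max_right _ _).trans (le_max_left _ _))
  obtain ⟨Z, -, hZ⟩ := τ.exists_unique_solves hpos.δ_pos hT hreg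
  have s := hZ _ (h.solves τ hpos hco fun t s ht hts hs =>
    (hc t s ht hts hs).trans ((le_max_left _ _).trans (le_max_right _ _)))
  have s' := hZ _ (h'.solves τ hpos hco fun t s ht hts hs =>
    (hc' t s ht hts hs).trans ((le_max_right _ _).trans (le_max_right _ _)))
  have key : ∀ t r, 0 ≤ t → t ≤ r → r ≤ T → (P₁' t r, P₂' r) = (P₁ t r, P₂ r) :=
    fun t r ht htr hr => (s' t r ht htr hr).trans (s t r ht htr hr).symm
  exact ⟨fun t r ht htr hr => congrArg Prod.fst (key t r ht htr hr),
    fun r hr => congrArg Prod.snd (key r r hr.1 le_rfl hr.2)⟩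

end Uniqueness

lemma exists_confined (hT : 0 ≤ T) (hreg : d.Regular T) (hpos : d.Positive T δ)
    (hmono : d.Monotone T b) :
    ∃ (K : ℝ) (τ : Truncation n m k δ K) (Z : ℝ → ℝ → Unknown n m), τ.Confined d T 0 Z b := by
  obtain ⟨Λ, hΛ⟩ := hreg.exists_norm_coeff_le
  -- `δ` makes the admissible set nonempty, `Λ` leaves the coefficients untruncated, the radius plus
  -- one allows the extension to the left, and the last two entries contain the terminal values.
  set K := max (max δ Λ) (max (d.radius T δ b + 1) (max (gHat b) ‖d.H‖)) with hK
  obtain ⟨τ⟩ := nonempty_truncation (n := n) (m := m) (k := k) (K := K)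
    hpos.δ_pos.le ((le_max_left _ _).trans (le_max_left _ _))
  obtain ⟨Z, hZ, -⟩ := τ.exists_unique_solves hpos.δ_pos hT hreg
  have hK2 : max (gHat b) ‖d.H‖ ≤ K := (le_max_right _ _).trans (le_max_right _ _)
  refine ⟨K, τ, Z, Truncation.Confined.to_zero ?_ ((le_max_left _ _).trans (le_max_right _ _))⟩
  -- Confinement starts at `a = T`, where only the terminal values have to be bounded.
  refine ⟨hZ, hreg, hpos, hmono, hT, ?_, fun t r ht htr hTr hrT => ?_⟩
  · filter_upwards [hΛ] with r hr t ht
    exact (hr t ht).trans ((le_max_right _ _).trans (le_max_left _ _))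
  · obtain rfl := le_antisymm hrT hTr
    refine le_trans ?_ hK2
    rw [hZ.eq t r ht htr le_rfl, intervalIntegral.integral_same, add_zero]
    exact max_le_max (norm_G1_le hpos hmono ht htr) le_rfl

end LQData

theorem theorem1p1 (n m k : ℕ) (T δ : ℝ) (hT : 0 < T)
    (d : LQData n m k) (b : WeightBounds n m k)
    (h1 : d.Regular T) (h2 : d.Positive T δ) (h3 : d.Monotone T b) :
    ∃ (P₁ : ℝ → ℝ → Matrix (Fin n) (Fin n) ℝ) (P₂ : ℝ → Matrix (Fin m) (Fin n) ℝ),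
      d.IsSolution T P₁ P₂ ∧
      (∀ (P₁' : ℝ → ℝ → Matrix (Fin n) (Fin n) ℝ) (P₂' : ℝ → Matrix (Fin m) (Fin n) ℝ),
        d.IsSolution T P₁' P₂' →
          (∀ t s, 0 ≤ t → t ≤ s → s ≤ T → P₁' t s = P₁ t s) ∧
          (∀ s ∈ Set.Icc 0 T, P₂' s = P₂ s)) ∧
      (∀ t ∈ Set.Icc 0 T,
        ‖P₁ t t + (P₂ t)ᵀ * d.G2 t * P₂ t‖ ≤ d.valueBound T δ b) := by
  obtain ⟨K, τ, Z, h⟩ := LQData.exists_confined hT.le h1 h2 h3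
  exact ⟨_, _, h.isSolution hT.le,
    fun _ _ h' => LQData.IsSolution.unique h2 h1 hT.le h' (h.isSolution hT.le),
    fun t ht => h.norm_valueAt_le ht.1 ht.2⟩
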